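/- **Theorem 5.1.** A *class of labelled objects* assigns to every finite set $S$ of labels a finite set of objects with label set exactly $S$, and is closed under relabelling (bijections between label sets transport objects functorially). The size of an object is its number of labels (possibly $0$). For a class $\mathcal C$ write $\mathcal C_n$ for its set of objects with label set $\{1,\dots,n\}$, $C(x)=\sum_{n\ge 0}|\mathcal C_n|\,x^n/n!$ for its exponential generating function, and $\rho(\mathcal C)\in[0,\infty]$ for the radius of convergence of $C$. Call a node of a tree a *leaf* if its degree is at most one, and *internal* otherwise. Given classes $\mathcal D,\mathcal I,\mathcal L$ of labelled objects, let $\mathcal A=\mathcal T(\mathcal D,\mathcal I,\mathcal L)$ be the class of all tuples $\alpha=(T,(D_e)_{e\in E(T)},(I_v)_{v\text{ internal}},(L_v)_{v\text{ leaf}})$, where $T=T(\alpha)$ is a non-empty labelled (Cayley) tree, $D_e\in\mathcal D$ for each edge $e$, $I_v\in\mathcal I$ for each internal node $v$ and $L_v\in\mathcal L$ for each leaf $v$, and the label sets of $T$ (i.e. $V(T)$) and of all the attached objects are pairwise disjoint; the label set of $\alpha$ is their union. Let $\mathcal A'=\mathcal R(\mathcal D,\mathcal I,\mathcal L)$ be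 defined in the same way from rooted Cayley trees, i.e. with one node of $T$ distinguished as the root (a root of degree at most one is still a leaf). Let $\mathcal D,\mathcal I,\mathcal L$ be non-empty classes of labelled objects. Suppose that $\rho:=\rho(\mathcal A)<\min(\rho(\mathcal D),\rho(\mathcal I),\rho(\mathcal L))$ and that there are positive integers $i,j,k$ with $\gcd(k-i,j-i)=1$ such that $\mathcal A$ contains an object of each of the sizes $i$, $j$ and $k$. Then there are constants $a>0$ and $c>0$ such that the following holds. 1. Let $R_n$ be uniformly random in $\mathcal A_n'$, or uniformly random in $\mathcal A_n$, and let $Y_n=|V(T(R_n))|$. In both cases, for every $\varepsilon>0$, $$\mathbb P\left(\left|\frac{Y_n}{n}-a\right|>\varepsilon\right)=e^{-\Omega(n)},$$ that is, there is $\kappa=\kappa(\varepsilon)>0$ such that the probability is at most $e^{-\kappa n}$ for all sufficiently large $n$. 2. As $n\to\infty$, $$|\mathcal A_n|=(1+o(1))\,(an)^{-1}|\mathcal A_n'|=(1+o(1))\,c\,a^{-1}n^{-5/2}\,n!\,\rho^{-n}.$$ 3. The series $A(x)$ and $A'(x)$ converge at $x=\rho$. -/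

import Mathlib

open Filter Asymptotics

universe u v w

/-- A class of labelled objects closed under relabelling: every finite label set `S` carries a
finite set `Obj S` of objects whose set of labels is exactly `S`, and a bijection of label sets
transports objects functorially. The size of an object in `Obj S` is the number of labels, so
objects of size `0` are allowed. -/
structure LabelledClass where
  Obj : Finset ℕ → Type u
  finite : ∀ S, Finite (Obj S)
  relabel : ∀ {S T : Finset ℕ}, (S ≃ T) → Obj S → Obj T
  relabel_refl : ∀ (S : Finset ℕ) (x : Obj S), relabel (Equiv.refl S) x = x
  relabel_trans : ∀ {S T U : Finset ℕ} (f : S ≃ T) (g : T ≃ U) (x : Obj S),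
    relabel (f.trans g) x = relabel g (relabel f x)

/-- The class contains some object. -/
def LabelledClass.IsNonempty (C : LabelledClass.{u}) : Prop :=
  ∃ S, Nonempty (C.Obj S)

/-- The objects of size `n` with labels `{1, …, n}`, for a family of objects indexed by their
label sets. -/
abbrev OfSize (F : Finset ℕ → Type u) (n : ℕ) : Type u :=
  F (Finset.Icc 1 n)

/-- The number of objects with labels `{1, …, n}`. -/
noncomputable def count (F : Finset ℕ → Type u) (n : ℕ) : ℕ :=
  Nat.card (OfSize F n)

/-- The coefficient of `x ^ n` in the exponential generating function. -/
noncomputable def egfCoeff (F : Finset ℕ → Type u) (n : ℕ) : ℝ :=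
  (count F n : ℝ) / (n.factorial : ℝ)

/-- The radius of convergence of the exponential generating function. -/
noncomputable def egfRadius (F : Finset ℕ → Type u) : ENNReal :=
  (FormalMultilinearSeries.ofScalars ℝ (egfCoeff F)).radius

open scoped Classical in
/-- A node of a tree is a leaf if its degree is at most one (so the node of the one-vertex tree is
a leaf); otherwise it is internal. -/
def IsLeafNode {V : Finset ℕ} (T : SimpleGraph V) (v : V) : Prop :=
  T.degree v ≤ 1

/-- The objects with label set `S` obtained from unrooted Cayley trees by attaching an object of
`D` to each edge, of `I` to each internal node and of `L` to each leaf. The tree itself uses the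
labels in `verts`, the object attached to a node or an edge `x` uses the labels in `labels x`, and
all these label sets are pairwise disjoint with union `S`. -/
structure TreeObj (D : LabelledClass.{u}) (I : LabelledClass.{v}) (L : LabelledClass.{w})
    (S : Finset ℕ) : Type (max u v w) where
  verts : Finset ℕ
  tree : SimpleGraph verts
  isTree : tree.IsTree
  labels : verts ⊕ tree.edgeSet → Finset ℕ
  edgeObj : ∀ e : tree.edgeSet, D.Obj (labels (Sum.inr e))
  internalObj : ∀ x : verts, ¬ IsLeafNode tree x → I.Obj (labels (Sum.inl x))
  leafObj : ∀ x : verts, IsLeafNode tree x → L.Obj (labels (Sum.inl x))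
  disjoint_verts : ∀ x, Disjoint verts (labels x)
  disjoint_labels : ∀ x y, x ≠ y → Disjoint (labels x) (labels y)
  mem_iff : ∀ l : ℕ, l ∈ S ↔ l ∈ verts ∨ ∃ x, l ∈ labels x

/-- The same construction over rooted Cayley trees: the underlying tree has in addition a
distinguished node. Leaves and internal nodes are still told apart by their degree in the tree. -/
structure RootedTreeObj (D : LabelledClass.{u}) (I : LabelledClass.{v}) (L : LabelledClass.{w})
    (S : Finset ℕ) : Type (max u v w) extends TreeObj D I L S where
  root : verts

/-- The number of nodes of the underlying tree. -/
def TreeObj.treeSize {D : LabelledClass.{u}} {I : LabelledClass.{v}} {L : LabelledClass.{w}}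
    {S : Finset ℕ} (α : TreeObj D I L S) : ℕ :=
  α.verts.card

/-- The probability that a uniformly random element of a finite non-empty type satisfies `p`. -/
noncomputable def uniformProb {Ω : Type u} (p : Ω → Prop) : ℝ :=
  (Nat.card {x : Ω // p x} : ℝ) / (Nat.card Ω : ℝ)

/-- `f n = e ^ {-Ω(n)}` for a nonnegative sequence `f`. -/
def ExpSmall (f : ℕ → ℝ) : Prop :=
  ∃ κ : ℝ, 0 < κ ∧ ∀ᶠ n : ℕ in atTop, f n ≤ Real.exp (-(κ * (n : ℝ)))

/-!
Write `D`, `I`, `L` for the exponential generating functions of the three classes. The argument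
passes from the combinatorial classes to an explicit bivariate power series, and from there to
analysis at the dominant singularity.

*Counting.* In a tree on `m ≥ 2` vertices a prescribed set `W` consists of leaves for
`(m - |W|) ^ (m - 2)` of the trees (`treesWithLeaves_eq`), so the trees, weighted by `a` for each
leaf and `b` for each internal node, have the same total weight as the maps
`Fin (m - 2) → Fin m`, weighted by `b` for each point of the range and `a` for each other point
(`sum_trees_prod`, `rangeWeight`). With the product rule for labelled objects this gives the number
of tree objects with `n` labels and `m` nodes as a coefficient of `D ^ (m - 1)` times that weight
at `L`, `I` (`card_treeObj`, `card_rootedTreeObj`).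

*Analysis.* Put `u = x D (L - I)` and `h = x D I exp u`. The rooted series is
`R = (1 + u) (x (L - I) + x I exp u exp V)`, where `V` has nonnegative coefficients and satisfies
`V = h exp V`. These identities are verified for small positive `x` by the classical expansion of
the tree function and extended by the identity theorem. If `ψ t z = t D (L + I (exp z - 1))`, then
an inequality `ψ t z < z` bounds the rooted series at `t` by a geometric series. It follows that
`ψ ρ z ≥ z` for all `z > 0`, which forces `V < 1` below `ρ` and `V ρ = 1`
(`Subcritical.branch_lt_one`, `Subcritical.branch_eq_one`). Since `D`, `I`, `L` are analytic beyond
`ρ`, the function `V` has a square root singularity there, and by the condition on the gcd it has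
no other singularity on the circle. A transfer theorem (`tendsto_coeff_div_sqrt`) applied to `R''`
gives `[x ^ n] R ~ c n ^ (-3 / 2) ρ ^ (-n)`
(`exists_tendsto_coeff_of_sqrt_singularity`, `Subcritical.exists_tendsto_rootedTotal`).

*Concentration.* The same geometric bound, at `z = τ = u ρ + 1` with `ψ ρ τ = τ` and at the tilted
argument `t = ρ exp s`, is a Chernoff bound for the number of nodes
(`Subcritical.mul_treeTerm_le_exp`); optimising over small `s` shows that it concentrates at `a n`
with `a = τ / (ρ ∂ₜψ ρ τ)`. The remaining claims compare rooted with unrooted objects, a tree with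
`m` nodes having `m` rootings.
-/

/-! ### Trees with prescribed leaves -/

/-- A vertex with at most one neighbour. For finite graphs this is the condition `IsLeafNode` on the
degree, in a form that needs no decidability. -/
def IsEndVertex {V : Type*} (G : SimpleGraph V) (v : V) : Prop :=
  (G.neighborSet v).Subsingleton

lemma isEndVertex_iff_degree_le_one {V : Type*} (G : SimpleGraph V) (v : V)
    [Fintype (G.neighborSet v)] : IsEndVertex G v ↔ G.degree v ≤ 1 := by
  rw [IsEndVertex, ← SimpleGraph.card_neighborSet_eq_degree, Fintype.card_le_one_iff_subsingleton,
    Set.subsingleton_coe]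

lemma isLeafNode_iff {V : Finset ℕ} (T : SimpleGraph V) (v : V) :
    IsLeafNode T v ↔ IsEndVertex T v := by
  classical
  rw [IsLeafNode, isEndVertex_iff_degree_le_one]

/-- The graph on `V` obtained from a graph on `V ∖ {w}` by joining `w` to the single vertex `p`. -/
def attachLeaf {V : Type*} (w : V) (G : SimpleGraph ({w}ᶜ : Set V)) (p : ({w}ᶜ : Set V)) :
    SimpleGraph V :=
  G.map (Function.Embedding.subtype _) ⊔ SimpleGraph.edge w p

section attachLeaf

variable {V : Type*} {w : V} {G : SimpleGraph ({w}ᶜ : Set V)} {p : ({w}ᶜ : Set V)}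

lemma attachLeaf_adj {a b : V} : (attachLeaf w G p).Adj a b ↔
    (∃ (ha : a ∈ ({w}ᶜ : Set V)) (hb : b ∈ ({w}ᶜ : Set V)), G.Adj ⟨a, ha⟩ ⟨b, hb⟩) ∨
      (a = w ∧ b = p) ∨ (a = p ∧ b = w) := by
  have hp : (p : V) ≠ w := p.2
  rw [attachLeaf, SimpleGraph.sup_adj, SimpleGraph.edge_adj, SimpleGraph.map_adj]
  constructor
  · rintro (⟨x, y, h, rfl, rfl⟩ | ⟨h, -⟩)
    · exact Or.inl ⟨x.2, y.2, h⟩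
    · exact Or.inr h
  · rintro (⟨ha, hb, h⟩ | h)
    · exact Or.inl ⟨_, _, h, rfl, rfl⟩
    · refine Or.inr ⟨h, ?_⟩
      rcases h with ⟨rfl, rfl⟩ | ⟨rfl, rfl⟩
      · exact hp.symm
      · exact hp

lemma attachLeaf_adj_self {b : V} : (attachLeaf w G p).Adj w b ↔ b = p := by
  have hp : (p : V) ≠ w := p.2
  rw [attachLeaf_adj]
  constructor
  · rintro (⟨ha, -, -⟩ | ⟨-, h⟩ | ⟨h, -⟩)
    · exact absurd rfl ha
    · exact h
    · exact absurd h.symm hp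
  · rintro rfl
    exact Or.inr (Or.inl ⟨rfl, rfl⟩)

lemma attachLeaf_adj_coe {a b : ({w}ᶜ : Set V)} : (attachLeaf w G p).Adj a b ↔ G.Adj a b := by
  have ha : (a : V) ≠ w := a.2
  have hb : (b : V) ≠ w := b.2
  rw [attachLeaf_adj]
  simp [ha, hb]

lemma induce_attachLeaf : (attachLeaf w G p).induce ({w}ᶜ : Set V) = G := by
  ext a b
  exact attachLeaf_adj_coe

lemma attachLeaf_injective {G' : SimpleGraph ({w}ᶜ : Set V)} {p' : ({w}ᶜ : Set V)}
    (h : attachLeaf w G p = attachLeaf w G' p') : G = G' ∧ p = p' := by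
  refine ⟨by rw [← induce_attachLeaf (G := G) (p := p), h, induce_attachLeaf], ?_⟩
  have := (attachLeaf_adj_self (w := w) (G := G) (p := p) (b := p)).2 rfl
  rw [h, attachLeaf_adj_self] at this
  exact Subtype.ext this

lemma attachLeaf_connected (hG : G.Connected) : (attachLeaf w G p).Connected := by
  have key : ∀ x, (attachLeaf w G p).Reachable p x := by
    intro x
    by_cases hx : x = w
    · subst hx
      exact (attachLeaf_adj_self.2 rfl).symm.reachable
    · let f : G →g attachLeaf w G p := ⟨Subtype.val, fun h => attachLeaf_adj_coe.2 h⟩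
      exact (hG.preconnected p ⟨x, hx⟩).map f
  have : Nonempty V := ⟨w⟩
  exact ⟨fun x y => (key x).symm.trans (key y)⟩

lemma attachLeaf_edgeSet : (attachLeaf w G p).edgeSet =
    insert s(w, (p : V)) ((Function.Embedding.subtype _).sym2Map '' G.edgeSet) := by
  have hp : w ≠ p := fun h => p.2 h.symm
  rw [attachLeaf, SimpleGraph.edgeSet_sup, SimpleGraph.edgeSet_map,
    SimpleGraph.edgeSet_edge_of_ne hp, Set.union_comm, Set.singleton_union]

lemma attachLeaf_isTree [Finite V] (hG : G.IsTree) : (attachLeaf w G p).IsTree := by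
  classical
  have := Fintype.ofFinite V
  rw [SimpleGraph.isTree_iff_connected_and_card] at hG ⊢
  refine ⟨attachLeaf_connected hG.1, ?_⟩
  have h1 : Nat.card ({w}ᶜ : Set V) + 1 = Nat.card V := by
    have := Set.ncard_add_ncard_compl ({w} : Set V)
    rw [Set.ncard_singleton, add_comm] at this
    exact this
  have h2 : Nat.card (attachLeaf w G p).edgeSet = Nat.card G.edgeSet + 1 := by
    rw [attachLeaf_edgeSet, Nat.card_coe_set_eq, Set.ncard_insert_of_notMem,
      Set.ncard_image_of_injective _ (Function.Embedding.injective _), Nat.card_coe_set_eq]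
    · rintro ⟨e, he, h⟩
      induction e with
      | _ x y =>
        have hx : (x : V) ≠ w := x.2
        have hy : (y : V) ≠ w := y.2
        simp only [Function.Embedding.sym2Map_apply, Sym2.map_mk, Function.Embedding.subtype_apply,
          Sym2.eq_iff] at h
        rcases h with ⟨h, -⟩ | ⟨-, h⟩
        · exact hx h
        · exact hy h
  rw [h2, hG.2, h1]

lemma isEndVertex_attachLeaf_self : IsEndVertex (attachLeaf w G p) w := by
  intro a ha b hb
  rw [attachLeaf_adj_self.1 ha, attachLeaf_adj_self.1 hb]

lemma isEndVertex_attachLeaf {x : ({w}ᶜ : Set V)} (hx : IsEndVertex G x) (hxp : x ≠ p) :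
    IsEndVertex (attachLeaf w G p) x := by
  have key : ∀ a, (attachLeaf w G p).Adj x a → ∃ ha : a ∈ ({w}ᶜ : Set V), G.Adj x ⟨a, ha⟩ := by
    intro a ha
    rw [attachLeaf_adj] at ha
    rcases ha with ⟨_, h, h'⟩ | ⟨h, -⟩ | ⟨h, -⟩
    · exact ⟨h, h'⟩
    · exact absurd h x.2
    · exact absurd (Subtype.ext h) hxp
  intro a ha b hb
  obtain ⟨ha', ha⟩ := key a ha
  obtain ⟨hb', hb⟩ := key b hb
  exact congrArg Subtype.val (hx ha hb)

end attachLeaf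

lemma exists_eq_attachLeaf {V : Type*} [Finite V] (h3 : 3 ≤ Nat.card V) {T : SimpleGraph V}
    (hT : T.IsTree) {w : V} (hw : IsEndVertex T w) :
    ∃ (G : SimpleGraph ({w}ᶜ : Set V)) (p : ({w}ᶜ : Set V)), G.IsTree ∧ attachLeaf w G p = T ∧
      (∀ x : ({w}ᶜ : Set V), IsEndVertex T x → IsEndVertex G x ∧ x ≠ p) := by
  classical
  have := Fintype.ofFinite V
  have : Nontrivial V := by
    rw [← Finite.one_lt_card_iff_nontrivial]; omega
  obtain ⟨p, hp⟩ := hT.connected.preconnected.exists_adj_of_nontrivial w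
  have hdeg : T.degree w = 1 := by
    have h1 := (isEndVertex_iff_degree_le_one T w).1 hw
    have h2 := hT.connected.preconnected.degree_pos_of_nontrivial w
    omega
  have hc := hT.connected.induce_compl_singleton_of_degree_eq_one hdeg
  have hpw : p ∈ ({w}ᶜ : Set V) := hp.ne'
  have h1 : Nat.card ({w}ᶜ : Set V) + 1 = Nat.card V := by
    have := Set.ncard_add_ncard_compl ({w} : Set V)
    rw [Set.ncard_singleton, add_comm] at this
    exact this
  have : Nontrivial ({w}ᶜ : Set V) := by
    rw [← Finite.one_lt_card_iff_nontrivial]; omega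
  refine ⟨T.induce {w}ᶜ, ⟨p, hpw⟩, ⟨hc, hT.isAcyclic.induce _⟩, ?_, ?_⟩
  · ext a b
    rw [attachLeaf_adj]
    constructor
    · rintro (⟨_, _, h⟩ | ⟨rfl, rfl⟩ | ⟨rfl, rfl⟩)
      · exact h
      · exact hp
      · exact hp.symm
    · intro h
      by_cases ha : a = w
      · subst ha
        exact Or.inr (Or.inl ⟨rfl, hw h hp⟩)
      · by_cases hb : b = w
        · subst hb
          exact Or.inr (Or.inr ⟨hw h.symm hp, rfl⟩)
        · exact Or.inl ⟨ha, hb, h⟩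
  · intro x hx
    refine ⟨fun a ha b hb => Subtype.ext (hx ha hb), ?_⟩
    rintro rfl
    -- a neighbour of `w` has a second neighbour, since three vertices remain connected
    obtain ⟨y, hy⟩ := hc.preconnected.exists_adj_of_nontrivial (⟨p, hpw⟩ : ({w}ᶜ : Set V))
    exact y.2 (hx (show T.Adj p y from hy) hp.symm)

/-- The number of trees on `V` all of whose vertices in `W` are leaves. -/
noncomputable def treesWithLeaves (V : Type*) (W : Finset V) : ℕ :=
  Nat.card {T : SimpleGraph V // T.IsTree ∧ ∀ x ∈ W, IsEndVertex T x}

/-- Removing the leaf `w`: its neighbour can be any vertex outside `W`, since in a tree on at least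
three vertices two leaves are not adjacent. -/
lemma treesWithLeaves_of_mem {V : Type*} [Fintype V] [DecidableEq V] (h3 : 3 ≤ Fintype.card V)
    (W : Finset V) {w : V} (hw : w ∈ W) :
    treesWithLeaves V W = treesWithLeaves ({w}ᶜ : Set V) (W.subtype (· ∈ ({w}ᶜ : Set V))) *
      (Fintype.card V - W.card) := by
  have hcard : Fintype.card V - W.card = Nat.card {p : ({w}ᶜ : Set V) // (p : V) ∉ W} := by
    have e : {p : ({w}ᶜ : Set V) // (p : V) ∉ W} ≃ {p : V // p ∉ W} :=
      { toFun := fun p => ⟨p.1.1, p.2⟩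
        invFun := fun p => ⟨⟨p.1, fun h => p.2 (by rw [Set.mem_singleton_iff.1 h]; exact hw)⟩, p.2⟩
        left_inv := fun p => rfl
        right_inv := fun p => rfl }
    rw [Nat.card_congr e, Nat.card_eq_fintype_card, Fintype.card_subtype_compl,
      Fintype.card_coe]
  rw [hcard, treesWithLeaves, treesWithLeaves, ← Nat.card_prod]
  symm
  refine Nat.card_congr (Equiv.ofBijective (fun q => ⟨attachLeaf w q.1.1 q.2.1, ?_, ?_⟩) ⟨?_, ?_⟩)
  · exact attachLeaf_isTree q.1.2.1
  · intro x hx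
    by_cases hxw : x = w
    · subst hxw; exact isEndVertex_attachLeaf_self
    · refine isEndVertex_attachLeaf (x := ⟨x, hxw⟩) (q.1.2.2 _ (by simpa using hx)) ?_
      intro h
      exact q.2.2 (by rw [← h]; exact hx)
  · intro q q' h
    have h' := attachLeaf_injective (Subtype.ext_iff.1 h)
    exact Prod.ext (Subtype.ext h'.1) (Subtype.ext h'.2)
  · rintro ⟨T, hT, hTW⟩
    obtain ⟨G, p, hG, rfl, hx⟩ := exists_eq_attachLeaf (by simpa using h3) hT (hTW w hw)
    refine ⟨⟨⟨G, hG, fun x hxW => (hx x (hTW _ (by simpa using hxW))).1⟩, ⟨p, fun hpW => ?_⟩⟩, rfl⟩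
    exact (hx p (hTW _ hpW)).2 rfl

/-- The binomial sum of a low power vanishes: it is an iterated finite difference. -/
lemma sum_neg_one_pow_choose_mul_pow {n j : ℕ} (h : j < n) :
    ∑ k ∈ Finset.range (n + 1), (-1 : ℤ) ^ (n - k) * (n.choose k : ℤ) * (k : ℤ) ^ j = 0 := by
  have h1 := congrFun (fwdDiff_iter_pow_eq_zero_of_lt (R := ℤ) h) 0
  rw [fwdDiff_iter_eq_sum_shift] at h1
  simpa using h1

lemma exists_isEndVertex {V : Type*} [Finite V] {T : SimpleGraph V} (hT : T.IsTree) :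
    ∃ v, IsEndVertex T v := by
  classical
  have := Fintype.ofFinite V
  rcases subsingleton_or_nontrivial V with h | h
  · obtain ⟨v⟩ := hT.connected.nonempty
    exact ⟨v, fun a _ b _ => Subsingleton.elim a b⟩
  · obtain ⟨v, hv⟩ := hT.exists_vert_degree_one_of_nontrivial
    exact ⟨v, (isEndVertex_iff_degree_le_one T v).2 hv.le⟩

/-- Inclusion–exclusion: since every tree has a leaf, the alternating sum over all sets `W` of the
number of trees in which `W` consists of leaves vanishes. -/
lemma sum_treesWithLeaves {V : Type*} [Fintype V] [DecidableEq V] :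
    ∑ W : Finset V, (-1 : ℤ) ^ W.card * treesWithLeaves V W = 0 := by
  classical
  have h1 : ∀ W : Finset V, (treesWithLeaves V W : ℤ) =
      ∑ T : {T : SimpleGraph V // T.IsTree}, if ∀ x ∈ W, IsEndVertex T.1 x then 1 else 0 := by
    intro W
    rw [treesWithLeaves, Finset.sum_boole]
    congr 1
    rw [← Fintype.card_subtype, ← Nat.card_eq_fintype_card]
    exact Nat.card_congr (Equiv.subtypeSubtypeEquivSubtypeInter
      (fun T : SimpleGraph V => T.IsTree) fun T => ∀ x ∈ W, IsEndVertex T x).symm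
  simp only [h1, Finset.mul_sum]
  rw [Finset.sum_comm]
  refine Finset.sum_eq_zero fun T _ => ?_
  have h2 := Finset.sum_powerset_neg_one_pow_card_of_nonempty
    (x := Finset.univ.filter fun x => IsEndVertex T.1 x) ?_
  · refine Eq.trans ?_ h2
    simp only [mul_ite, mul_one, mul_zero]
    rw [← Finset.sum_filter]
    refine Finset.sum_congr ?_ fun _ _ => rfl
    ext W
    simp [Finset.subset_iff]
  · obtain ⟨v, hv⟩ := exists_isEndVertex T.2
    exact ⟨v, by simpa using hv⟩

lemma sum_finset_card {V : Type*} [Fintype V] {R : Type*} [CommRing R] (f : ℕ → R) :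
    ∑ W : Finset V, f W.card =
      ∑ k ∈ Finset.range (Fintype.card V + 1), ((Fintype.card V).choose k : R) * f k := by
  rw [← Finset.powerset_univ, Finset.sum_powerset_apply_card]
  simp [nsmul_eq_mul]

/-- A refinement of Cayley's formula: `W` consists of leaves in `(m - |W|) ^ (m - 2)` of the trees
on `m ≥ 2` vertices. A vertex of `W` can be removed; the case of empty `W` follows from the others
by inclusion–exclusion. -/
theorem treesWithLeaves_eq (m : ℕ) : ∀ {V : Type u} [Fintype V] [DecidableEq V],
    Fintype.card V = m + 2 → ∀ W : Finset V,
      treesWithLeaves V W = (m + 2 - W.card) ^ m := by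
  induction m with
  | zero =>
    intro V _ _ hV W
    rw [pow_zero, treesWithLeaves, Nat.card_eq_one_iff_unique]
    have : Nontrivial V := by rw [← Fintype.one_lt_card_iff_nontrivial]; omega
    have hadj : ∀ T : SimpleGraph V, T.IsTree → ∀ a b, T.Adj a b ↔ a ≠ b := by
      intro T hT a b
      refine ⟨fun h => h.ne, fun h => ?_⟩
      obtain ⟨c, hc⟩ := hT.connected.preconnected.exists_adj_of_nontrivial a
      by_contra hcon
      have hcb : c ≠ b := by rintro rfl; exact hcon hc
      have : ({a, b, c} : Finset V).card ≤ 2 := by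
        exact (Finset.card_le_univ _).trans hV.le
      rw [Finset.card_eq_three.2 ⟨a, b, c, h, hc.ne, hcb.symm, rfl⟩] at this
      omega
    constructor
    · refine ⟨fun T T' => Subtype.ext ?_⟩
      ext a b
      rw [hadj _ T.2.1, hadj _ T'.2.1]
    · obtain ⟨T, -, hT⟩ := (SimpleGraph.connected_top (V := V)).exists_isTree_le
      refine ⟨T, hT, fun x _ => ?_⟩
      classical
      rw [isEndVertex_iff_degree_le_one]
      have := T.degree_lt_card_verts x
      omega
  | succ m ih =>
    have hpos : ∀ {V : Type u} [Fintype V] [DecidableEq V], Fintype.card V = m + 1 + 2 →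
        ∀ W : Finset V, W.Nonempty → treesWithLeaves V W = (m + 1 + 2 - W.card) ^ (m + 1) := by
      rintro V _ _ hV W ⟨w, hw⟩
      rw [treesWithLeaves_of_mem (by omega) W hw, ih, pow_succ, hV]
      · congr 2
        have : (W.subtype (· ∈ ({w}ᶜ : Set V))).card + 1 = W.card := by
          rw [Finset.card_subtype, ← Finset.card_erase_add_one hw]
          congr 2
          ext x
          simp [and_comm]
        omega
      · rw [Fintype.card_compl_set, hV]; simp
    intro V _ _ hV W
    rcases W.eq_empty_or_nonempty with rfl | hW
    · have h1 := sum_treesWithLeaves (V := V)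
      have h2 := sum_finset_card (V := V) (R := ℤ)
        (fun k => (-1) ^ k * (((m + 1 + 2 - k : ℕ) : ℤ)) ^ (m + 1))
      have h3 : ∑ W : Finset V, (-1 : ℤ) ^ W.card * ((m + 1 + 2 - W.card : ℕ) : ℤ) ^ (m + 1) =
          0 := by
        rw [h2, hV, ← sum_neg_one_pow_choose_mul_pow (show m + 1 < m + 1 + 2 by omega),
          ← Finset.sum_range_reflect]
        refine Finset.sum_congr rfl fun k hk => ?_
        have hk' : k ≤ m + 1 + 2 := by simpa [Nat.lt_succ_iff] using hk
        rw [show m + 1 + 2 + 1 - 1 - k = m + 1 + 2 - k by omega, Nat.choose_symm hk',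
          show m + 1 + 2 - (m + 1 + 2 - k) = k by omega]
        ring
      rw [← Finset.add_sum_erase _ _ (Finset.mem_univ ∅)] at h1 h3
      have h4 : ∑ W ∈ Finset.univ.erase (∅ : Finset V), (-1 : ℤ) ^ W.card * treesWithLeaves V W =
          ∑ W ∈ Finset.univ.erase (∅ : Finset V),
            (-1 : ℤ) ^ W.card * ((m + 1 + 2 - W.card : ℕ) : ℤ) ^ (m + 1) := by
        refine Finset.sum_congr rfl fun W hW => ?_
        rw [hpos hV W (Finset.nonempty_iff_ne_empty.2 (Finset.ne_of_mem_erase hW))]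
        push_cast
        rfl
      rw [h4, ← h3] at h1
      have h5 := add_right_cancel h1
      simp only [Finset.card_empty, pow_zero, one_mul] at h5
      rw [Finset.card_empty]
      exact_mod_cast h5
    · exact hpos hV W hW

/-- The sum over all functions `Fin N → Fin m` of the weight that gives `b` to each point of the
range and `a` to each other point. -/
noncomputable def rangeWeight {R : Type*} [CommRing R] (m N : ℕ) (a b : R) : R := by
  classical
  exact ∑ f : Fin N → Fin m, ∏ v, if v ∈ Set.range f then b else a

lemma prod_ite_eq_sum {V R : Type*} [Fintype V] [DecidableEq V] [CommRing R] (p : V → Prop)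
    [DecidablePred p] (a b : R) : (∏ v, if p v then a else b) =
      ∑ W : Finset V, if ∀ x ∈ W, p x then (a - b) ^ W.card * b ^ (Fintype.card V - W.card)
        else 0 := by
  have h : ∀ v, (if p v then a else b) = (if p v then a - b else 0) + b := by
    intro v; split_ifs <;> simp
  rw [Finset.prod_congr rfl fun v _ => h v, Finset.prod_add, Finset.powerset_univ]
  refine Finset.sum_congr rfl fun W _ => ?_
  rw [Finset.prod_const, Finset.card_sdiff_of_subset (Finset.subset_univ W), Finset.card_univ]
  split_ifs with hW
  · rw [Finset.prod_congr rfl fun x hx => if_pos (hW x hx), Finset.prod_const]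
  · push Not at hW
    obtain ⟨x, hx, hpx⟩ := hW
    rw [Finset.prod_eq_zero hx (if_neg hpx), zero_mul]

/-- Expand each factor of the weight as `b + (a - b)` off the range: a map that misses the `k`
points chosen takes values in the other `m - k`. -/
theorem rangeWeight_eq {R : Type*} [CommRing R] (m N : ℕ) (a b : R) :
    rangeWeight m N a b = ∑ k ∈ Finset.range (m + 1),
      (m.choose k : R) * ((a - b) ^ k * b ^ (m - k) * ((m - k : ℕ) : R) ^ N) := by
  classical
  have h := sum_finset_card (V := Fin m)
    (fun k => (a - b) ^ k * b ^ (m - k) * ((m - k : ℕ) : R) ^ N)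
  rw [Fintype.card_fin] at h
  rw [← h, rangeWeight]
  have h1 : ∀ f : Fin N → Fin m, (∏ v, if v ∈ Set.range f then b else a) =
      ∏ v, if v ∉ Set.range f then a else b := by
    intro f
    exact Finset.prod_congr rfl fun v _ => by split_ifs <;> simp_all
  simp only [h1, prod_ite_eq_sum, Fintype.card_fin]
  rw [Finset.sum_comm]
  refine Finset.sum_congr rfl fun W _ => ?_
  rw [← Finset.sum_filter, Finset.sum_const, nsmul_eq_mul, mul_comm]
  congr 1
  have h2 : (Finset.univ.filter fun f : Fin N → Fin m => ∀ x ∈ W, x ∉ Set.range f) =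
      Fintype.piFinset fun _ => Wᶜ := by
    ext f
    simp only [Finset.mem_filter, Finset.mem_univ, true_and, Fintype.mem_piFinset,
      Finset.mem_compl, Set.mem_range]
    exact ⟨fun h i hi => h _ hi ⟨i, rfl⟩, by rintro h x hx ⟨i, rfl⟩; exact h i hx⟩
  rw [h2, Fintype.card_piFinset]
  simp [Finset.card_compl]

/-- The leaf enumerator of the trees on `m ≥ 2` vertices. This is the content of the Prüfer code,
whose missing values are the leaves. -/
theorem sum_trees_prod {V : Type u} [Fintype V] {R : Type*} [CommRing R] {m : ℕ}
    (hV : Fintype.card V = m + 2) (a b : R) [Fintype {T : SimpleGraph V // T.IsTree}]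
    [∀ (T : SimpleGraph V) v, Decidable (IsEndVertex T v)] :
    ∑ T : {T : SimpleGraph V // T.IsTree}, ∏ v, (if IsEndVertex T.1 v then a else b) =
      rangeWeight (m + 2) m a b := by
  classical
  rw [rangeWeight_eq]
  have h := sum_finset_card (V := V)
    (fun k => (a - b) ^ k * b ^ (m + 2 - k) * ((m + 2 - k : ℕ) : R) ^ m)
  rw [hV] at h
  rw [← h]
  simp only [prod_ite_eq_sum, hV]
  rw [Finset.sum_comm]
  refine Finset.sum_congr rfl fun W _ => ?_
  rw [← Finset.sum_filter, Finset.sum_const, nsmul_eq_mul, mul_comm]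
  congr 1
  rw [← Nat.cast_pow, ← treesWithLeaves_eq m hV W, treesWithLeaves, ← Fintype.card_subtype,
    ← Nat.card_eq_fintype_card]
  exact congrArg _ (Nat.card_congr (Equiv.subtypeSubtypeEquivSubtypeInter
      (fun T : SimpleGraph V => T.IsTree) fun T => ∀ x ∈ W, IsEndVertex T x))

/-! ### Counting decorated labelled trees -/

/-- The exponential generating function of a class, as a formal power series. -/
noncomputable def LabelledClass.egf (C : LabelledClass.{u}) : PowerSeries ℝ :=
  PowerSeries.mk (egfCoeff C.Obj)

lemma LabelledClass.card_obj (C : LabelledClass.{u}) (S : Finset ℕ) :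
    Nat.card (C.Obj S) = count C.Obj S.card := by
  have h : Fintype.card S = Fintype.card (Finset.Icc 1 S.card) := by simp
  let e : S ≃ Finset.Icc 1 S.card := Fintype.equivOfCardEq h
  refine Nat.card_congr ⟨C.relabel e, C.relabel e.symm, fun x => ?_, fun x => ?_⟩
  · rw [← C.relabel_trans, Equiv.self_trans_symm, C.relabel_refl]
  · rw [← C.relabel_trans, Equiv.symm_trans_self, C.relabel_refl]

/-- The distributions of the labels in `S` over the places in `J`. -/
def Labelling (J : Type u) (S : Finset ℕ) : Type u :=
  {l : J → Finset ℕ // (∀ x y, x ≠ y → Disjoint (l x) (l y)) ∧ ∀ a, a ∈ S ↔ ∃ x, a ∈ l x}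

instance (J : Type u) [Finite J] (S : Finset ℕ) : Finite (Labelling J S) := by
  refine Finite.of_injective
    (fun l : Labelling J S => fun j => (⟨l.1 j, fun a ha => (l.2.2 a).2 ⟨j, ha⟩⟩ : {U // U ⊆ S})) ?_
  intro l l' h
  refine Subtype.ext (funext fun j => ?_)
  exact congrArg Subtype.val (congrFun h j)

noncomputable instance (J : Type u) [Finite J] (S : Finset ℕ) : Fintype (Labelling J S) :=
  Fintype.ofFinite _

/-- Relabelling the places. -/
def Labelling.congr {J K : Type u} (e : J ≃ K) (S : Finset ℕ) : Labelling J S ≃ Labelling K S where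
  toFun l := ⟨fun k => l.1 (e.symm k), fun x y h => l.2.1 _ _ (by simpa using h),
    fun a => (l.2.2 a).trans ⟨fun ⟨x, hx⟩ => ⟨e x, by simpa using hx⟩, fun ⟨x, hx⟩ => ⟨_, hx⟩⟩⟩
  invFun l := ⟨fun k => l.1 (e k), fun x y h => l.2.1 _ _ (by simpa using h),
    fun a => (l.2.2 a).trans ⟨fun ⟨x, hx⟩ => ⟨e.symm x, by simpa using hx⟩, fun ⟨x, hx⟩ => ⟨_, hx⟩⟩⟩
  left_inv l := Subtype.ext (funext fun k => by simp)
  right_inv l := Subtype.ext (funext fun k => by simp)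

/-- A distribution over `Option J` consists of the label set of `none` and a distribution of the
other labels over `J`. -/
def Labelling.optionEquiv (J : Type u) (S : Finset ℕ) :
    Labelling (Option J) S ≃ Σ U : {U // U ∈ S.powerset}, Labelling J (S \ U.1) where
  toFun l := ⟨⟨l.1 none, Finset.mem_powerset.2 fun a ha => (l.2.2 a).2 ⟨none, ha⟩⟩,
    ⟨fun j => l.1 (some j), fun x y h => l.2.1 _ _ (by simpa using h), fun a => by
      rw [Finset.mem_sdiff]
      constructor
      · rintro ⟨h1, h2⟩
        obtain ⟨x, hx⟩ := (l.2.2 a).1 h1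
        cases x with
        | none => exact absurd hx h2
        | some j => exact ⟨j, hx⟩
      · rintro ⟨j, hj⟩
        exact ⟨(l.2.2 a).2 ⟨_, hj⟩,
          Finset.disjoint_left.1 (l.2.1 (some j) none (by simp)) hj⟩⟩⟩
  invFun q := ⟨fun x => x.elim q.1.1 q.2.1, by
      have hd : ∀ j, Disjoint q.1.1 (q.2.1 j) := fun j => Finset.disjoint_left.2 fun a ha hj =>
        (Finset.mem_sdiff.1 ((q.2.2.2 a).2 ⟨j, hj⟩)).2 ha
      rintro (_ | x) (_ | y) h
      · exact absurd rfl h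
      · exact hd y
      · exact (hd x).symm
      · exact q.2.2.1 x y (by simpa using h), fun a => by
      constructor
      · intro ha
        by_cases h : a ∈ q.1.1
        · exact ⟨none, h⟩
        · obtain ⟨j, hj⟩ := (q.2.2.2 a).1 (Finset.mem_sdiff.2 ⟨ha, h⟩)
          exact ⟨some j, hj⟩
      · rintro ⟨_ | j, hj⟩
        · exact Finset.mem_powerset.1 q.1.2 hj
        · exact (Finset.mem_sdiff.1 ((q.2.2.2 a).2 ⟨j, hj⟩)).1⟩
  left_inv l := Subtype.ext (funext fun x => by cases x <;> rfl)
  right_inv q := rfl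

/-- The product rule for exponential generating functions: distributing labels over finitely many
places with weights that depend on the numbers of labels. -/
theorem sum_labelling (J : Type u) [Fintype J] : ∀ (c : J → ℕ → ℝ) (S : Finset ℕ),
    ∑ l : Labelling J S, ∏ j, c j (l.1 j).card =
      (S.card.factorial : ℝ) *
        PowerSeries.coeff S.card (∏ j, PowerSeries.mk fun n => c j n / (n.factorial : ℝ)) := by
  refine Fintype.induction_empty_option (P := fun J _ => ∀ (c : J → ℕ → ℝ) (S : Finset ℕ),
    ∑ l : Labelling J S, ∏ j, c j (l.1 j).card =
      (S.card.factorial : ℝ) *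
        PowerSeries.coeff S.card (∏ j, PowerSeries.mk fun n => c j n / (n.factorial : ℝ)))
    ?_ ?_ ?_ J
  · intro J K _ e ih c S
    let _ := Fintype.ofEquiv K e.symm
    have h := ih (fun j => c (e j)) S
    rw [Equiv.prod_comp e fun k => PowerSeries.mk fun n => c k n / (n.factorial : ℝ)] at h
    rw [← h]
    refine (Fintype.sum_equiv (Labelling.congr e S) _ _ fun l => ?_).symm
    rw [← Equiv.prod_comp e]
    refine Finset.prod_congr rfl fun x _ => ?_
    change _ = c (e x) (l.1 (e.symm (e x))).card
    rw [e.symm_apply_apply]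
  · intro c S
    simp only [Finset.univ_eq_empty, Finset.prod_empty, Finset.sum_const, nsmul_eq_mul, mul_one,
      Finset.card_univ, ← Nat.card_eq_fintype_card, PowerSeries.coeff_one]
    rcases S.eq_empty_or_nonempty with rfl | ⟨a, ha⟩
    · have : Nat.card (Labelling PEmpty.{u+1} ∅) = 1 := by
        rw [Nat.card_eq_one_iff_unique]
        exact ⟨⟨fun l l' => Subtype.ext (funext fun x => x.elim)⟩,
          ⟨⟨fun x => x.elim, fun x => x.elim, by simp⟩⟩⟩
      rw [this]; simp
    · have : IsEmpty (Labelling PEmpty.{u+1} S) :=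
        ⟨fun l => by obtain ⟨x, -⟩ := (l.2.2 a).1 ha; exact x.elim⟩
      have hne : S.card ≠ 0 := Finset.card_ne_zero_of_mem ha
      rw [Nat.card_of_isEmpty]; simp [hne]
  · intro J _ ih c S
    rw [Fintype.sum_equiv (Labelling.optionEquiv J S) _
      (fun q => c none q.1.1.card * ∏ j, c (some j) (q.2.1 j).card)
      fun l => by rw [Fintype.prod_option]; rfl]
    rw [Fintype.sum_sigma, Fintype.prod_option, PowerSeries.coeff_mul,
      Finset.Nat.sum_antidiagonal_eq_sum_range_succ_mk]
    have h1 : ∀ U : {U // U ∈ S.powerset},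
        ∑ y : Labelling J (S \ U.1), c none U.1.card * ∏ j, c (some j) (y.1 j).card =
        (fun k => c none k * (((S.card - k).factorial : ℝ) * PowerSeries.coeff (S.card - k)
          (∏ j, PowerSeries.mk fun n => c (some j) n / (n.factorial : ℝ)))) U.1.card := by
      intro U
      rw [← Finset.mul_sum, ih (fun j => c (some j)),
        Finset.card_sdiff_of_subset (Finset.mem_powerset.1 U.2)]
    rw [Finset.sum_congr rfl fun U _ => h1 U,
      Finset.sum_coe_sort S.powerset (fun U => (fun k => c none k * (((S.card - k).factorial : ℝ) *
        PowerSeries.coeff (S.card - k)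
          (∏ j, PowerSeries.mk fun n => c (some j) n / (n.factorial : ℝ)))) U.card),
      Finset.mul_sum]
    refine (Finset.sum_powerset_apply_card (fun k => c none k * (((S.card - k).factorial : ℝ) *
        PowerSeries.coeff (S.card - k)
          (∏ j, PowerSeries.mk fun n => c (some j) n / (n.factorial : ℝ))))).trans ?_
    refine Finset.sum_congr rfl fun k hk => ?_
    have hk' : k ≤ S.card := by simpa [Nat.lt_succ_iff] using hk
    rw [PowerSeries.coeff_mk, nsmul_eq_mul, ← Nat.choose_mul_factorial_mul_factorial hk']
    have : (k.factorial : ℝ) ≠ 0 := by positivity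
    push_cast
    field_simp

/-- The sum of `a ^ #leaves * b ^ #internal nodes` over the trees on `m` vertices. -/
noncomputable def treeWeight {R : Type*} [CommRing R] (m : ℕ) (a b : R) : R :=
  match m with
  | 0 => 0
  | 1 => a
  | m + 2 => rangeWeight (m + 2) m a b

theorem sum_trees_prod_eq_treeWeight {V : Type u} [Fintype V] {R : Type*} [CommRing R]
    (a b : R) [Fintype {T : SimpleGraph V // T.IsTree}]
    [∀ (T : SimpleGraph V) v, Decidable (IsEndVertex T v)] :
    ∑ T : {T : SimpleGraph V // T.IsTree}, ∏ v, (if IsEndVertex T.1 v then a else b) =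
      treeWeight (Fintype.card V) a b := by
  rcases h : Fintype.card V with _ | _ | m
  · have : IsEmpty V := Fintype.card_eq_zero_iff.1 h
    have : IsEmpty {T : SimpleGraph V // T.IsTree} :=
      ⟨fun T => IsEmpty.false T.2.connected.nonempty.some⟩
    simp [treeWeight]
  · obtain ⟨x, hx⟩ := Fintype.card_eq_one_iff.1 h
    have hs : Subsingleton V := ⟨fun a b => (hx a).trans (hx b).symm⟩
    have : Nonempty V := ⟨x⟩
    have : Unique {T : SimpleGraph V // T.IsTree} :=
      { default := ⟨⊥, .of_subsingleton⟩
        uniq := fun T => Subtype.ext (Subsingleton.elim _ _) }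
    have hv : ∀ (T : SimpleGraph V) v, IsEndVertex T v := fun T v a _ b _ => Subsingleton.elim _ _
    simp [treeWeight, hv, h]
  · exact sum_trees_prod h a b

section TreeObj

variable (D : LabelledClass.{u}) (I : LabelledClass.{v}) (L : LabelledClass.{w})

/-- The data of an object of `TreeObj D I L S` apart from its node set `V`. -/
def TreeData (S V : Finset ℕ) : Type (max u v w) :=
  Σ T : {T : SimpleGraph V // T.IsTree}, Σ l : Labelling (V ⊕ T.1.edgeSet) (S \ V),
    (∀ e, D.Obj (l.1 (Sum.inr e))) × (∀ x, ¬ IsLeafNode T.1 x → I.Obj (l.1 (Sum.inl x))) ×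
      (∀ x, IsLeafNode T.1 x → L.Obj (l.1 (Sum.inl x)))

/-- A tree with attached objects, split into its node set and the remaining data. -/
def treeObjEquiv (S : Finset ℕ) :
    TreeObj D I L S ≃ Σ V : {V // V ∈ S.powerset}, TreeData D I L S V.1 where
  toFun α := ⟨⟨α.verts, Finset.mem_powerset.2 fun a ha => (α.mem_iff a).2 (Or.inl ha)⟩,
    ⟨α.tree, α.isTree⟩, ⟨α.labels, α.disjoint_labels, fun a => by
      rw [Finset.mem_sdiff, α.mem_iff]
      constructor
      · rintro ⟨h | h, h'⟩
        · exact absurd h h'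
        · exact h
      · rintro ⟨x, hx⟩
        exact ⟨Or.inr ⟨x, hx⟩, fun h => Finset.disjoint_left.1 (α.disjoint_verts x) h hx⟩⟩,
    α.edgeObj, α.internalObj, α.leafObj⟩
  invFun q :=
    { verts := q.1.1
      tree := q.2.1.1
      isTree := q.2.1.2
      labels := q.2.2.1.1
      edgeObj := q.2.2.2.1
      internalObj := q.2.2.2.2.1
      leafObj := q.2.2.2.2.2
      disjoint_verts := fun x => Finset.disjoint_left.2 fun a ha hx =>
        (Finset.mem_sdiff.1 ((q.2.2.1.2.2 a).2 ⟨x, hx⟩)).2 ha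
      disjoint_labels := q.2.2.1.2.1
      mem_iff := fun a => by
        have h := q.2.2.1.2.2 a
        rw [← h, Finset.mem_sdiff]
        have hV : a ∈ q.1.1 → a ∈ S := fun ha => Finset.mem_powerset.1 q.1.2 ha
        tauto }
  left_inv α := rfl
  right_inv q := rfl

lemma card_not_and_card {p : Prop} [Decidable p] {X : Type u} {Y : Type v} :
    Nat.card (¬ p → X) * Nat.card (p → Y) = if p then Nat.card Y else Nat.card X := by
  split_ifs with h
  · have : Unique (¬ p → X) := ⟨⟨fun h' => absurd h h'⟩, fun f => funext fun h' => absurd h h'⟩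
    rw [Nat.card_unique, one_mul]
    exact Nat.card_congr ⟨fun f => f h, fun y _ => y, fun f => rfl, fun y => rfl⟩
  · have : Unique (p → Y) := ⟨⟨fun h' => absurd h' h⟩, fun f => funext fun h' => absurd h' h⟩
    rw [Nat.card_unique (α := p → Y), mul_one]
    exact Nat.card_congr ⟨fun f => f h, fun y _ => y, fun f => rfl, fun y => rfl⟩

instance (S V : Finset ℕ) : Finite (TreeData D I L S V) := by
  have := D.finite
  have := I.finite
  have := L.finite
  unfold TreeData
  infer_instance

instance (S : Finset ℕ) : Finite (TreeObj D I L S) :=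
  Finite.of_equiv _ (treeObjEquiv D I L S).symm

theorem card_treeData (S V : Finset ℕ) (hV : V ⊆ S) :
    (Nat.card (TreeData D I L S V) : ℝ) = ((S.card - V.card).factorial : ℝ) *
      PowerSeries.coeff (S.card - V.card)
        (D.egf ^ (V.card - 1) * treeWeight V.card L.egf I.egf) := by
  classical
  have := D.finite
  have := I.finite
  have := L.finite
  let _ : Fintype {T : SimpleGraph V // T.IsTree} := Fintype.ofFinite _
  have hw := sum_trees_prod_eq_treeWeight (V := V) L.egf I.egf
  rw [Fintype.card_coe] at hw
  rw [← hw, Finset.mul_sum, map_sum, Finset.mul_sum, TreeData, Nat.card_sigma]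
  push_cast
  refine Finset.sum_congr rfl fun T _ => ?_
  let _ : Fintype T.1.edgeSet := Fintype.ofFinite _
  let c : V ⊕ T.1.edgeSet → ℕ → ℝ := Sum.elim
    (fun x n => if IsEndVertex T.1 x then (count L.Obj n : ℝ) else (count I.Obj n : ℝ))
    (fun _ n => (count D.Obj n : ℝ))
  have hc := sum_labelling _ c (S \ V)
  rw [Finset.card_sdiff_of_subset hV] at hc
  have hE : Fintype.card T.1.edgeSet = V.card - 1 := by
    have := T.2.card_edgeFinset
    rw [Fintype.card_coe, ← Set.toFinset_card] at *
    rw [← this, SimpleGraph.edgeFinset]; simp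
  have hprod : (∏ j, PowerSeries.mk fun n => c j n / (n.factorial : ℝ)) =
      D.egf ^ (V.card - 1) * ∏ x, if IsEndVertex T.1 x then L.egf else I.egf := by
    rw [Fintype.prod_sum_type, mul_comm]
    congr 1
    · simp only [c, Sum.elim_inr]
      rw [Finset.prod_const, Finset.card_univ, hE]
      rfl
    · refine Finset.prod_congr rfl fun x _ => ?_
      simp only [c, Sum.elim_inl]
      split_ifs <;> rfl
  rw [hprod] at hc
  rw [← hc, Nat.card_sigma]
  push_cast
  refine Finset.sum_congr rfl fun l _ => ?_
  rw [Nat.card_prod, Nat.card_prod, Nat.card_pi, Nat.card_pi, Nat.card_pi,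
    ← Finset.prod_mul_distrib,
    Fintype.prod_sum_type, mul_comm]
  push_cast
  congr 1
  · refine Finset.prod_congr rfl fun x _ => ?_
    rw [← Nat.cast_mul, card_not_and_card, L.card_obj, I.card_obj]
    simp only [c, Sum.elim_inl, isLeafNode_iff]
    split_ifs <;> rfl
  · refine Finset.prod_congr rfl fun x _ => ?_
    rw [D.card_obj]
    rfl

/-- The normalised number of objects of size `n` with `m` nodes. -/
noncomputable def treeCoeff (n m : ℕ) : ℝ :=
  PowerSeries.coeff (n - m) (D.egf ^ (m - 1) * treeWeight m L.egf I.egf) / (m.factorial : ℝ)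

lemma sum_powerset_filter_card {S : Finset ℕ} (p : ℕ → Prop) [DecidablePred p] (f : ℕ → ℝ) :
    ∑ V ∈ S.powerset with p V.card, f V.card =
      ∑ m ∈ Finset.range (S.card + 1) with p m, (S.card.choose m : ℝ) * f m := by
  rw [Finset.sum_filter, Finset.sum_filter]
  refine (Finset.sum_powerset_apply_card fun m => if p m then f m else 0).trans
    (Finset.sum_congr rfl fun m _ => ?_)
  rw [nsmul_eq_mul]
  split_ifs <;> simp

lemma choose_mul_factorial_mul_div {n m : ℕ} (h : m ≤ n) (x : ℝ) :
    (n.choose m : ℝ) * (((n - m).factorial : ℝ) * x) = n.factorial * (x / m.factorial) := by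
  rw [← Nat.choose_mul_factorial_mul_factorial h]
  have : (m.factorial : ℝ) ≠ 0 := by positivity
  push_cast
  field_simp

theorem card_treeObj (n : ℕ) (p : ℕ → Prop) [DecidablePred p] :
    (Nat.card {α : OfSize (TreeObj D I L) n // p α.treeSize} : ℝ) =
      n.factorial * ∑ m ∈ Finset.range (n + 1) with p m, treeCoeff D I L n m := by
  classical
  let S := Finset.Icc 1 n
  have hS : S.card = n := by simp [S]
  have e : {α : OfSize (TreeObj D I L) n // p α.treeSize} ≃
      Σ V : {V : {V // V ∈ S.powerset} // p V.1.card}, TreeData D I L S V.1.1 :=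
    ((treeObjEquiv D I L S).subtypeEquiv
      (q := fun q => p q.1.1.card) fun α => Iff.rfl).trans
      (Equiv.subtypeSigmaEquiv (fun V : {V // V ∈ S.powerset} => TreeData D I L S V.1)
        fun V => p V.1.card)
  rw [Nat.card_congr e, Nat.card_sigma]
  push_cast
  have h1 : ∀ V : {V : {V // V ∈ S.powerset} // p V.1.card},
      (Nat.card (TreeData D I L S V.1.1) : ℝ) = (fun m => ((n - m).factorial : ℝ) *
      PowerSeries.coeff (n - m) (D.egf ^ (m - 1) * treeWeight m L.egf I.egf)) V.1.1.card := by
    intro V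
    rw [card_treeData D I L S V.1.1 (Finset.mem_powerset.1 V.1.2), hS]
  rw [Finset.sum_congr rfl fun V _ => h1 V]
  have h2 := sum_powerset_filter_card (S := S) p (fun m => ((n - m).factorial : ℝ) *
      PowerSeries.coeff (n - m) (D.egf ^ (m - 1) * treeWeight m L.egf I.egf))
  rw [hS] at h2
  have h3 : ∀ f : Finset ℕ → ℝ, ∑ V : {V : {V // V ∈ S.powerset} // p V.1.card}, f V.1.1 =
      ∑ V ∈ S.powerset with p V.card, f V := by
    intro f
    rw [Finset.sum_filter, ← Finset.sum_coe_sort S.powerset (fun V => if p V.card then f V else 0),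
      ← Finset.sum_filter]
    exact (Finset.sum_subtype (p := fun V : {V // V ∈ S.powerset} => p V.1.card)
        (Finset.univ.filter fun V : {V // V ∈ S.powerset} => p V.1.card) (by simp)
        (fun V => f V.1)).symm
  rw [h3 (fun V => (fun m => ((n - m).factorial : ℝ) *
      PowerSeries.coeff (n - m) (D.egf ^ (m - 1) * treeWeight m L.egf I.egf)) V.card), h2,
      Finset.mul_sum]
  refine Finset.sum_congr rfl fun m hm => ?_
  have hm' : m ≤ n := by simpa [Nat.lt_succ_iff] using (Finset.mem_filter.1 hm).1
  rw [choose_mul_factorial_mul_div hm', treeCoeff]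

/-- A rooted tree object is a tree object with a distinguished node. -/
def rootedTreeObjEquiv (S : Finset ℕ) :
    RootedTreeObj D I L S ≃ Σ α : TreeObj D I L S, α.verts where
  toFun α := ⟨α.toTreeObj, α.root⟩
  invFun q := { q.1 with root := q.2 }
  left_inv _ := rfl
  right_inv _ := rfl

instance (S : Finset ℕ) : Finite (RootedTreeObj D I L S) :=
  Finite.of_equiv _ (rootedTreeObjEquiv D I L S).symm

theorem card_rootedTreeObj (n : ℕ) (p : ℕ → Prop) [DecidablePred p] :
    (Nat.card {α : OfSize (RootedTreeObj D I L) n // p α.treeSize} : ℝ) =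
      n.factorial * ∑ m ∈ Finset.range (n + 1) with p m, m * treeCoeff D I L n m := by
  classical
  let S := Finset.Icc 1 n
  have hsize : ∀ α : TreeObj D I L S, α.treeSize ∈ Finset.range (n + 1) := by
    intro α
    rw [Finset.mem_range, Nat.lt_succ_iff]
    have h : α.verts ⊆ S := fun a ha => (α.mem_iff a).2 (Or.inl ha)
    simpa [S, TreeObj.treeSize] using Finset.card_le_card h
  let _ : Fintype (TreeObj D I L S) := Fintype.ofFinite _
  have e : {α : OfSize (RootedTreeObj D I L) n // p α.treeSize} ≃
      Σ α : {α : TreeObj D I L S // p α.treeSize}, α.1.verts :=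
    ((rootedTreeObjEquiv D I L S).subtypeEquiv
      (q := fun q => p q.1.treeSize) fun α => Iff.rfl).trans
      (Equiv.subtypeSigmaEquiv (fun α : TreeObj D I L S => α.verts) fun α => p α.treeSize)
  rw [Nat.card_congr e, Nat.card_sigma]
  push_cast
  have h1 : ∀ α : {α : TreeObj D I L S // p α.treeSize},
      (Nat.card α.1.verts : ℝ) = (fun α : TreeObj D I L S => (α.treeSize : ℝ)) α.1 := by
    intro α
    simp [TreeObj.treeSize]
  rw [Finset.sum_congr rfl fun V _ => h1 V,
    ← Finset.sum_subtype (p := fun α : TreeObj D I L S => p α.treeSize)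
        (Finset.univ.filter fun α : TreeObj D I L S => p α.treeSize) (by simp)
        (fun α : TreeObj D I L S => (α.treeSize : ℝ)),
    Finset.sum_filter,
    ← Finset.sum_fiberwise_of_maps_to (g := fun α : TreeObj D I L S => α.treeSize)
      (t := Finset.range (n + 1)) fun α _ => hsize α, Finset.mul_sum, Finset.sum_filter]
  refine Finset.sum_congr rfl fun m hm => ?_
  have h2 := card_treeObj D I L n (fun k => k = m)
  rw [Finset.filter_eq', if_pos hm, Finset.sum_singleton] at h2
  have h3 : (Nat.card {α : OfSize (TreeObj D I L) n // α.treeSize = m} : ℝ) =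
      ((Finset.univ.filter fun α : TreeObj D I L S => α.treeSize = m).card : ℝ) := by
    rw [← Fintype.card_subtype, ← Nat.card_eq_fintype_card]
  rw [Finset.sum_congr rfl (g := fun _ => if p m then (m : ℝ) else 0) (fun α hα => by
    rw [(Finset.mem_filter.1 hα).2]), Finset.sum_const, nsmul_eq_mul, ← h3, h2]
  split_ifs <;> ring

end TreeObj

/-! ### The tree function at small arguments -/

/-- Rearrangement of an absolutely convergent double series along antidiagonals. -/
lemma HasSum.antidiagonal_of_prod {F : ℕ × ℕ → ℝ} {g : ℕ → ℝ} {s : ℝ} (hF : Summable F)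
    (hg : ∀ p, HasSum (fun q => F (p, q)) (g p)) (hs : HasSum g s) :
    HasSum (fun n => ∑ x ∈ Finset.HasAntidiagonal.antidiagonal n, F x) s := by
  have h1 := hF.hasSum.prod_fiberwise hg
  have h2 := (Finset.HasAntidiagonal.sigmaAntidiagonalEquivProd (A := ℕ)).hasSum_iff.2 hF.hasSum
  rw [h1.unique hs] at h2
  refine h2.sigma fun n => ?_
  rw [← Finset.sum_coe_sort]
  exact hasSum_fintype _

lemma hasSum_pow_div_factorial (b : ℝ) :
    HasSum (fun q : ℕ => b ^ q / (q.factorial : ℝ)) (Real.exp b) := by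
  rw [Real.exp_eq_exp_ℝ]
  exact NormedSpace.expSeries_div_hasSum_exp b

lemma hasSum_nat_mul_pow_div_factorial (b : ℝ) :
    HasSum (fun q : ℕ => (q : ℝ) * (b ^ q / (q.factorial : ℝ))) (b * Real.exp b) := by
  rw [← hasSum_nat_add_iff' 1]
  simp only [Finset.range_one, Finset.sum_singleton, Nat.cast_zero, zero_mul, sub_zero]
  refine ((hasSum_pow_div_factorial b).mul_left b).congr_fun fun q => ?_
  have : (q.factorial : ℝ) ≠ 0 := by positivity
  have : ((q : ℝ) + 1) ≠ 0 := by positivity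
  rw [Nat.factorial_succ]
  push_cast
  field_simp
  ring

/-- The coefficients `(p + 1) ^ p / (p + 1)!` of the tree function, shifted by one. -/
noncomputable def treeFunCoeff (p : ℕ) : ℝ :=
  ((p : ℝ) + 1) ^ p / ((p + 1).factorial : ℝ)

lemma treeFunCoeff_nonneg (p : ℕ) : 0 ≤ treeFunCoeff p := by
  unfold treeFunCoeff; positivity

lemma treeFunCoeff_le (p : ℕ) : treeFunCoeff p ≤ Real.exp 1 ^ (p + 1) := by
  have h := Real.pow_div_factorial_le_exp ((p + 1 : ℕ) : ℝ) (by positivity) (p + 1)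
  rw [← Real.exp_nat_mul, mul_one]
  refine le_trans ?_ h
  unfold treeFunCoeff
  push_cast
  gcongr
  · linarith
  · omega

lemma summable_treeFunCoeff_mul_pow {y : ℝ} (hy : 0 ≤ y) (hy' : Real.exp 1 * y < 1) :
    Summable fun p => treeFunCoeff p * y ^ (p + 1) := by
  have h : Summable fun p : ℕ => (Real.exp 1 * y) ^ (p + 1) :=
    (summable_nat_add_iff 1).2 (summable_geometric_of_lt_one (by positivity) hy')
  refine h.of_nonneg_of_le (fun p => mul_nonneg (treeFunCoeff_nonneg p) (by positivity)) fun p => ?_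
  rw [mul_pow]
  exact mul_le_mul_of_nonneg_right (treeFunCoeff_le p) (by positivity)

/-- Expanding the exponentials in `∑ treeFunCoeff p * (w * exp u) ^ (p + 1)`. -/
lemma hasSum_treeFun_expand {w u s : ℝ} (hw : 0 ≤ w)
    (hsmall : Real.exp 1 * (w * Real.exp |u|) < 1)
    (hs : HasSum (fun p => treeFunCoeff p * (w * Real.exp u) ^ (p + 1)) s) :
    HasSum (fun n : ℕ => ∑ x ∈ Finset.HasAntidiagonal.antidiagonal n,
      treeFunCoeff x.1 * w ^ (x.1 + 1) *
      ((((x.1 : ℝ) + 1) * u) ^ x.2 / (x.2.factorial : ℝ))) s ∧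
    HasSum (fun n : ℕ => ∑ x ∈ Finset.HasAntidiagonal.antidiagonal n,
      (1 + (x.2 : ℝ) / ((x.1 : ℝ) + 1)) *
      (treeFunCoeff x.1 * w ^ (x.1 + 1) *
      ((((x.1 : ℝ) + 1) * u) ^ x.2 / (x.2.factorial : ℝ)))) ((1 + u) * s) := by
  have e1 : ∀ (u : ℝ) (p : ℕ), treeFunCoeff p * (w * Real.exp u) ^ (p + 1) =
      treeFunCoeff p * w ^ (p + 1) * Real.exp (((p : ℝ) + 1) * u) := by
    intro u p
    rw [mul_pow, ← Real.exp_nat_mul]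
    push_cast
    ring
  have f1 : ∀ (u : ℝ) (p : ℕ), HasSum (fun q : ℕ => treeFunCoeff p * w ^ (p + 1) *
      ((((p : ℝ) + 1) * u) ^ q / (q.factorial : ℝ)))
      (treeFunCoeff p * (w * Real.exp u) ^ (p + 1)) := by
    intro u p
    rw [e1]
    exact (hasSum_pow_div_factorial _).mul_left _
  have f2 : ∀ (u : ℝ) (p : ℕ), HasSum (fun q : ℕ => (1 + (q : ℝ) / ((p : ℝ) + 1)) *
      (treeFunCoeff p * w ^ (p + 1) * ((((p : ℝ) + 1) * u) ^ q / (q.factorial : ℝ))))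
      ((1 + u) * (treeFunCoeff p * (w * Real.exp u) ^ (p + 1))) := by
    intro u p
    have h := (f1 u p).add ((hasSum_nat_mul_pow_div_factorial (((p : ℝ) + 1) * u)).mul_left
      (treeFunCoeff p * w ^ (p + 1) / ((p : ℝ) + 1)))
    have hp : ((p : ℝ) + 1) ≠ 0 := by positivity
    have e : treeFunCoeff p * (w * Real.exp u) ^ (p + 1) +
        treeFunCoeff p * w ^ (p + 1) / ((p : ℝ) + 1) *
          (((p : ℝ) + 1) * u * Real.exp (((p : ℝ) + 1) * u)) =
        (1 + u) * (treeFunCoeff p * (w * Real.exp u) ^ (p + 1)) := by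
      rw [e1]; field_simp
    rw [e] at h
    refine h.congr_fun fun q => ?_
    ring
  have hsum := summable_treeFunCoeff_mul_pow (y := w * Real.exp |u|) (by positivity) hsmall
  constructor
  · refine HasSum.antidiagonal_of_prod (F := fun x => treeFunCoeff x.1 * w ^ (x.1 + 1) *
      ((((x.1 : ℝ) + 1) * u) ^ x.2 / (x.2.factorial : ℝ))) ?_ (f1 u) hs
    have h : Summable fun x : ℕ × ℕ => treeFunCoeff x.1 * w ^ (x.1 + 1) *
      ((((x.1 : ℝ) + 1) * |u|) ^ x.2 / (x.2.factorial : ℝ)) := by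
      refine (summable_prod_of_nonneg fun x => ?_).2 ⟨fun p => (f1 _ p).summable, ?_⟩
      · have := treeFunCoeff_nonneg x.1
        simp only [Pi.zero_apply]; positivity
      · simpa only [fun p => (f1 |u| p).tsum_eq] using hsum
    refine h.of_norm_bounded fun x => ?_
    rw [norm_mul, norm_mul, norm_div, norm_pow, norm_pow, norm_mul, Real.norm_of_nonneg hw,
      Real.norm_of_nonneg (treeFunCoeff_nonneg _),
      Real.norm_of_nonneg (by positivity : (0 : ℝ) ≤ x.2.factorial),
      Real.norm_of_nonneg (by positivity : (0 : ℝ) ≤ (x.1 : ℝ) + 1), Real.norm_eq_abs]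
  · refine HasSum.antidiagonal_of_prod (F := fun x => (1 + (x.2 : ℝ) / ((x.1 : ℝ) + 1)) *
      (treeFunCoeff x.1 * w ^ (x.1 + 1) *
      ((((x.1 : ℝ) + 1) * u) ^ x.2 / (x.2.factorial : ℝ)))) ?_ (f2 u) (hs.mul_left _)
    have h : Summable fun x : ℕ × ℕ => (1 + (x.2 : ℝ) / ((x.1 : ℝ) + 1)) *
      (treeFunCoeff x.1 * w ^ (x.1 + 1) *
      ((((x.1 : ℝ) + 1) * |u|) ^ x.2 / (x.2.factorial : ℝ))) := by
      refine (summable_prod_of_nonneg fun x => ?_).2 ⟨fun p => (f2 _ p).summable, ?_⟩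
      · have := treeFunCoeff_nonneg x.1
        simp only [Pi.zero_apply]; positivity
      · simpa only [fun p => (f2 |u| p).tsum_eq] using hsum.mul_left _
    refine h.of_norm_bounded fun x => ?_
    rw [norm_mul, norm_mul, norm_mul, norm_div, norm_pow, norm_pow, norm_mul,
      Real.norm_of_nonneg hw,
      Real.norm_of_nonneg (treeFunCoeff_nonneg _),
      Real.norm_of_nonneg (by positivity : (0 : ℝ) ≤ x.2.factorial),
      Real.norm_of_nonneg (by positivity : (0 : ℝ) ≤ (x.1 : ℝ) + 1), Real.norm_eq_abs u,
      Real.norm_of_nonneg (by positivity : (0 : ℝ) ≤ 1 + (x.2 : ℝ) / ((x.1 : ℝ) + 1))]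

lemma sum_antidiagonal_treeFunCoeff (z : ℝ) (n : ℕ) :
    ∑ x ∈ Finset.HasAntidiagonal.antidiagonal n, treeFunCoeff x.1 * z ^ (x.1 + 1) *
      ((((x.1 : ℝ) + 1) * -z) ^ x.2 / (x.2.factorial : ℝ)) = if n = 0 then z else 0 := by
  rcases n with _ | n
  · simp [treeFunCoeff]
  rw [if_neg (Nat.succ_ne_zero n)]
  have h := sum_neg_one_pow_choose_mul_pow (show n + 1 < n + 1 + 1 by omega)
  rw [Finset.sum_range_succ'] at h
  simp only [Nat.cast_zero, zero_pow (Nat.succ_ne_zero n), mul_zero, add_zero] at h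
  have h' : ∑ k ∈ Finset.range (n + 1 + 1), (-1 : ℝ) ^ (n + 1 + 1 - (k + 1)) *
      ((n + 1 + 1).choose (k + 1) : ℝ) * ((k + 1 : ℕ) : ℝ) ^ (n + 1) = 0 := by exact_mod_cast h
  rw [Finset.Nat.sum_antidiagonal_eq_sum_range_succ_mk]
  have h2 : (z ^ (n + 1 + 1) / ((n + 1 + 1).factorial : ℝ)) *
    ∑ k ∈ Finset.range (n + 1 + 1), (-1 : ℝ) ^ (n + 1 + 1 - (k + 1)) *
      ((n + 1 + 1).choose (k + 1) : ℝ) * ((k + 1 : ℕ) : ℝ) ^ (n + 1) = 0 := by rw [h', mul_zero]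
  rw [← h2, Finset.mul_sum]
  refine Finset.sum_congr rfl fun k hk => ?_
  have hk' : k ≤ n + 1 := by simpa [Nat.lt_succ_iff] using hk
  have e1 : ((k : ℝ) + 1) ^ (n + 1) = ((k : ℝ) + 1) ^ k * ((k : ℝ) + 1) ^ (n + 1 - k) := by
    rw [← pow_add]; congr 1; omega
  have e2 : z ^ (n + 1 + 1) = z ^ (k + 1) * z ^ (n + 1 - k) := by
    rw [← pow_add]; congr 1; omega
  have e3 : ((n + 1 + 1).factorial : ℝ) =
      (n + 1 + 1).choose (k + 1) * (k + 1).factorial * (n + 1 - k).factorial := by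
    rw [← Nat.choose_mul_factorial_mul_factorial (show k + 1 ≤ n + 1 + 1 by omega)]
    rw [show n + 1 + 1 - (k + 1) = n + 1 - k by omega]
    push_cast
    ring
  have e4 : ((n + 1 + 1).choose (k + 1) : ℝ) ≠ 0 :=
    Nat.cast_ne_zero.2 (Nat.choose_pos (by omega)).ne'
  have e5 : ((k + 1).factorial : ℝ) ≠ 0 := by positivity
  have e6 : ((n + 1 - k).factorial : ℝ) ≠ 0 := by positivity
  rw [show n + 1 + 1 - (k + 1) = n + 1 - k by omega, e3, e2, treeFunCoeff]
  push_cast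
  rw [e1, mul_neg, neg_pow, mul_pow]
  field_simp

/-- The tree function inverts `z ↦ z * exp (-z)` near `0`: the coefficients of the composition are
iterated finite differences of powers. -/
lemma hasSum_treeFun {z : ℝ} (hz : 0 ≤ z) (hz' : z ≤ 1 / 10) :
    HasSum (fun p => treeFunCoeff p * (z * Real.exp (-z)) ^ (p + 1)) z := by
  have hsmall : Real.exp 1 * (z * Real.exp |-z|) < 1 := by
    rw [abs_neg, abs_of_nonneg hz]
    have h1 := Real.exp_one_lt_d9
    have h2 : Real.exp z ≤ Real.exp 1 := Real.exp_le_exp.2 (by linarith)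
    have h3 : z * Real.exp z ≤ 1 / 10 * 2.7182818286 := by
      apply mul_le_mul hz' (h2.trans h1.le) (Real.exp_pos z).le (by norm_num)
    nlinarith [Real.exp_pos 1, Real.exp_pos z]
  have hsmall' : Real.exp 1 * (z * Real.exp (-z)) < 1 := by
    refine lt_of_le_of_lt ?_ hsmall
    gcongr
    exact le_abs_self _
  have hs := (summable_treeFunCoeff_mul_pow (by positivity) hsmall').hasSum
  have h := (hasSum_treeFun_expand hz hsmall hs).1
  simp only [sum_antidiagonal_treeFunCoeff] at h
  have e := (hasSum_ite_eq 0 z).unique h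
  rwa [← e] at hs

/-- For small parameters the tree function provides the root `s` of `s = w * exp (u + s)`. -/
lemma exists_treeFun_root {w u : ℝ} (hw : 0 ≤ w) (hsmall : w * Real.exp |u| ≤ 1 / 20) :
    ∃ s, s = w * Real.exp (u + s) ∧
      HasSum (fun p => treeFunCoeff p * (w * Real.exp u) ^ (p + 1)) s := by
  have hc : ContinuousOn (fun z : ℝ => z * Real.exp (-z)) (Set.Icc 0 (1 / 10)) := by fun_prop
  have h1 : w * Real.exp u ≤ 1 / 20 := by
    refine le_trans ?_ hsmall
    gcongr
    exact le_abs_self _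
  have h2 : (1 / 20 : ℝ) ≤ 1 / 10 * Real.exp (-(1 / 10)) := by
    have := Real.add_one_le_exp (-(1 / 10) : ℝ)
    linarith
  obtain ⟨z, ⟨hz0, hz1⟩, hz⟩ := intermediate_value_Icc (by norm_num) hc
    (show w * Real.exp u ∈ Set.Icc ((fun z : ℝ => z * Real.exp (-z)) 0)
      ((fun z : ℝ => z * Real.exp (-z)) (1 / 10)) from ⟨by simp; positivity, h1.trans h2⟩)
  refine ⟨z, ?_, ?_⟩
  · rw [Real.exp_add, ← mul_assoc, ← hz, mul_assoc, ← Real.exp_add]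
    simp
  · rw [← hz]
    exact hasSum_treeFun hz0 hz1

/-! ### Transfer of a singularity of order three halves -/

open scoped Topology in
lemma hasFPowerSeriesOnBall_of_hasSum {c : ℕ → ℂ} {f : ℂ → ℂ} {R : ℝ} (hR : 0 < R)
    (h : ∀ x : ℂ, ‖x‖ < R → HasSum (fun n => c n * x ^ n) (f x)) :
    HasFPowerSeriesOnBall f (FormalMultilinearSeries.ofScalars ℂ c) 0 (ENNReal.ofReal R) where
  r_le := by
    refine ENNReal.le_of_forall_nnreal_lt fun r hr => ?_
    refine FormalMultilinearSeries.le_radius_of_tendsto (l := 0) _ ?_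
    have hr' : (r : ℝ) < R := by
      rw [← ENNReal.ofReal_coe_nnreal] at hr
      exact (ENNReal.ofReal_lt_ofReal_iff hR).1 hr
    have := (h (r : ℂ) (by simpa using hr')).summable.tendsto_atTop_zero.norm
    simpa [FormalMultilinearSeries.ofScalars_norm] using this
  r_pos := by simpa using hR
  hasSum := by
    intro y hy
    have hy' : ‖y‖ < R := by
      rw [Metric.eball_ofReal] at hy
      simpa using hy
    have := h y hy'
    rw [zero_add]
    refine this.congr_fun fun n => ?_
    rw [FormalMultilinearSeries.ofScalars_apply_eq, smul_eq_mul]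

/-- Cauchy's estimate with the mean of `‖g‖` over a circle. -/
lemma norm_coeff_le_circle_mean {c : ℕ → ℂ} {g : ℂ → ℂ}
    (h : ∀ x : ℂ, ‖x‖ < 1 → HasSum (fun n => c n * x ^ n) (g x)) {r : ℝ} (hr0 : 0 < r) (hr1 : r < 1)
    (n : ℕ) :
    ‖c n‖ ≤ ((2 * Real.pi)⁻¹ * ∫ θ in 0..2 * Real.pi, ‖g (circleMap 0 r θ)‖) * r⁻¹ ^ n := by
  have h1 := hasFPowerSeriesOnBall_of_hasSum one_pos h
  have hd : DifferentiableOn ℂ g (Metric.closedBall 0 r) := by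
    refine h1.differentiableOn.mono fun x hx => ?_
    rw [Metric.eball_ofReal]
    exact Metric.closedBall_subset_ball hr1 hx
  lift r to NNReal using hr0.le
  have h2 := hd.hasFPowerSeriesOnBall (by exact_mod_cast hr0)
  have h3 := h1.hasFPowerSeriesAt.eq_formalMultilinearSeries h2.hasFPowerSeriesAt
  rw [← FormalMultilinearSeries.ofScalars_norm (E := ℂ) c, h3]
  refine (norm_cauchyPowerSeries_le g 0 r n).trans ?_
  rw [abs_of_nonneg (NNReal.coe_nonneg r)]

lemma norm_one_sub_circleMap_ge {r θ : ℝ} (hr : 1 / 2 ≤ r) (hr1 : r < 1)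
    (hθ : |θ| ≤ Real.pi) : ((1 - r) + |θ|) / 3 ≤ ‖1 - circleMap 0 r θ‖ := by
  have h1 : ‖1 - circleMap 0 r θ‖ ^ 2 = (1 - r) ^ 2 + 2 * r * (1 - Real.cos θ) := by
    rw [Complex.sq_norm, Complex.normSq_apply, circleMap, zero_add, Complex.exp_mul_I,
      ← Complex.ofReal_cos, ← Complex.ofReal_sin]
    simp only [Complex.sub_re, Complex.one_re, Complex.mul_re, Complex.ofReal_re, Complex.add_re,
      Complex.I_re, mul_zero, Complex.ofReal_im, Complex.I_im, Complex.sub_im, Complex.one_im,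
      Complex.mul_im, Complex.add_im]
    nlinarith [Real.sin_sq_add_cos_sq θ]
  have h2 := Real.cos_le_one_sub_mul_cos_sq hθ
  have hpi : Real.pi ^ 2 ≤ 10 := by
    have := Real.pi_lt_d2
    nlinarith [Real.pi_pos]
  have h3 : (1 / 5 : ℝ) * θ ^ 2 ≤ 2 / Real.pi ^ 2 * θ ^ 2 := by
    refine mul_le_mul_of_nonneg_right ?_ (sq_nonneg θ)
    rw [div_le_div_iff₀ (by norm_num) (by positivity)]
    linarith
  have h4 : 1 / 5 * θ ^ 2 ≤ 1 - Real.cos θ := by linarith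
  have h5 : (1 - r) ^ 2 + 1 / 5 * |θ| ^ 2 ≤ ‖1 - circleMap 0 r θ‖ ^ 2 := by
    rw [h1, sq_abs]
    nlinarith [sq_nonneg θ]
  refine le_of_sq_le_sq ?_ (norm_nonneg _)
  refine le_trans ?_ h5
  nlinarith [sq_nonneg (5 * (1 - r) - |θ|), sq_nonneg (1 - r), sq_nonneg |θ|]

lemma integral_norm_one_sub_circleMap_le {r : ℝ} (hr : 1 / 2 ≤ r) (hr1 : r < 1) :
    ∫ θ in 0..2 * Real.pi, ‖1 - circleMap 0 r θ‖ ^ (-(3 / 2) : ℝ) ≤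
      4 * 3 ^ (3 / 2 : ℝ) * (1 - r) ^ (-(1 / 2) : ℝ) := by
  have hδ : 0 < 1 - r := by linarith
  have hne : ∀ θ, 1 - circleMap 0 r θ ≠ 0 := by
    intro θ h
    have : ‖circleMap 0 r θ‖ = 1 := by rw [← sub_eq_zero.1 h]; simp
    rw [norm_circleMap_zero, abs_of_pos (by linarith)] at this
    linarith
  have hc : Continuous fun θ => ‖1 - circleMap 0 r θ‖ ^ (-(3 / 2) : ℝ) :=
    (continuous_const.sub (continuous_circleMap 0 r)).norm.rpow_const
      fun θ => Or.inl (norm_ne_zero_iff.2 (hne θ))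
  have hper : Function.Periodic (fun θ => ‖1 - circleMap 0 r θ‖ ^ (-(3 / 2) : ℝ)) (2 * Real.pi) :=
    fun θ => by simp only [periodic_circleMap 0 r θ]
  have hshift := hper.intervalIntegral_add_eq 0 (-Real.pi)
  rw [zero_add, show -Real.pi + 2 * Real.pi = Real.pi by ring] at hshift
  rw [hshift]
  have hb : ∀ θ : ℝ, |θ| ≤ Real.pi → ‖1 - circleMap 0 r θ‖ ^ (-(3 / 2) : ℝ) ≤
      3 ^ (3 / 2 : ℝ) * ((1 - r) + |θ|) ^ (-(3 / 2) : ℝ) := by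
    intro θ hθ
    have h0 : 0 < (1 - r) + |θ| := by positivity
    have h1 := Real.rpow_le_rpow_of_nonpos (by positivity) (norm_one_sub_circleMap_ge hr hr1 hθ)
      (show (-(3 / 2) : ℝ) ≤ 0 by norm_num)
    refine h1.trans (le_of_eq ?_)
    rw [Real.div_rpow h0.le (by norm_num), Real.rpow_neg (by norm_num : (0 : ℝ) ≤ 3)]
    field_simp
  have hc2 : Continuous fun θ : ℝ => 3 ^ (3 / 2 : ℝ) * ((1 - r) + |θ|) ^ (-(3 / 2) : ℝ) := by
    refine continuous_const.mul
      ((continuous_const.add continuous_abs).rpow_const fun θ => Or.inl ?_)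
    exact (add_pos_of_pos_of_nonneg hδ (abs_nonneg θ)).ne'
  have hle : ∫ θ in -Real.pi..Real.pi, ‖1 - circleMap 0 r θ‖ ^ (-(3 / 2) : ℝ) ≤
      ∫ θ in -Real.pi..Real.pi, 3 ^ (3 / 2 : ℝ) * ((1 - r) + |θ|) ^ (-(3 / 2) : ℝ) :=
    intervalIntegral.integral_mono_on (by linarith [Real.pi_pos]) (hc.intervalIntegrable _ _)
      (hc2.intervalIntegrable _ _) fun θ hθ => hb θ (abs_le.2 hθ)
  refine hle.trans ?_
  -- the integrand is even; on the positive half it has an elementary primitive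
  have hhalf : ∫ θ in 0..Real.pi, ((1 - r) + |θ|) ^ (-(3 / 2) : ℝ) ≤
      2 * (1 - r) ^ (-(1 / 2) : ℝ) := by
    have e : ∫ θ in 0..Real.pi, ((1 - r) + |θ|) ^ (-(3 / 2) : ℝ) =
        ∫ θ in 0..Real.pi, (θ + (1 - r)) ^ (-(3 / 2) : ℝ) := by
      refine intervalIntegral.integral_congr fun θ hθ => ?_
      rw [Set.uIcc_of_le Real.pi_pos.le] at hθ
      rw [abs_of_nonneg hθ.1, add_comm]
    rw [e, intervalIntegral.integral_comp_add_right (fun θ => θ ^ (-(3 / 2) : ℝ)), integral_rpow]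
    · rw [show (-(3 / 2) + 1 : ℝ) = -(1 / 2) by norm_num, zero_add]
      have := Real.rpow_nonneg (show 0 ≤ Real.pi + (1 - r) by linarith [Real.pi_pos]) (-(1 / 2) : ℝ)
      rw [div_le_iff_of_neg (by norm_num)]
      linarith
    · refine Or.inr ⟨by norm_num, ?_⟩
      rw [zero_add, Set.uIcc_of_le (by linarith [Real.pi_pos])]
      intro h
      linarith [h.1]
  have hc3 : Continuous fun θ : ℝ => ((1 - r) + |θ|) ^ (-(3 / 2) : ℝ) := by
    refine (continuous_const.add continuous_abs).rpow_const fun θ => Or.inl ?_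
    exact (add_pos_of_pos_of_nonneg hδ (abs_nonneg θ)).ne'
  have heven : ∫ θ in -Real.pi..0, ((1 - r) + |θ|) ^ (-(3 / 2) : ℝ) =
      ∫ θ in 0..Real.pi, ((1 - r) + |θ|) ^ (-(3 / 2) : ℝ) := by
    have := intervalIntegral.integral_comp_neg (a := 0) (b := Real.pi)
      (fun θ : ℝ => ((1 - r) + |θ|) ^ (-(3 / 2) : ℝ))
    simp only [abs_neg, neg_zero] at this
    exact this.symm
  rw [intervalIntegral.integral_const_mul, ← intervalIntegral.integral_add_adjacent_intervals
    (hc3.intervalIntegrable (-Real.pi) 0) (hc3.intervalIntegrable 0 Real.pi), heven]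
  have h3 : (0 : ℝ) ≤ 3 ^ (3 / 2 : ℝ) := by positivity
  nlinarith

/-- A function on the unit disk that is `O(ε |1 - x| ^ (-3/2)) + O(1)` has coefficients
`O(ε √n) + O(1)`, with absolute constants. -/
lemma exists_norm_coeff_le :
    ∃ C₀ : ℝ, 0 < C₀ ∧ ∀ (c : ℕ → ℂ) (g : ℂ → ℂ) (ε K : ℝ), 0 ≤ ε → 0 ≤ K →
      (∀ x : ℂ, ‖x‖ < 1 → HasSum (fun n => c n * x ^ n) (g x)) →
      (∀ x : ℂ, ‖x‖ < 1 → ‖g x‖ ≤ ε * ‖1 - x‖ ^ (-(3 / 2) : ℝ) + K) →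
      ∀ n : ℕ, 2 ≤ n → ‖c n‖ ≤ C₀ * (ε * Real.sqrt n + K) := by
  set A : ℝ := (2 * Real.pi)⁻¹ * (4 * 3 ^ (3 / 2 : ℝ)) with hA
  have hA0 : 0 < A := by positivity
  refine ⟨(A + 1) * Real.exp 2, by positivity, ?_⟩
  intro c g ε K hε hK hg hb n hn
  have hn' : (2 : ℝ) ≤ n := by exact_mod_cast hn
  set r : ℝ := 1 - 1 / n with hr
  have hinv : (1 : ℝ) / n ≤ 1 / 2 := one_div_le_one_div_of_le (by norm_num) hn'
  have hinv0 : (0 : ℝ) < 1 / n := by positivity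
  have hr2 : 1 / 2 ≤ r := by rw [hr]; linarith
  have hr1 : r < 1 := by rw [hr]; linarith
  have hr0 : 0 < r := by linarith
  have h1 := norm_coeff_le_circle_mean hg hr0 hr1 n
  have hnorm : ∀ θ, ‖circleMap 0 r θ‖ < 1 := fun θ => by
    rw [norm_circleMap_zero, abs_of_pos hr0]; exact hr1
  have hne : ∀ θ, 1 - circleMap 0 r θ ≠ 0 := by
    intro θ h
    have h' := hnorm θ
    rw [← sub_eq_zero.1 h] at h'
    simp at h'
  have hcg : Continuous fun θ => ‖g (circleMap 0 r θ)‖ := by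
    have hd := (hasFPowerSeriesOnBall_of_hasSum one_pos hg).differentiableOn.continuousOn
    rw [Metric.eball_ofReal] at hd
    exact (hd.comp_continuous (continuous_circleMap 0 r) fun θ => by simpa using hnorm θ).norm
  have hc : Continuous fun θ => ‖1 - circleMap 0 r θ‖ ^ (-(3 / 2) : ℝ) :=
    (continuous_const.sub (continuous_circleMap 0 r)).norm.rpow_const
      fun θ => Or.inl (norm_ne_zero_iff.2 (hne θ))
  have hint : ∫ θ in 0..2 * Real.pi, ‖g (circleMap 0 r θ)‖ ≤
      ε * (4 * 3 ^ (3 / 2 : ℝ) * (1 - r) ^ (-(1 / 2) : ℝ)) + 2 * Real.pi * K := by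
    have h2 : ∫ θ in 0..2 * Real.pi, ‖g (circleMap 0 r θ)‖ ≤
        ∫ θ in 0..2 * Real.pi, (ε * ‖1 - circleMap 0 r θ‖ ^ (-(3 / 2) : ℝ) + K) :=
      intervalIntegral.integral_mono_on Real.two_pi_pos.le (hcg.intervalIntegrable _ _)
        (((continuous_const.mul hc).add continuous_const).intervalIntegrable _ _)
        fun θ _ => hb _ (hnorm θ)
    refine h2.trans ?_
    rw [intervalIntegral.integral_add ((hc.intervalIntegrable _ _).const_mul ε)
      (continuous_const.intervalIntegrable _ _), intervalIntegral.integral_const_mul,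
      intervalIntegral.integral_const, smul_eq_mul, sub_zero]
    have := integral_norm_one_sub_circleMap_le hr2 hr1
    gcongr
  have hsqrt : (1 - r) ^ (-(1 / 2) : ℝ) = Real.sqrt n := by
    rw [hr, sub_sub_cancel, one_div, Real.rpow_neg (by positivity), ← Real.sqrt_eq_rpow,
      Real.sqrt_inv, inv_inv]
  rw [hsqrt] at hint
  have hpow : r⁻¹ ^ n ≤ Real.exp 2 := by
    have h2 : r⁻¹ ≤ Real.exp (2 / n) := by
      refine le_trans ?_ (Real.add_one_le_exp _)
      rw [inv_le_comm₀ hr0 (by positivity), hr, inv_le_iff_one_le_mul₀ (by positivity)]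
      have : (2 : ℝ) / n = 2 * (1 / n) := by ring
      rw [this]
      nlinarith
    calc r⁻¹ ^ n ≤ Real.exp (2 / n) ^ n := by gcongr
      _ = Real.exp 2 := by
        rw [← Real.exp_nat_mul]
        congr 1
        field_simp
  have hpi : 0 < (2 * Real.pi)⁻¹ := by positivity
  calc ‖c n‖ ≤ _ := h1
    _ ≤ ((2 * Real.pi)⁻¹ * (ε * (4 * 3 ^ (3 / 2 : ℝ) * Real.sqrt n) + 2 * Real.pi * K)) *
        Real.exp 2 := by gcongr
    _ = (A * (ε * Real.sqrt n) + K) * Real.exp 2 := by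
      rw [hA]; field_simp
    _ ≤ (A + 1) * Real.exp 2 * (ε * Real.sqrt n + K) := by
      have h5 : 0 ≤ ε * Real.sqrt n := by positivity
      have h6 : A * (ε * Real.sqrt n) + K ≤ (A + 1) * (ε * Real.sqrt n + K) := by nlinarith
      calc _ ≤ (A + 1) * (ε * Real.sqrt n + K) * Real.exp 2 := by gcongr
        _ = _ := by ring

lemma factorial_mul_choose_eq_prod (s : ℂ) (n : ℕ) :
    (n.factorial : ℂ) * Ring.choose (s + n - 1) n = ∏ j ∈ Finset.range n, (s + j) := by
  have h := Ring.factorial_nsmul_multichoose_eq_ascPochhammer s n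
  rw [nsmul_eq_mul, Polynomial.ascPochhammer_smeval_eq_eval] at h
  rw [Ring.choose, show s + n - 1 - n + 1 = s by ring, h]
  clear h
  induction n with
  | zero => simp
  | succ n ih => rw [ascPochhammer_succ_eval, ih, Finset.prod_range_succ]

/-- The coefficients of `(1 - x) ^ (-3/2)` are asymptotic to `√n / Γ(3/2)`. -/
lemma tendsto_choose_div_sqrt : Tendsto
    (fun n : ℕ => Ring.choose ((3 / 2 : ℂ) + n - 1) n / (Real.sqrt n : ℂ)) atTop
    (nhds (Complex.Gamma (3 / 2))⁻¹) := by
  have hG := Complex.GammaSeq_tendsto_Gamma (3 / 2)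
  have hG0 : Complex.Gamma (3 / 2) ≠ 0 := Complex.Gamma_ne_zero_of_re_pos (by norm_num)
  have h1 : Tendsto (fun n : ℕ => (n : ℂ) / ((n : ℂ) + 3 / 2)) atTop (nhds 1) :=
    tendsto_natCast_div_add_atTop (3 / 2 : ℂ)
  have h2 := h1.mul (hG.inv₀ hG0)
  rw [one_mul] at h2
  refine h2.congr' ?_
  filter_upwards [eventually_gt_atTop 0] with n hn
  have hn' : (n : ℂ) ≠ 0 := Nat.cast_ne_zero.2 hn.ne'
  have hf : (n.factorial : ℂ) ≠ 0 := Nat.cast_ne_zero.2 n.factorial_ne_zero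
  have hsq : (Real.sqrt n : ℂ) ≠ 0 := by
    rw [Complex.ofReal_ne_zero]; positivity
  have hs : ((3 / 2 : ℂ) + n) ≠ 0 := by
    intro h
    have := congrArg Complex.re h
    simp at this
    have h0 : (0 : ℝ) ≤ n := by positivity
    linarith
  have hpow : (n : ℂ) ^ (3 / 2 : ℂ) = n * (Real.sqrt n : ℂ) := by
    rw [show (3 / 2 : ℂ) = 1 + 1 / 2 by norm_num, Complex.cpow_add _ _ hn', Complex.cpow_one]
    congr 1
    rw [Real.sqrt_eq_rpow, Complex.ofReal_cpow (by positivity)]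
    norm_num
  rw [Complex.GammaSeq, Finset.prod_range_succ, ← factorial_mul_choose_eq_prod, hpow, inv_div]
  rw [add_comm (n : ℂ)]
  generalize Ring.choose ((3 / 2 : ℂ) + n - 1) n = b
  have hs' : (3 + (n : ℂ) * 2) ≠ 0 := fun h => hs (by linear_combination h / 2)
  field_simp

open scoped Topology in
/-- Transfer theorem: a function on the unit disk that is bounded away from `1` and is asymptotic to
`C (1 - x) ^ (-3/2)` at `1` has coefficients asymptotic to `C √n / Γ(3/2)`. -/
theorem tendsto_coeff_div_sqrt {a : ℕ → ℂ} {f : ℂ → ℂ} {C : ℂ}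
    (h : ∀ x : ℂ, ‖x‖ < 1 → HasSum (fun n => a n * x ^ n) (f x))
    (hC : Tendsto (fun x => f x * (1 - x) ^ (3 / 2 : ℂ)) (𝓝[Metric.ball 0 1] 1) (𝓝 C))
    (hb : ∀ δ : ℝ, 0 < δ → ∃ K, ∀ x : ℂ, ‖x‖ < 1 → δ ≤ ‖1 - x‖ → ‖f x‖ ≤ K) :
    Tendsto (fun n : ℕ => a n / (Real.sqrt n : ℂ)) atTop (𝓝 (C * (Complex.Gamma (3 / 2))⁻¹)) := by
  obtain ⟨C₀, hC₀, hmain⟩ := exists_norm_coeff_le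
  let b : ℕ → ℂ := fun n => Ring.choose ((3 / 2 : ℂ) + n - 1) n
  have hbs : ∀ x : ℂ, ‖x‖ < 1 → HasSum (fun n => b n * x ^ n) (1 / (1 - x) ^ (3 / 2 : ℂ)) := by
    intro x hx
    have h1 := (Complex.one_div_one_sub_cpow_hasFPowerSeriesOnBall_zero (3 / 2)).hasSum
      (y := x) (by rw [← ENNReal.ofReal_one, Metric.eball_ofReal]; simpa using hx)
    rw [zero_add] at h1
    refine h1.congr_fun fun n => ?_
    rw [FormalMultilinearSeries.ofScalars_apply_eq, smul_eq_mul]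
  have hnorm : ∀ x : ℂ, ‖(1 - x) ^ (3 / 2 : ℂ)‖ = ‖1 - x‖ ^ (3 / 2 : ℝ) := by
    intro x
    rw [← Complex.norm_cpow_real]; norm_num
  have hd : Tendsto (fun n : ℕ => (a n - C * b n) / (Real.sqrt n : ℂ)) atTop (𝓝 0) := by
    rw [tendsto_zero_iff_norm_tendsto_zero]
    refine Metric.tendsto_atTop.2 fun η hη => ?_
    set ε := η / (4 * C₀) with hεdef
    have hε : 0 < ε := by positivity
    obtain ⟨δ, hδ, hδ'⟩ := Metric.tendsto_nhdsWithin_nhds.1 hC ε hε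
    obtain ⟨K₀, hK₀⟩ := hb δ hδ
    set K := |K₀| + ‖C‖ * δ ^ (-(3 / 2) : ℝ) with hK
    have hK0 : 0 ≤ K := by positivity
    have hg : ∀ x : ℂ, ‖x‖ < 1 → ‖f x - C * (1 / (1 - x) ^ (3 / 2 : ℂ))‖ ≤
        ε * ‖1 - x‖ ^ (-(3 / 2) : ℝ) + K := by
      intro x hx
      have hx1 : 0 < ‖1 - x‖ := by
        rw [norm_pos_iff, sub_ne_zero]
        rintro rfl
        simp at hx
      have hpos : 0 < ‖1 - x‖ ^ (3 / 2 : ℝ) := by positivity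
      have hne : (1 - x) ^ (3 / 2 : ℂ) ≠ 0 := by
        rw [← norm_pos_iff, hnorm]; exact hpos
      by_cases hxδ : δ ≤ ‖1 - x‖
      · have h1 : ‖C * (1 / (1 - x) ^ (3 / 2 : ℂ))‖ ≤ ‖C‖ * δ ^ (-(3 / 2) : ℝ) := by
          rw [norm_mul, norm_div, norm_one, hnorm, one_div, ← Real.rpow_neg hx1.le]
          exact mul_le_mul_of_nonneg_left
            (Real.rpow_le_rpow_of_nonpos hδ hxδ (by norm_num)) (norm_nonneg _)
        have h2 := (hK₀ x hx hxδ).trans (le_abs_self K₀)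
        have h3 := norm_sub_le (f x) (C * (1 / (1 - x) ^ (3 / 2 : ℂ)))
        have h4 : 0 ≤ ε * ‖1 - x‖ ^ (-(3 / 2) : ℝ) := by positivity
        linarith
      · have h1 := hδ' (show x ∈ Metric.ball (0 : ℂ) 1 by simpa using hx)
          (by rw [dist_comm, dist_eq_norm]; exact not_le.1 hxδ)
        rw [dist_eq_norm] at h1
        have h2 : f x - C * (1 / (1 - x) ^ (3 / 2 : ℂ)) =
            (f x * (1 - x) ^ (3 / 2 : ℂ) - C) / (1 - x) ^ (3 / 2 : ℂ) := by
          field_simp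
        rw [h2, norm_div, hnorm, div_eq_mul_inv, ← Real.rpow_neg hx1.le]
        have h3 : 0 ≤ ‖1 - x‖ ^ (-(3 / 2) : ℝ) := by positivity
        have h4 := mul_le_mul_of_nonneg_right h1.le h3
        linarith
    have h5 := hmain (fun n => a n - C * b n) _ ε K hε.le hK0 (fun x hx => by
      refine ((h x hx).sub ((hbs x hx).mul_left C)).congr_fun fun n => ?_
      ring) hg
    have h6 : Tendsto (fun n : ℕ => C₀ * K / Real.sqrt n) atTop (𝓝 0) :=
      tendsto_const_nhds.div_atTop (Real.tendsto_sqrt_atTop.comp tendsto_natCast_atTop_atTop)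
    obtain ⟨N, hN⟩ := (Metric.tendsto_atTop.1 h6) (η / 4) (by positivity)
    refine ⟨max N 2, fun n hn => ?_⟩
    have h7 := h5 n (le_of_max_le_right hn)
    have h8 := hN n (le_of_max_le_left hn)
    rw [Real.dist_eq, sub_zero] at h8
    rw [Real.dist_eq, sub_zero, abs_norm, norm_div, Complex.norm_real,
      Real.norm_of_nonneg (Real.sqrt_nonneg _)]
    have hs : 0 < Real.sqrt n := Real.sqrt_pos.2 (by
      have : 2 ≤ n := le_of_max_le_right hn
      positivity)
    have h9 := (le_abs_self _).trans_lt h8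
    rw [div_lt_iff₀ hs] at h9 ⊢
    have h10 : C₀ * (ε * Real.sqrt n) = η / 4 * Real.sqrt n := by
      rw [hεdef]; field_simp
    have h11 : 0 < η * Real.sqrt n := by positivity
    calc _ ≤ _ := h7
      _ = C₀ * (ε * Real.sqrt n) + C₀ * K := by ring
      _ < _ := by rw [h10]; linarith
  have h12 := hd.add (tendsto_choose_div_sqrt.const_mul C)
  rw [zero_add] at h12
  refine h12.congr fun n => ?_
  simp only [b]
  ring

/-! ### Weights of decorated trees at real arguments -/

/-- The total weight of the rooted trees on `m` vertices, up to the factor `m / m!`, where each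
edge has weight `d`, each leaf weight `a` and each internal node weight `b`. -/
noncomputable def rootedWeight {R : Type*} [CommRing R] (m : ℕ) (d a b : R) : R :=
  d ^ (m - 1) * treeWeight m a b

/-- The coefficients, up to the factor `1 / m!`, of the branching series `V` which becomes singular
when it reaches the value `1`. In terms of `u = x d (a - b)` and `w = x d b` it is `T (w * exp u)`
for the tree function `T`; the form chosen here shows that its coefficients are nonnegative. -/
noncomputable def branchWeight {R : Type*} [CommRing R] (m : ℕ) (d a b : R) : R :=
  match m with
  | 0 => 0
  | 1 => d * b
  | m + 2 => d ^ (m + 2) * rangeWeight (m + 2) (m + 1) a b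

lemma rangeWeight_nonneg (m N : ℕ) {a b : ℝ} (ha : 0 ≤ a) (hb : 0 ≤ b) :
    0 ≤ rangeWeight m N a b := by
  unfold rangeWeight
  refine Finset.sum_nonneg fun f _ => Finset.prod_nonneg fun v _ => ?_
  split_ifs <;> assumption

lemma treeWeight_nonneg (m : ℕ) {a b : ℝ} (ha : 0 ≤ a) (hb : 0 ≤ b) : 0 ≤ treeWeight m a b := by
  rcases m with _ | _ | m
  · exact le_rfl
  · exact ha
  · exact rangeWeight_nonneg _ _ ha hb

/-- The exponential generating function of `rangeWeight m N a b` in the variable `N`. -/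
lemma hasSum_rangeWeight (m : ℕ) (a b z : ℝ) :
    HasSum (fun N : ℕ => z ^ N / (N.factorial : ℝ) * rangeWeight m N a b)
      ((a + b * (Real.exp z - 1)) ^ m) := by
  have h1 : (a + b * (Real.exp z - 1)) ^ m = ∑ k ∈ Finset.range (m + 1),
      (m.choose k : ℝ) * ((a - b) ^ k * b ^ (m - k)) * Real.exp (((m - k : ℕ) : ℝ) * z) := by
    rw [show a + b * (Real.exp z - 1) = (a - b) + b * Real.exp z by ring, add_pow]
    refine Finset.sum_congr rfl fun k _ => ?_
    rw [mul_pow, Real.exp_nat_mul]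
    ring
  rw [h1]
  have h2 : ∀ k ∈ Finset.range (m + 1), HasSum (fun N : ℕ => (m.choose k : ℝ) *
      ((a - b) ^ k * b ^ (m - k)) * ((((m - k : ℕ) : ℝ) * z) ^ N / (N.factorial : ℝ)))
      ((m.choose k : ℝ) * ((a - b) ^ k * b ^ (m - k)) * Real.exp (((m - k : ℕ) : ℝ) * z)) :=
    fun k _ => (hasSum_pow_div_factorial _).mul_left _
  refine (hasSum_sum h2).congr_fun fun N => ?_
  rw [rangeWeight_eq, Finset.mul_sum]
  refine Finset.sum_congr rfl fun k _ => ?_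
  rw [mul_pow]
  ring

lemma rangeWeight_le (m N : ℕ) {a b z : ℝ} (ha : 0 ≤ a) (hb : 0 ≤ b) (hz : 0 < z) :
    rangeWeight m N a b ≤ N.factorial / z ^ N * (a + b * (Real.exp z - 1)) ^ m := by
  have h := le_hasSum (hasSum_rangeWeight m a b z) N fun k _ =>
    mul_nonneg (by positivity) (rangeWeight_nonneg m k ha hb)
  rw [div_mul_eq_mul_div, le_div_iff₀ (by positivity)]
  rw [div_mul_eq_mul_div, div_le_iff₀ (by positivity)] at h
  linarith

/-- One more value can be chosen in `m` ways, and at worst it turns a factor `a` into `b`. -/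
lemma rangeWeight_succ_le (m N : ℕ) {a b : ℝ} (ha : 0 < a) (hb : 0 ≤ b) :
    rangeWeight m (N + 1) a b ≤ m * (max 1 (b / a) * rangeWeight m N a b) := by
  classical
  have hc : 1 ≤ max 1 (b / a) := le_max_left _ _
  have hca : b ≤ max 1 (b / a) * a := by
    rw [← div_le_iff₀ ha]; exact le_max_right _ _
  have h1 : ∀ (i : Fin m) (g : Fin N → Fin m),
      (∏ v, if v ∈ Set.range (Fin.cons i g : Fin (N + 1) → Fin m) then b else a) ≤
      max 1 (b / a) * ∏ v, if v ∈ Set.range g then b else a := by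
    intro i g
    rw [← Finset.mul_prod_erase _ _ (Finset.mem_univ i),
      ← Finset.mul_prod_erase _ (fun v => if v ∈ Set.range g then b else a) (Finset.mem_univ i),
      ← mul_assoc]
    have h2 : ∏ v ∈ Finset.univ.erase i,
        (if v ∈ Set.range (Fin.cons i g : Fin (N + 1) → Fin m) then b else a) =
        ∏ v ∈ Finset.univ.erase i, (if v ∈ Set.range g then b else a) := by
      refine Finset.prod_congr rfl fun v hv => ?_
      have hv' : v ≠ i := Finset.ne_of_mem_erase hv
      simp [Fin.range_cons, hv']
    rw [h2]
    refine mul_le_mul_of_nonneg_right ?_ (Finset.prod_nonneg fun v _ => by split_ifs <;> linarith)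
    rw [if_pos ⟨0, rfl⟩]
    split_ifs
    · nlinarith
    · exact hca
  rw [rangeWeight, rangeWeight, ← (Fin.consEquiv fun _ => Fin m).sum_comp, Fintype.sum_prod_type,
    Finset.mul_sum]
  have h3 : ∀ i : Fin m, ∑ g : Fin N → Fin m, (∏ v, if v ∈ Set.range
      ((Fin.consEquiv fun _ => Fin m) (i, g) : Fin (N + 1) → Fin m) then b else a) ≤
      ∑ g : Fin N → Fin m, max 1 (b / a) * ∏ v, if v ∈ Set.range g then b else a :=
    fun i => Finset.sum_le_sum fun g _ => h1 i g
  refine (Finset.sum_le_sum fun i _ => h3 i).trans (le_of_eq ?_)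
  simp

/-- The bound behind both convergence and concentration: the terms of the rooted series are
dominated by powers of `ψ / z`, where `ψ = t d (a + b (exp z - 1))`. -/
lemma rootedWeight_le (m : ℕ) {t d a b z : ℝ} (ht : 0 ≤ t) (hd : 0 < d) (ha : 0 ≤ a) (hb : 0 ≤ b)
    (hz : 0 < z) : m / m.factorial * rootedWeight m d a b * t ^ m ≤
      (z ^ 2 + z) / d * (t * d * (a + b * (Real.exp z - 1)) / z) ^ m := by
  have hexp : 0 ≤ Real.exp z - 1 := by linarith [Real.add_one_le_exp z]
  have hX : 0 ≤ a + b * (Real.exp z - 1) := by positivity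
  rcases m with _ | _ | m
  · simp [rootedWeight, treeWeight]
    positivity
  · have h1 : (z ^ 2 + z) / d * (t * d * (a + b * (Real.exp z - 1)) / z) =
        (z + 1) * (t * (a + b * (Real.exp z - 1))) := by field_simp
    simp only [rootedWeight, treeWeight, zero_add, pow_one, Nat.sub_self, pow_zero, one_mul, h1,
      Nat.factorial_one, Nat.cast_one, div_one]
    have h2 : a * t ≤ t * (a + b * (Real.exp z - 1)) := by
      have : 0 ≤ t * (b * (Real.exp z - 1)) := by positivity
      linarith
    have h3 : 0 ≤ z * (t * (a + b * (Real.exp z - 1))) := by positivity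
    linarith
  · have h := rangeWeight_le (m + 2) m ha hb hz
    have hf : ((m + 2 : ℕ) : ℝ) / ((m + 2).factorial : ℝ) * m.factorial ≤ 1 := by
      rw [Nat.factorial_succ, Nat.factorial_succ]
      have : (m.factorial : ℝ) ≠ 0 := by positivity
      push_cast
      rw [div_mul_eq_mul_div, div_le_one (by positivity)]
      have h1 : (0 : ℝ) < m.factorial := by positivity
      have h2 : (0 : ℝ) ≤ (m : ℝ) := by positivity
      have h3 : 0 ≤ (m : ℝ) * m.factorial * (m + 2) := by positivity
      nlinarith
    set X := a + b * (Real.exp z - 1) with hXdef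
    have h0 : rootedWeight (m + 2) d a b = d ^ (m + 1) * rangeWeight (m + 2) m a b := rfl
    rw [h0]
    calc ((m + 2 : ℕ) : ℝ) / ((m + 2).factorial : ℝ) * (d ^ (m + 1) * rangeWeight (m + 2) m a b) *
          t ^ (m + 2)
        ≤ ((m + 2 : ℕ) : ℝ) / ((m + 2).factorial : ℝ) *
          (d ^ (m + 1) * (m.factorial / z ^ m * X ^ (m + 2))) * t ^ (m + 2) := by gcongr
      _ = (((m + 2 : ℕ) : ℝ) / ((m + 2).factorial : ℝ) * m.factorial) *
          (z ^ 2 / d * (t * d * X / z) ^ (m + 2)) := by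
        rw [div_pow, mul_pow, mul_pow]
        field_simp
        ring
      _ ≤ 1 * (z ^ 2 / d * (t * d * X / z) ^ (m + 2)) := by gcongr
      _ ≤ (z ^ 2 + z) / d * (t * d * X / z) ^ (m + 2) := by
        rw [one_mul]
        gcongr
        linarith

lemma branchWeight_le (m : ℕ) {t d a b : ℝ} (ht : 0 ≤ t) (hd : 0 ≤ d) (ha : 0 < a) (hb : 0 ≤ b) :
    1 / (m.factorial : ℝ) * branchWeight m d a b * t ^ m ≤
      d * max 1 (b / a) * (m / m.factorial * rootedWeight m d a b * t ^ m) := by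
  have hca : b ≤ max 1 (b / a) * a := by
    rw [← div_le_iff₀ ha]; exact le_max_right _ _
  rcases m with _ | _ | m
  · simp [rootedWeight, treeWeight, branchWeight]
  · simp only [branchWeight, rootedWeight, treeWeight, zero_add, pow_one, Nat.sub_self, pow_zero,
      one_mul, Nat.factorial_one, Nat.cast_one, div_one]
    nlinarith [mul_nonneg hd ht]
  · have h := rangeWeight_succ_le (m + 2) m ha hb
    have h0 : rootedWeight (m + 2) d a b = d ^ (m + 1) * rangeWeight (m + 2) m a b := rfl
    have h1 : branchWeight (m + 2) d a b = d ^ (m + 2) * rangeWeight (m + 2) (m + 1) a b := rfl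
    rw [h0, h1]
    calc 1 / ((m + 2).factorial : ℝ) * (d ^ (m + 2) * rangeWeight (m + 2) (m + 1) a b) * t ^ (m + 2)
        ≤ 1 / ((m + 2).factorial : ℝ) * (d ^ (m + 2) *
          ((m + 2 : ℕ) * (max 1 (b / a) * rangeWeight (m + 2) m a b))) * t ^ (m + 2) := by gcongr
      _ = _ := by ring

lemma sum_choose_eq_sum_antidiagonal (n N : ℕ) (u w : ℝ) :
    ∑ k ∈ Finset.range (n + 1 + 1), ((n + 1).choose k : ℝ) *
      (u ^ k * w ^ (n + 1 - k) * ((n + 1 - k : ℕ) : ℝ) ^ N) =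
    u ^ (n + 1) * 0 ^ N + ∑ x ∈ Finset.HasAntidiagonal.antidiagonal n,
      ((n + 1).choose x.2 : ℝ) * (u ^ x.2 * w ^ (x.1 + 1) * ((x.1 : ℝ) + 1) ^ N) := by
  rw [Finset.sum_range_succ, add_comm]
  congr 1
  · simp
  · rw [← Finset.Nat.sum_antidiagonal_swap, Finset.Nat.sum_antidiagonal_eq_sum_range_succ_mk]
    refine Finset.sum_congr rfl fun k hk => ?_
    have hk' : k ≤ n := by simpa [Nat.lt_succ_iff] using hk
    simp only [Prod.snd_swap, Prod.fst_swap]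
    rw [show n + 1 - k = n - k + 1 by omega]
    push_cast
    rfl

lemma mul_rangeWeight_eq (n N : ℕ) (t d a b : ℝ) :
    d ^ (n + 1) * rangeWeight (n + 1) N a b * t ^ (n + 1) =
    (t * d * (a - b)) ^ (n + 1) * 0 ^ N + ∑ x ∈ Finset.HasAntidiagonal.antidiagonal n,
      ((n + 1).choose x.2 : ℝ) *
        ((t * d * (a - b)) ^ x.2 * (t * d * b) ^ (x.1 + 1) * ((x.1 : ℝ) + 1) ^ N) := by
  rw [← sum_choose_eq_sum_antidiagonal, rangeWeight_eq, Finset.mul_sum, Finset.sum_mul]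
  refine Finset.sum_congr rfl fun k hk => ?_
  have hk' : k ≤ n + 1 := by simpa [Nat.lt_succ_iff] using hk
  have e1 : d ^ (n + 1) = d ^ k * d ^ (n + 1 - k) := by rw [← pow_add]; congr 1; omega
  have e2 : t ^ (n + 1) = t ^ k * t ^ (n + 1 - k) := by rw [← pow_add]; congr 1; omega
  rw [e1, e2]
  simp only [mul_pow]
  ring

lemma choose_div_factorial {n p q : ℕ} (h : p + q = n) :
    ((n + 1).choose q : ℝ) = (n + 1).factorial / ((p + 1).factorial * q.factorial) := by
  subst h
  rw [show p + q + 1 = (p + 1) + q by ring, Nat.add_choose, Nat.cast_div_charZero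
    (Nat.factorial_mul_factorial_dvd_factorial_add _ _)]
  push_cast
  rfl

/-- For a small variable `t` the branching series sums to the root `s` of `s = w exp (u + s)`, and
the rooted series is an explicit function of that root. -/
theorem exists_hasSum_branch_rooted {t d a b : ℝ} (ht : 0 ≤ t) (hd : 0 ≤ d) (hb : 0 ≤ b)
    (hsmall : t * d * b * Real.exp |t * d * (a - b)| ≤ 1 / 20) :
    ∃ s, s = t * d * b * Real.exp (t * d * (a - b) + s) ∧
      HasSum (fun m : ℕ => 1 / (m.factorial : ℝ) * branchWeight m d a b * t ^ m) s ∧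
      HasSum (fun m : ℕ => d * (m / m.factorial * rootedWeight m d a b * t ^ m))
        ((1 + t * d * (a - b)) * (t * d * (a - b) + s)) := by
  set u := t * d * (a - b) with hu
  set w := t * d * b with hw
  have hw0 : 0 ≤ w := by positivity
  clear_value u w
  obtain ⟨s, hs, hsum⟩ := exists_treeFun_root hw0 hsmall
  have hsmall' : Real.exp 1 * (w * Real.exp |u|) < 1 := by
    have := Real.exp_one_lt_d9
    have h0 : 0 ≤ w * Real.exp |u| := by positivity
    nlinarith
  obtain ⟨h1, h2⟩ := hasSum_treeFun_expand hw0 hsmall' hsum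
  refine ⟨s, hs, ?_, ?_⟩
  · rw [← hasSum_nat_add_iff' 1]
    have e0 : branchWeight 0 d a b = 0 := rfl
    simp only [Finset.range_one, Finset.sum_singleton, e0, mul_zero, zero_mul, sub_zero]
    refine h1.congr_fun fun n => ?_
    rcases n with _ | n
    · simp [treeFunCoeff, branchWeight, hw]; ring
    · have e : branchWeight (n + 1 + 1) d a b =
        d ^ (n + 1 + 1) * rangeWeight (n + 1 + 1) (n + 1) a b := rfl
      rw [e, mul_assoc, mul_rangeWeight_eq, ← hu, ← hw, zero_pow (Nat.succ_ne_zero n), mul_zero,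
        zero_add, Finset.mul_sum]
      refine Finset.sum_congr rfl fun x hx => ?_
      have hx' := Finset.HasAntidiagonal.mem_antidiagonal.1 hx
      have hf : ((n + 1 + 1).factorial : ℝ) ≠ 0 := by positivity
      rw [choose_div_factorial hx', treeFunCoeff, ← hx', mul_pow ((x.1 : ℝ) + 1) u,
        pow_add ((x.1 : ℝ) + 1)]
      rw [← hx'] at hf
      field_simp
  · rw [← hasSum_nat_add_iff' 1]
    have e0 : (1 + u) * (u + s) - ∑ m ∈ Finset.range 1,
        d * ((m : ℝ) / m.factorial * rootedWeight m d a b * t ^ m) =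
        (1 + u) * s + u + u ^ 2 := by simp; ring
    rw [e0]
    refine ((h2.add (hasSum_ite_eq 0 u)).add (hasSum_ite_eq 1 (u ^ 2))).congr_fun fun n => ?_
    rcases n with _ | n
    · simp [treeFunCoeff, rootedWeight, treeWeight, hu, hw]; ring
    · have e : d * (((n + 1 + 1 : ℕ) : ℝ) / (n + 1 + 1).factorial *
          rootedWeight (n + 1 + 1) d a b * t ^ (n + 1 + 1)) =
          ((n + 1 + 1 : ℕ) : ℝ) / (n + 1 + 1).factorial *
          (d ^ (n + 1 + 1) * rangeWeight (n + 1 + 1) n a b * t ^ (n + 1 + 1)) := by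
        have : rootedWeight (n + 1 + 1) d a b = d ^ (n + 1) * rangeWeight (n + 1 + 1) n a b := rfl
        rw [this]; ring
      rw [e, mul_rangeWeight_eq, ← hu, ← hw, mul_add, add_comm, if_neg (Nat.succ_ne_zero n),
        add_zero,
        Finset.mul_sum]
      congr 1
      · refine Finset.sum_congr rfl fun x hx => ?_
        have hx' := Finset.HasAntidiagonal.mem_antidiagonal.1 hx
        have hf : ((n + 1 + 1).factorial : ℝ) ≠ 0 := by positivity
        have hx1 : ((x.1 : ℝ) + 1) ≠ 0 := by positivity
        have hcast : ((n + 1 + 1 : ℕ) : ℝ) = (x.1 : ℝ) + x.2 + 1 := by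
          rw [← hx']; push_cast; ring
        have hpow : ((x.1 : ℝ) + 1) ^ n * ((x.1 : ℝ) + 1) =
            ((x.1 : ℝ) + 1) ^ x.1 * ((x.1 : ℝ) + 1) ^ x.2 := by
          rw [← pow_succ, ← pow_add, hx']
        rw [choose_div_factorial hx', treeFunCoeff, hcast, mul_pow ((x.1 : ℝ) + 1) u]
        field_simp
        linear_combination (u ^ x.2 * w ^ (x.1 + 1) * ((x.1 : ℝ) + x.2 + 1)) * hpow
      · rcases n with _ | n
        · simp
        · simp

/-! ### Coefficients at a square root singularity -/

open Metric in
/-- A convergent power series on the unit disk may be differentiated term by term. -/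
theorem hasSum_deriv_of_hasSum {c : ℕ → ℂ} {f : ℂ → ℂ}
    (h : ∀ x : ℂ, ‖x‖ < 1 → HasSum (fun n => c n * x ^ n) (f x)) :
    ∀ x : ℂ, ‖x‖ < 1 → HasSum (fun n : ℕ => (((n : ℂ) + 1) * c (n + 1)) * x ^ n) (deriv f x) := by
  intro x hx
  have hp := hasFPowerSeriesOnBall_of_hasSum one_pos h
  have hd : DifferentiableOn ℂ f (ball 0 1) := by
    have := hp.differentiableOn
    rwa [Metric.eball_ofReal] at this
  have hd' : DifferentiableOn ℂ (deriv f) (ball 0 1) := hd.deriv isOpen_ball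
  have hc : ∀ n, iteratedDeriv n f 0 = n.factorial * c n := by
    intro n
    have := hp.factorial_smul 1 n
    rw [iteratedDeriv_eq_iteratedFDeriv, ← this]
    simp
  have := Complex.hasSum_taylorSeries_on_ball hd' (z := x) (by simpa using hx)
  refine this.congr_fun fun n => ?_
  rw [← iteratedDeriv_succ', hc, Nat.factorial_succ]
  have : (n.factorial : ℂ) ≠ 0 := by exact_mod_cast n.factorial_ne_zero
  simp only [sub_zero, smul_eq_mul]
  push_cast
  field_simp

/-- Second order expansion of `y * exp (1 - y)` at its critical point `y = 1`. -/
theorem tendsto_one_sub_mul_exp_div_sq :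
    Tendsto (fun y : ℂ => (1 - y * Complex.exp (1 - y)) / (1 - y) ^ 2) (nhdsWithin 1 {1}ᶜ)
      (nhds (1 / 2)) := by
  have key : Tendsto (fun d : ℂ => (1 - (1 - d) * Complex.exp d) / d ^ 2) (nhdsWithin 0 {0}ᶜ)
      (nhds (1 / 2)) := by
    have h3 := Complex.exp_sub_sum_range_isBigO_pow 3
    have h4 : (fun d : ℂ => d ^ 3) =o[nhds 0] fun d : ℂ => d ^ 2 := by
      simpa using isLittleO_pow_pow (𝕜 := ℂ) (show 2 < 3 by norm_num)
    have h5 := (h3.trans_isLittleO h4).tendsto_div_nhds_zero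
    have h6 : Tendsto (fun d : ℂ => 1 / 2 + d / 2 -
        (1 - d) * ((Complex.exp d - ∑ i ∈ Finset.range 3, d ^ i / i.factorial) / d ^ 2))
        (nhdsWithin 0 {0}ᶜ) (nhds (1 / 2 + 0 / 2 - (1 - 0) * 0)) := by
      refine ((tendsto_const_nhds.add (tendsto_id.div_const 2)).sub
        ((tendsto_const_nhds.sub tendsto_id).mul h5)).mono_left nhdsWithin_le_nhds
    simp only [zero_div, add_zero, mul_zero, sub_zero] at h6
    refine h6.congr' ?_
    filter_upwards [self_mem_nhdsWithin] with d hd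
    have hd : d ≠ 0 := hd
    simp only [Finset.sum_range_succ, Finset.sum_range_zero, Nat.factorial]
    field_simp
    push_cast
    ring
  have hsub : Tendsto (fun y : ℂ => 1 - y) (nhdsWithin 1 {1}ᶜ) (nhdsWithin 0 {0}ᶜ) := by
    refine tendsto_nhdsWithin_iff.2 ⟨?_, ?_⟩
    · have : Tendsto (fun y : ℂ => 1 - y) (nhds 1) (nhds (1 - 1)) :=
        tendsto_const_nhds.sub tendsto_id
      rw [sub_self] at this
      exact this.mono_left nhdsWithin_le_nhds
    · filter_upwards [self_mem_nhdsWithin] with y hy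
      exact sub_ne_zero.2 (Ne.symm hy)
  refine (key.comp hsub).congr fun y => ?_
  simp

/-- Real part of the principal square root on the right half plane. -/
theorem norm_le_two_mul_re_cpow_half {z : ℂ} (hz : 0 ≤ z.re) :
    ‖z ^ (1 / 2 : ℂ)‖ ≤ 2 * (z ^ (1 / 2 : ℂ)).re := by
  have e : (1 / 2 : ℂ) = ((1 / 2 : ℝ) : ℂ) := by push_cast; rfl
  rcases eq_or_ne z 0 with rfl | hz0
  · simp
  rw [e, Complex.cpow_ofReal_re, Complex.norm_cpow_of_ne_zero hz0]
  have h1 := abs_le.1 (Complex.abs_arg_le_pi_div_two_iff.2 hz)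
  have hπ := Real.pi_pos
  have : (1 / 2 : ℝ) ≤ Real.cos (z.arg * (1 / 2)) := by
    rw [← Real.cos_abs (z.arg * (1 / 2))]
    nth_rewrite 1 [← Real.cos_pi_div_three]
    refine Real.cos_le_cos_of_nonneg_of_le_pi (abs_nonneg _) (by linarith) ?_
    rw [abs_le]; constructor <;> linarith [h1.1, h1.2]
  have h0 : 0 ≤ ‖z‖ ^ (1 / 2 : ℝ) := by positivity
  simp only [Complex.ofReal_re, Complex.ofReal_im, mul_zero, Real.exp_zero, div_one]
  nlinarith

open Metric in
/-- At a square root singularity of `V = h * exp V` the function `(1 - V)⁻¹` behaves like a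
constant multiple of `(1 - x) ^ (-1 / 2)`. -/
theorem tendsto_inv_one_sub_mul_cpow_half {h V : ℂ → ℂ} {H : ℝ}
    (hh : HasDerivAt h H 1) (hVc : ContinuousOn V (closedBall 0 1))
    (hV : ∀ x ∈ closedBall (0 : ℂ) 1, V x = h x * Complex.exp (V x)) (hV1 : V 1 = 1)
    (hVle : ∀ x ∈ closedBall (0 : ℂ) 1, ‖V x‖ ≤ 1)
    (hne : ∀ x ∈ closedBall (0 : ℂ) 1, x ≠ 1 → V x ≠ 1) (hH : 0 < H) :
    Tendsto (fun x => (1 - V x)⁻¹ * (1 - x) ^ (1 / 2 : ℂ)) (nhdsWithin 1 (ball 0 1))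
      (nhds ((Real.sqrt (2 * (Real.exp 1 * H)))⁻¹ : ℝ)) := by
  have hsub : ball (0 : ℂ) 1 ⊆ closedBall 0 1 := ball_subset_closedBall
  have h1mem : (1 : ℂ) ∈ closedBall (0 : ℂ) 1 := by simp
  have hball1 : ∀ x ∈ ball (0 : ℂ) 1, x ≠ 1 := by
    rintro x hx rfl
    simp at hx
  set κ : ℝ := (Real.sqrt (2 * (Real.exp 1 * H)))⁻¹ with hκ
  have heH : 0 < 2 * (Real.exp 1 * H) := by positivity
  have hκ0 : 0 < κ := by positivity
  have hκ2 : κ ^ 2 = (1 / 2) / (Real.exp 1 * H) := by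
    rw [hκ, inv_pow, Real.sq_sqrt heH.le]
    field_simp
  have hVt : Tendsto V (nhdsWithin 1 (ball 0 1)) (nhdsWithin 1 {1}ᶜ) := by
    refine tendsto_nhdsWithin_iff.2 ⟨?_, ?_⟩
    · have := (hVc 1 h1mem).mono_left (nhdsWithin_mono _ hsub)
      rwa [hV1] at this
    · filter_upwards [self_mem_nhdsWithin] with x hx
      exact hne x (hsub hx) (hball1 x hx)
  have hA := tendsto_one_sub_mul_exp_div_sq.comp hVt
  have hh1 : Complex.exp 1 * h 1 = 1 := by
    have := hV 1 h1mem
    rw [hV1] at this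
    rw [mul_comm]; exact this.symm
  have hB : Tendsto (fun x => (1 - Complex.exp 1 * h x) / (1 - x)) (nhdsWithin 1 (ball 0 1))
      (nhds (Complex.exp 1 * H)) := by
    have h2 := (hasDerivAt_iff_tendsto_slope.1 hh).mono_left
      (nhdsWithin_mono 1 (show ball (0 : ℂ) 1 ⊆ {1}ᶜ from hball1))
    refine (h2.const_mul (Complex.exp 1)).congr' ?_
    filter_upwards [self_mem_nhdsWithin] with x hx
    have h3 : (1 : ℂ) - x ≠ 0 := sub_ne_zero.2 (hball1 x hx).symm
    have h4 : x - 1 ≠ 0 := sub_ne_zero.2 (hball1 x hx)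
    rw [slope_def_field]
    field_simp
    linear_combination (x - 1) * hh1
  have hne0 : Complex.exp 1 * (H : ℂ) ≠ 0 := by
    refine mul_ne_zero (Complex.exp_ne_zero _) ?_
    exact_mod_cast hH.ne'
  have hsq : Tendsto (fun x => ((1 - V x)⁻¹ * (1 - x) ^ (1 / 2 : ℂ)) ^ 2)
      (nhdsWithin 1 (ball 0 1)) (nhds ((κ : ℂ) ^ 2)) := by
    have h5 := hA.div hB hne0
    have e : (1 / 2 : ℂ) / (Complex.exp 1 * (H : ℂ)) = (κ : ℂ) ^ 2 := by
      rw [← Complex.ofReal_pow, hκ2]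
      push_cast; rfl
    rw [e] at h5
    refine h5.congr' ?_
    filter_upwards [self_mem_nhdsWithin, hB.eventually_ne hne0] with x hx hx0
    have h3 : (1 : ℂ) - x ≠ 0 := sub_ne_zero.2 (hball1 x hx).symm
    have h4 : 1 - V x ≠ 0 := sub_ne_zero.2 (hne x (hsub hx) (hball1 x hx)).symm
    have h6 : V x * Complex.exp (1 - V x) = Complex.exp 1 * h x := by
      nth_rewrite 1 [hV x (hsub hx)]
      rw [mul_assoc, ← Complex.exp_add, mul_comm]; congr 2; ring
    have h7 : 1 - Complex.exp 1 * h x ≠ 0 := fun h0 => hx0 (by simp [h0])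
    have h8 : ((1 - x) ^ (1 / 2 : ℂ)) ^ 2 = 1 - x := by
      rw [← Complex.cpow_nat_mul]; simp
    simp only [Function.comp_apply, Pi.div_apply]
    rw [h6, mul_pow, h8]
    field_simp
  -- the limit of the squares leaves the sign open; positivity of real parts decides it
  have hlow : ∀ x ∈ ball (0 : ℂ) 1, κ / 2 ≤ ‖(1 - V x)⁻¹ * (1 - x) ^ (1 / 2 : ℂ) + κ‖ := by
    intro x hx
    set σ := (1 - x) ^ (1 / 2 : ℂ) with hσ
    have h3 : (1 : ℂ) - x ≠ 0 := sub_ne_zero.2 (hball1 x hx).symm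
    have hσ0 : σ ≠ 0 := by
      rw [hσ, Ne, Complex.cpow_eq_zero_iff]; tauto
    have hre : ∀ y : ℂ, ‖y‖ ≤ 1 → 0 ≤ (1 - y).re := fun y hy => by
      have := (Complex.re_le_norm y).trans hy
      simp; exact this
    have hx1 : ‖x‖ ≤ 1 := by simpa using hsub hx
    have hσre := norm_le_two_mul_re_cpow_half (hre x hx1)
    rw [← hσ] at hσre
    have hs : 0 ≤ ((1 - V x)⁻¹).re := by
      rw [Complex.inv_re]
      exact div_nonneg (hre _ (hVle x (hsub hx))) (Complex.normSq_nonneg _)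
    have e1 : (1 - V x)⁻¹ * σ + κ = σ * ((1 - V x)⁻¹ + κ * σ⁻¹) := by field_simp
    have hn : 0 < ‖σ‖ := norm_pos_iff.2 hσ0
    have h9 : κ / (2 * ‖σ‖) ≤ ((1 - V x)⁻¹ + κ * σ⁻¹).re := by
      rw [Complex.add_re, Complex.re_ofReal_mul, Complex.inv_re σ, Complex.normSq_eq_norm_sq]
      have : κ / (2 * ‖σ‖) ≤ κ * (σ.re / ‖σ‖ ^ 2) := by
        rw [mul_div_assoc', div_le_div_iff₀ (by positivity) (by positivity)]
        have := mul_le_mul_of_nonneg_left hσre (mul_nonneg hκ0.le hn.le)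
        nlinarith
      linarith
    rw [e1, norm_mul]
    calc κ / 2 = ‖σ‖ * (κ / (2 * ‖σ‖)) := by field_simp
      _ ≤ _ := by
        gcongr
        exact h9.trans (Complex.re_le_norm _)
  rw [tendsto_iff_norm_sub_tendsto_zero] at hsq ⊢
  have hz := hsq.const_mul (2 / κ)
  rw [mul_zero] at hz
  refine squeeze_zero' (Eventually.of_forall fun _ => norm_nonneg _) ?_ hz
  filter_upwards [self_mem_nhdsWithin] with x hx
  have h10 := hlow x hx
  set W := (1 - V x)⁻¹ * (1 - x) ^ (1 / 2 : ℂ)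
  rw [show W ^ 2 - (κ : ℂ) ^ 2 = (W + κ) * (W - κ) by ring, norm_mul]
  calc ‖W - κ‖ = 2 / κ * (κ / 2 * ‖W - κ‖) := by field_simp
    _ ≤ _ := by gcongr

/-- The branches of `V = h * exp V` are differentiable, with a pole of the derivative at `V = 1`. -/
theorem hasDerivAt_of_eq_mul_exp {h V : ℂ → ℂ} {x : ℂ} (hh : DifferentiableAt ℂ h x)
    (hVd : DifferentiableAt ℂ V x) (hV : ∀ᶠ y in nhds x, V y = h y * Complex.exp (V y))
    (hne : V x ≠ 1) :
    HasDerivAt V (deriv h x * Complex.exp (V x) * (1 - V x)⁻¹) x := by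
  have h1 := hh.hasDerivAt.mul hVd.hasDerivAt.cexp
  have h2 := hVd.hasDerivAt.unique (h1.congr_of_eventuallyEq hV)
  have h3 := hV.self_of_nhds
  have h4 : 1 - V x ≠ 0 := sub_ne_zero.2 hne.symm
  have : deriv V x = deriv h x * Complex.exp (V x) * (1 - V x)⁻¹ := by
    field_simp
    linear_combination h2 - deriv V x * h3
  rw [← this]
  exact hVd.hasDerivAt

open Metric in
/-- The coefficients of a function `g0 + g1 * exp V` are asymptotically `c * n ^ (-3 / 2)`, where
`V = h * exp V` has its only singularity on the closed unit disk at `x = 1`, where `V = 1`. The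
second derivative is a polynomial of degree three in `(1 - V)⁻¹`, so it grows like
`(1 - x) ^ (-3 / 2)`. -/
theorem exists_tendsto_coeff_of_sqrt_singularity {R : ℝ} (hR : 1 < R) {h g0 g1 V : ℂ → ℂ}
    {a : ℕ → ℝ} {H γ : ℝ}
    (hh : DifferentiableOn ℂ h (ball 0 R)) (hg0 : DifferentiableOn ℂ g0 (ball 0 R))
    (hg1 : DifferentiableOn ℂ g1 (ball 0 R))
    (hVc : ContinuousOn V (closedBall 0 1)) (hVd : DifferentiableOn ℂ V (ball 0 1))
    (hV : ∀ x ∈ closedBall (0 : ℂ) 1, V x = h x * Complex.exp (V x)) (hV1 : V 1 = 1)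
    (hVle : ∀ x ∈ closedBall (0 : ℂ) 1, ‖V x‖ ≤ 1)
    (hne : ∀ x ∈ closedBall (0 : ℂ) 1, x ≠ 1 → V x ≠ 1)
    (hH : 0 < H) (hh1 : deriv h 1 = H) (hγ : 0 < γ) (hg1γ : g1 1 = γ)
    (ha : ∀ x : ℂ, ‖x‖ < 1 → HasSum (fun n => (a n : ℂ) * x ^ n)
      (g0 x + g1 x * Complex.exp (V x))) :
    ∃ c : ℝ, 0 < c ∧ Tendsto (fun n : ℕ => (n : ℝ) ^ (3 / 2 : ℝ) * a n) atTop (nhds c) := by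
  have hsub : ball (0 : ℂ) 1 ⊆ closedBall 0 1 := ball_subset_closedBall
  have hsubR : closedBall (0 : ℂ) 1 ⊆ ball 0 R := closedBall_subset_ball hR
  have h1mem : (1 : ℂ) ∈ closedBall (0 : ℂ) 1 := by simp
  have hball1 : ∀ x ∈ ball (0 : ℂ) 1, x ≠ 1 := by
    rintro x hx rfl
    simp at hx
  have hd1 : ∀ {f : ℂ → ℂ}, DifferentiableOn ℂ f (ball 0 R) → ∀ x ∈ ball (0 : ℂ) R,
      HasDerivAt f (deriv f x) x := fun hf x hx =>
    (hf.differentiableAt (isOpen_ball.mem_nhds hx)).hasDerivAt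
  have hdd : ∀ {f : ℂ → ℂ}, DifferentiableOn ℂ f (ball 0 R) →
      DifferentiableOn ℂ (deriv f) (ball 0 R) := fun hf => hf.deriv isOpen_ball
  set E : ℂ → ℂ := fun x => Complex.exp (V x) with hE
  set s : ℂ → ℂ := fun x => (1 - V x)⁻¹ with hs
  set k : ℂ → ℂ := fun x => g1 x * deriv h x with hk
  have hkd : DifferentiableOn ℂ k (ball 0 R) := hg1.mul (hdd hh)
  have hVder : ∀ x ∈ ball (0 : ℂ) 1, HasDerivAt V (deriv h x * E x * s x) x := fun x hx =>
    hasDerivAt_of_eq_mul_exp ((hh.differentiableAt (isOpen_ball.mem_nhds (hsubR (hsub hx)))))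
      (hVd.differentiableAt (isOpen_ball.mem_nhds hx))
      (by filter_upwards [isOpen_ball.mem_nhds hx] with y hy using hV y (hsub hy))
      (hne x (hsub hx) (hball1 x hx))
  have hEder : ∀ x ∈ ball (0 : ℂ) 1, HasDerivAt E (E x * (deriv h x * E x * s x)) x := fun x hx =>
    (hVder x hx).cexp
  have hsder : ∀ x ∈ ball (0 : ℂ) 1, HasDerivAt s (deriv h x * E x * s x * s x ^ 2) x := by
    intro x hx
    have h4 : 1 - V x ≠ 0 := sub_ne_zero.2 (hne x (hsub hx) (hball1 x hx)).symm
    refine (((hVder x hx).const_sub 1).inv h4).congr_deriv ?_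
    simp only [hs, neg_neg]
    rw [inv_pow]; rfl
  set F : ℂ → ℂ := fun x => g0 x + g1 x * E x with hF
  set F1 : ℂ → ℂ := fun x => deriv g0 x + deriv g1 x * E x + k x * E x ^ 2 * s x with hF1
  set A1 : ℂ → ℂ := fun x => (deriv g1 x * deriv h x + deriv k x) * E x ^ 2 with hA1
  set A2 : ℂ → ℂ := fun x => 2 * k x * deriv h x * E x ^ 3 with hA2
  set A3 : ℂ → ℂ := fun x => k x * deriv h x * E x ^ 3 with hA3
  set A0 : ℂ → ℂ := fun x => deriv (deriv g0) x + deriv (deriv g1) x * E x with hA0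
  set F2 : ℂ → ℂ := fun x => A0 x + A1 x * s x + A2 x * s x ^ 2 + A3 x * s x ^ 3 with hF2
  have hFder : ∀ x ∈ ball (0 : ℂ) 1, HasDerivAt F (F1 x) x := by
    intro x hx
    have hxR := hsubR (hsub hx)
    refine ((hd1 hg0 x hxR).add ((hd1 hg1 x hxR).mul (hEder x hx))).congr_deriv ?_
    simp only [hF1, hk]; ring
  have hF1der : ∀ x ∈ ball (0 : ℂ) 1, HasDerivAt F1 (F2 x) x := by
    intro x hx
    have hxR := hsubR (hsub hx)
    refine (((hd1 (hdd hg0) x hxR).add ((hd1 (hdd hg1) x hxR).mul (hEder x hx))).add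
      (((hd1 hkd x hxR).mul ((hEder x hx).pow 2)).mul (hsder x hx))).congr_deriv ?_
    simp only [hF2, hA0, hA1, hA2, hA3]
    simp only [Nat.cast_ofNat, Nat.add_one_sub_one, Pi.pow_apply, Pi.mul_apply]
    simp only [hk]
    ring
  have hcoef : ∀ x : ℂ, ‖x‖ < 1 → HasSum (fun n : ℕ =>
      (((n : ℂ) + 1) * ((((n + 1 : ℕ) : ℂ) + 1) * a (n + 1 + 1))) * x ^ n) (F2 x) := by
    have h1 : ∀ x : ℂ, ‖x‖ < 1 → HasSum
        (fun n : ℕ => (((n : ℂ) + 1) * a (n + 1)) * x ^ n) (F1 x) := by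
      intro x hx
      rw [← (hFder x (by simpa using hx)).deriv]
      exact hasSum_deriv_of_hasSum (c := fun n => (a n : ℂ)) ha x hx
    intro x hx
    rw [← (hF1der x (by simpa using hx)).deriv]
    exact hasSum_deriv_of_hasSum (c := fun n => ((n : ℂ) + 1) * a (n + 1)) h1 x hx
  have hEc : ContinuousOn E (closedBall 0 1) := hVc.cexp
  have hcs : ∀ {f : ℂ → ℂ}, DifferentiableOn ℂ f (ball 0 R) → ContinuousOn f (closedBall 0 1) :=
    fun hf => hf.continuousOn.mono hsubR
  have hA0c : ContinuousOn A0 (closedBall 0 1) :=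
    (hcs (hdd (hdd hg0))).add ((hcs (hdd (hdd hg1))).mul hEc)
  have hA1c : ContinuousOn A1 (closedBall 0 1) :=
    (((hcs (hdd hg1)).mul (hcs (hdd hh))).add (hcs (hdd hkd))).mul (hEc.pow 2)
  have hA3c : ContinuousOn A3 (closedBall 0 1) :=
    ((hcs hkd).mul (hcs (hdd hh))).mul (hEc.pow 3)
  have hA2c : ContinuousOn A2 (closedBall 0 1) :=
    ((continuousOn_const.mul (hcs hkd)).mul (hcs (hdd hh))).mul (hEc.pow 3)
  set κ : ℝ := (Real.sqrt (2 * (Real.exp 1 * H)))⁻¹ with hκ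
  have hκ0 : 0 < κ := by positivity
  have hlim : Tendsto (fun x => F2 x * (1 - x) ^ (3 / 2 : ℂ)) (nhdsWithin 1 (ball 0 1))
      (nhds (A3 1 * (κ : ℂ) ^ 3)) := by
    have hsσ := tendsto_inv_one_sub_mul_cpow_half (h := h) (H := H)
      (hh1 ▸ hd1 hh 1 (hsubR h1mem)) hVc hV hV1 hVle hne hH
    have hσ : Tendsto (fun x : ℂ => (1 - x) ^ (1 / 2 : ℂ)) (nhdsWithin 1 (ball 0 1)) (nhds 0) := by
      rw [tendsto_zero_iff_norm_tendsto_zero]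
      have h1 : Tendsto (fun x : ℂ => ‖1 - x‖ ^ (1 / 2 : ℝ)) (nhds 1)
          (nhds (‖(1 : ℂ) - 1‖ ^ (1 / 2 : ℝ))) :=
        ((continuous_const.sub continuous_id).norm.rpow_const
          (fun _ => Or.inr (by norm_num))).tendsto 1
      rw [sub_self, norm_zero, Real.zero_rpow (by norm_num)] at h1
      refine (h1.mono_left nhdsWithin_le_nhds).congr fun x => ?_
      rw [show (1 / 2 : ℂ) = ((1 / 2 : ℝ) : ℂ) by push_cast; rfl, Complex.norm_cpow_real]
    have hat : ∀ {f : ℂ → ℂ}, ContinuousOn f (closedBall 0 1) →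
        Tendsto f (nhdsWithin 1 (ball 0 1)) (nhds (f 1)) := fun hf =>
      (hf 1 h1mem).mono_left (nhdsWithin_mono _ hsub)
    have hT := ((((hat hA0c).mul (hσ.pow 3)).add (((hat hA1c).mul hsσ).mul (hσ.pow 2))).add
      (((hat hA2c).mul (hsσ.pow 2)).mul hσ)).add ((hat hA3c).mul (hsσ.pow 3))
    have e0 : A0 1 * 0 ^ 3 + A1 1 * (κ : ℂ) * 0 ^ 2 + A2 1 * (κ : ℂ) ^ 2 * 0 +
      A3 1 * (κ : ℂ) ^ 3 = A3 1 * (κ : ℂ) ^ 3 := by ring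
    rw [e0] at hT
    refine hT.congr fun x => ?_
    have e1 : (1 - x) ^ (3 / 2 : ℂ) = ((1 - x) ^ (1 / 2 : ℂ)) ^ 3 := by
      rw [← Complex.cpow_nat_mul]; norm_num
    rw [e1]
    simp only [hF2, hs]
    ring
  have hbd : ∀ δ > 0, ∃ K, ∀ x : ℂ, ‖x‖ < 1 → δ ≤ ‖1 - x‖ → ‖F2 x‖ ≤ K := by
    intro δ hδ
    have hcl : IsClosed {x : ℂ | δ ≤ ‖1 - x‖} :=
      isClosed_le continuous_const (continuous_const.sub continuous_id).norm
    have hK : IsCompact (closedBall (0 : ℂ) 1 ∩ {x : ℂ | δ ≤ ‖1 - x‖}) :=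
      (isCompact_closedBall 0 1).inter_right hcl
    have hm : ∀ {f : ℂ → ℂ}, ContinuousOn f (closedBall 0 1) →
      ContinuousOn f (closedBall (0 : ℂ) 1 ∩ {x : ℂ | δ ≤ ‖1 - x‖}) := fun hf =>
        hf.mono Set.inter_subset_left
    have hsc : ContinuousOn s (closedBall (0 : ℂ) 1 ∩ {x : ℂ | δ ≤ ‖1 - x‖}) := by
      refine (continuousOn_const.sub (hm hVc)).inv₀ ?_
      rintro x ⟨hx, hx'⟩
      refine sub_ne_zero.2 (hne x hx ?_).symm
      rintro rfl
      have : δ ≤ 0 := by simpa using hx'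
      linarith
    obtain ⟨K, hK⟩ := hK.exists_bound_of_continuousOn
      ((((hm hA0c).add ((hm hA1c).mul hsc)).add ((hm hA2c).mul (hsc.pow 2))).add
        ((hm hA3c).mul (hsc.pow 3)))
    exact ⟨K, fun x hx hx' => hK x ⟨by simpa using hx.le, hx'⟩⟩
  have hT := tendsto_coeff_div_sqrt hcoef hlim hbd
  have hA31 : A3 1 = ((γ * H * H * Real.exp 1 ^ 3 : ℝ) : ℂ) := by
    simp only [hA3, hk, hE, hg1γ, hh1, hV1]
    push_cast; rfl
  have hG : Complex.Gamma (3 / 2) = ((Real.Gamma (3 / 2) : ℝ) : ℂ) := by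
    rw [← Complex.Gamma_ofReal]; norm_num
  have hGpos : 0 < Real.Gamma (3 / 2) := Real.Gamma_pos_of_pos (by norm_num)
  refine ⟨γ * H * H * Real.exp 1 ^ 3 * κ ^ 3 * (Real.Gamma (3 / 2))⁻¹, by positivity, ?_⟩
  have hTr : Tendsto (fun n : ℕ => ((n : ℝ) + 1) * ((n : ℝ) + 2) * a (n + 2) / Real.sqrt n) atTop
      (nhds (γ * H * H * Real.exp 1 ^ 3 * κ ^ 3 * (Real.Gamma (3 / 2))⁻¹)) := by
    have := (Complex.continuous_re.tendsto _).comp hT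
    rw [hA31, hG] at this
    have e : (((γ * H * H * Real.exp 1 ^ 3 : ℝ) : ℂ) * (κ : ℂ) ^ 3 *
        ((Real.Gamma (3 / 2) : ℝ) : ℂ)⁻¹).re =
        γ * H * H * Real.exp 1 ^ 3 * κ ^ 3 * (Real.Gamma (3 / 2))⁻¹ := by
      rw [← Complex.ofReal_pow, ← Complex.ofReal_inv, ← Complex.ofReal_mul, ← Complex.ofReal_mul,
        Complex.ofReal_re]
    rw [e] at this
    refine this.congr fun n => ?_
    have e2 : ((n : ℂ) + 1) * ((((n + 1 : ℕ) : ℂ) + 1) * a (n + 1 + 1)) / ((Real.sqrt n : ℝ) : ℂ) =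
        ((((n : ℝ) + 1) * ((n : ℝ) + 2) * a (n + 2) / Real.sqrt n : ℝ) : ℂ) := by
      push_cast; ring
    simp only [Function.comp_apply]
    rw [e2, Complex.ofReal_re]
  rw [← tendsto_add_atTop_iff_nat 2]
  have hratio : Tendsto (fun n : ℕ => Real.sqrt (1 - (1 / ((n : ℝ) + 1)) ^ 2)) atTop (nhds 1) := by
    have h1 : Tendsto (fun n : ℕ => 1 / ((n : ℝ) + 1)) atTop (nhds 0) :=
      tendsto_one_div_add_atTop_nhds_zero_nat
    have h2 := ((h1.pow 2).const_sub 1).sqrt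
    simpa using h2
  have := hTr.mul hratio
  rw [mul_one] at this
  refine this.congr' ?_
  filter_upwards [eventually_gt_atTop 0] with n hn
  have hn' : (0 : ℝ) < n := by exact_mod_cast hn
  have e1 : (1 - (1 / ((n : ℝ) + 1)) ^ 2) = n * ((n : ℝ) + 2) / ((n : ℝ) + 1) ^ 2 := by
    field_simp; ring
  rw [e1, Real.sqrt_div (by positivity), Real.sqrt_sq (by positivity), Real.sqrt_mul hn'.le]
  have e2 : (((n + 2 : ℕ) : ℝ)) ^ (3 / 2 : ℝ) = ((n : ℝ) + 2) * Real.sqrt ((n : ℝ) + 2) := by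
    push_cast
    rw [show (3 / 2 : ℝ) = 1 + 1 / 2 by norm_num, Real.rpow_add (by positivity), Real.rpow_one,
      Real.sqrt_eq_rpow]
  rw [e2]
  have : 0 < Real.sqrt n := Real.sqrt_pos.2 hn'
  field_simp

/-! ### Evaluation of power series with nonnegative coefficients -/

/-- The power series `f` has nonnegative coefficients and converges at `t` with sum `y`. -/
def EvalsTo (t : ℝ) (f : PowerSeries ℝ) (y : ℝ) : Prop :=
  (∀ n, 0 ≤ PowerSeries.coeff n f) ∧ HasSum (fun n => PowerSeries.coeff n f * t ^ n) y

namespace EvalsTo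

variable {t : ℝ} {f g : PowerSeries ℝ} {y z : ℝ}

lemma one : EvalsTo t 1 1 := by
  refine ⟨fun n => ?_, ?_⟩
  · rw [PowerSeries.coeff_one]; split_ifs <;> norm_num
  · refine (hasSum_ite_eq 0 (1 : ℝ)).congr_fun fun n => ?_
    rw [PowerSeries.coeff_one]
    rcases n with _ | n <;> simp

lemma zero : EvalsTo t 0 0 := ⟨fun n => by simp, by simp⟩

lemma add (hf : EvalsTo t f y) (hg : EvalsTo t g z) : EvalsTo t (f + g) (y + z) := by
  refine ⟨fun n => ?_, (hf.2.add hg.2).congr_fun fun n => ?_⟩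
  · rw [map_add]; exact add_nonneg (hf.1 n) (hg.1 n)
  · rw [map_add, add_mul]

lemma mul (ht : 0 ≤ t) (hf : EvalsTo t f y) (hg : EvalsTo t g z) : EvalsTo t (f * g) (y * z) := by
  refine ⟨fun n => ?_, ?_⟩
  · rw [PowerSeries.coeff_mul]
    exact Finset.sum_nonneg fun x _ => mul_nonneg (hf.1 _) (hg.1 _)
  · have hs : Summable fun x : ℕ × ℕ => (PowerSeries.coeff x.1 f * t ^ x.1) *
        (PowerSeries.coeff x.2 g * t ^ x.2) :=
      hf.2.summable.mul_of_nonneg hg.2.summable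
        (fun n => mul_nonneg (hf.1 n) (pow_nonneg ht n))
        (fun n => mul_nonneg (hg.1 n) (pow_nonneg ht n))
    have := HasSum.antidiagonal_of_prod hs (g := fun p => PowerSeries.coeff p f * t ^ p * z)
      (fun p => hg.2.mul_left _) (hf.2.mul_right z)
    refine this.congr_fun fun n => ?_
    rw [PowerSeries.coeff_mul, Finset.sum_mul]
    refine Finset.sum_congr rfl fun x hx => ?_
    rw [← Finset.HasAntidiagonal.mem_antidiagonal.1 hx, pow_add]
    ring

lemma pow (ht : 0 ≤ t) (hf : EvalsTo t f y) (k : ℕ) : EvalsTo t (f ^ k) (y ^ k) := by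
  induction k with
  | zero => simpa using one
  | succ k ih => rw [pow_succ, pow_succ]; exact ih.mul ht hf

lemma prod {ι : Type*} (ht : 0 ≤ t) (s : Finset ι) {F : ι → PowerSeries ℝ} {Y : ι → ℝ}
    (h : ∀ i, EvalsTo t (F i) (Y i)) : EvalsTo t (∏ i ∈ s, F i) (∏ i ∈ s, Y i) := by
  classical
  induction s using Finset.induction_on with
  | empty => simpa using one
  | insert i s hi ih => rw [Finset.prod_insert hi, Finset.prod_insert hi]; exact (h i).mul ht ih

lemma sum {ι : Type*} (s : Finset ι) {F : ι → PowerSeries ℝ} {Y : ι → ℝ}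
    (h : ∀ i, EvalsTo t (F i) (Y i)) : EvalsTo t (∑ i ∈ s, F i) (∑ i ∈ s, Y i) := by
  classical
  induction s using Finset.induction_on with
  | empty => simpa using zero
  | insert i s hi ih => rw [Finset.sum_insert hi, Finset.sum_insert hi]; exact (h i).add ih

lemma rangeWeight (ht : 0 ≤ t) (hf : EvalsTo t f y) (hg : EvalsTo t g z) (m N : ℕ) :
    EvalsTo t (rangeWeight m N f g) (rangeWeight m N y z) := by
  refine sum _ fun i => prod ht _ fun v => ?_
  split_ifs <;> assumption

lemma treeWeight (ht : 0 ≤ t) (hf : EvalsTo t f y) (hg : EvalsTo t g z) (m : ℕ) :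
    EvalsTo t (treeWeight m f g) (treeWeight m y z) := by
  rcases m with _ | _ | m
  · exact zero
  · exact hf
  · exact hf.rangeWeight ht hg _ _

lemma rootedWeight {d : PowerSeries ℝ} {x : ℝ} (ht : 0 ≤ t) (hd : EvalsTo t d x)
    (hf : EvalsTo t f y) (hg : EvalsTo t g z) (m : ℕ) :
    EvalsTo t (rootedWeight m d f g) (rootedWeight m x y z) :=
  (hd.pow ht _).mul ht (hf.treeWeight ht hg m)

lemma branchWeight {d : PowerSeries ℝ} {x : ℝ} (ht : 0 ≤ t) (hd : EvalsTo t d x)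
    (hf : EvalsTo t f y) (hg : EvalsTo t g z) (m : ℕ) :
    EvalsTo t (branchWeight m d f g) (branchWeight m x y z) := by
  rcases m with _ | _ | m
  · exact zero
  · exact hd.mul ht hg
  · exact (hd.pow ht _).mul ht (hf.rangeWeight ht hg _ _)

end EvalsTo

/-- The coefficients of `∑ m, κ m * x ^ m * G m`. -/
noncomputable def shiftedSum (κ : ℕ → ℝ) (G : ℕ → PowerSeries ℝ) (n : ℕ) : ℝ :=
  ∑ m ∈ Finset.range (n + 1), κ m * PowerSeries.coeff (n - m) (G m)

section ShiftedSum

variable {t : ℝ} {κ : ℕ → ℝ} {G : ℕ → PowerSeries ℝ} {g : ℕ → ℝ}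

lemma shiftedSum_mul_pow (n : ℕ) : shiftedSum κ G n * t ^ n =
    ∑ x ∈ Finset.HasAntidiagonal.antidiagonal n,
      κ x.1 * t ^ x.1 * (PowerSeries.coeff x.2 (G x.1) * t ^ x.2) := by
  rw [Finset.Nat.sum_antidiagonal_eq_sum_range_succ_mk, shiftedSum, Finset.sum_mul]
  refine Finset.sum_congr rfl fun m hm => ?_
  have hm' : m ≤ n := Nat.lt_succ_iff.1 (Finset.mem_range.1 hm)
  have e : t ^ n = t ^ m * t ^ (n - m) := by rw [← pow_add, Nat.add_sub_cancel' hm']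
  rw [e]; ring

lemma hasSum_shiftedSum (ht : 0 ≤ t) (hκ : ∀ m, 0 ≤ κ m) (hG : ∀ m, EvalsTo t (G m) (g m)) {s : ℝ}
    (hs : HasSum (fun m => κ m * g m * t ^ m) s) :
    HasSum (fun n => shiftedSum κ G n * t ^ n) s := by
  have hrow : ∀ m, HasSum (fun k => κ m * t ^ m * (PowerSeries.coeff k (G m) * t ^ k))
      (κ m * t ^ m * g m) := fun m => (hG m).2.mul_left _
  have hs' : HasSum (fun m => κ m * t ^ m * g m) s := hs.congr_fun fun m => by ring
  have hsum : Summable fun x : ℕ × ℕ =>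
      κ x.1 * t ^ x.1 * (PowerSeries.coeff x.2 (G x.1) * t ^ x.2) := by
    refine (summable_prod_of_nonneg fun x => ?_).2 ⟨fun m => (hrow m).summable, ?_⟩
    · have h1 := hκ x.1
      have h2 := (hG x.1).1 x.2
      simp only [Pi.zero_apply]; positivity
    · simpa only [fun m => (hrow m).tsum_eq] using hs'.summable
  exact (HasSum.antidiagonal_of_prod hsum hrow hs').congr_fun fun n => shiftedSum_mul_pow n

lemma summable_of_summable_shiftedSum (ht : 0 ≤ t) (hκ : ∀ m, 0 ≤ κ m)
    (hG : ∀ m, EvalsTo t (G m) (g m)) (hs : Summable (fun n => shiftedSum κ G n * t ^ n)) :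
    Summable (fun m => κ m * g m * t ^ m) := by
  have hrow : ∀ m, HasSum (fun k => κ m * t ^ m * (PowerSeries.coeff k (G m) * t ^ k))
      (κ m * t ^ m * g m) := fun m => (hG m).2.mul_left _
  have hsum : Summable fun x : ℕ × ℕ =>
      κ x.1 * t ^ x.1 * (PowerSeries.coeff x.2 (G x.1) * t ^ x.2) := by
    rw [← (Finset.HasAntidiagonal.sigmaAntidiagonalEquivProd (A := ℕ)).summable_iff]
    refine (summable_sigma_of_nonneg fun x => ?_).2 ⟨fun n => (hasSum_fintype _).summable, ?_⟩
    · have h1 := hκ x.2.1.1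
      have h2 := (hG x.2.1.1).1 x.2.1.2
      simp only [Function.comp_apply]
      exact mul_nonneg (mul_nonneg h1 (pow_nonneg ht _)) (mul_nonneg h2 (pow_nonneg ht _))
    · refine hs.congr fun n => ?_
      rw [tsum_fintype, shiftedSum_mul_pow, ← Finset.sum_coe_sort]
      rfl
  have := hsum.prod
  refine this.congr fun m => ?_
  rw [(hrow m).tsum_eq]
  ring

end ShiftedSum

/-- The sum at the real point `t` of the power series with coefficients `c`. -/
noncomputable def realSum (c : ℕ → ℝ) (t : ℝ) : ℝ := ∑' n, c n * t ^ n

/-- The sum at the complex point `x` of the power series with real coefficients `c`. -/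
noncomputable def complexSum (c : ℕ → ℝ) (x : ℂ) : ℂ := ∑' n, (c n : ℂ) * x ^ n

section Sums

variable {c : ℕ → ℝ} {r : ℝ}

lemma complexSum_ofReal (c : ℕ → ℝ) (t : ℝ) : complexSum c t = (realSum c t : ℂ) := by
  rw [complexSum, realSum, Complex.ofReal_tsum]
  push_cast; rfl

lemma summable_mul_pow_of_le (hc : ∀ n, 0 ≤ c n) (hs : Summable fun n => c n * r ^ n) {t : ℝ}
    (ht : 0 ≤ t) (htr : t ≤ r) : Summable fun n => c n * t ^ n :=
  hs.of_nonneg_of_le (fun n => mul_nonneg (hc n) (pow_nonneg ht n))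
    fun n => mul_le_mul_of_nonneg_left (pow_le_pow_left₀ ht htr n) (hc n)

lemma norm_mul_pow_le (hc : ∀ n, 0 ≤ c n) {x : ℂ} (hx : ‖x‖ ≤ r) (n : ℕ) :
    ‖(c n : ℂ) * x ^ n‖ ≤ c n * r ^ n := by
  rw [norm_mul, norm_pow, Complex.norm_real, Real.norm_of_nonneg (hc n)]
  exact mul_le_mul_of_nonneg_left (pow_le_pow_left₀ (norm_nonneg x) hx n) (hc n)

lemma hasSum_complexSum (hc : ∀ n, 0 ≤ c n) (hs : Summable fun n => c n * r ^ n) {x : ℂ}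
    (hx : ‖x‖ ≤ r) : HasSum (fun n => (c n : ℂ) * x ^ n) (complexSum c x) :=
  (hs.of_norm_bounded (norm_mul_pow_le hc hx)).hasSum

lemma norm_complexSum_le (hc : ∀ n, 0 ≤ c n) (hs : Summable fun n => c n * r ^ n) {x : ℂ}
    (hx : ‖x‖ ≤ r) : ‖complexSum c x‖ ≤ realSum c r :=
  tsum_of_norm_bounded hs.hasSum (norm_mul_pow_le hc hx)

lemma continuousOn_complexSum (hc : ∀ n, 0 ≤ c n) (hs : Summable fun n => c n * r ^ n) :
    ContinuousOn (complexSum c) (Metric.closedBall 0 r) :=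
  continuousOn_tsum (fun n => by fun_prop) hs fun n x hx => norm_mul_pow_le hc (by simpa using hx) n

lemma differentiableOn_complexSum (hc : ∀ n, 0 ≤ c n) (hs : Summable fun n => c n * r ^ n) :
    DifferentiableOn ℂ (complexSum c) (Metric.ball 0 r) :=
  Complex.differentiableOn_tsum_of_summable_norm hs (fun n => by fun_prop) Metric.isOpen_ball
    fun n x hx => norm_mul_pow_le hc (by simpa using (Metric.ball_subset_closedBall hx)) n

lemma continuousOn_realSum (hc : ∀ n, 0 ≤ c n) (hs : Summable fun n => c n * r ^ n) :
    ContinuousOn (realSum c) (Set.Icc 0 r) :=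
  continuousOn_tsum (fun n => by fun_prop) hs fun n t ht => by
    rw [Real.norm_of_nonneg (mul_nonneg (hc n) (pow_nonneg ht.1 n))]
    exact mul_le_mul_of_nonneg_left (pow_le_pow_left₀ ht.1 ht.2 n) (hc n)

lemma realSum_nonneg (hc : ∀ n, 0 ≤ c n) {t : ℝ} (ht : 0 ≤ t) : 0 ≤ realSum c t :=
  tsum_nonneg fun n => mul_nonneg (hc n) (pow_nonneg ht n)

lemma realSum_mono (hc : ∀ n, 0 ≤ c n) (hs : Summable fun n => c n * r ^ n) {s t : ℝ}
    (hs0 : 0 ≤ s) (hst : s ≤ t) (htr : t ≤ r) : realSum c s ≤ realSum c t :=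
  (summable_mul_pow_of_le hc hs hs0 (hst.trans htr)).tsum_le_tsum
    (fun n => mul_le_mul_of_nonneg_left (pow_le_pow_left₀ hs0 hst n) (hc n))
    (summable_mul_pow_of_le hc hs (hs0.trans hst) htr)

lemma realSum_pos (hc : ∀ n, 0 ≤ c n) (hs : Summable fun n => c n * r ^ n) {t : ℝ}
    (ht : 0 < t) (htr : t ≤ r) {n : ℕ} (hn : c n ≠ 0) : 0 < realSum c t :=
  (summable_mul_pow_of_le hc hs ht.le htr).tsum_pos
    (fun n => mul_nonneg (hc n) (pow_nonneg ht.le n)) n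
    (mul_pos ((hc n).lt_of_ne' hn) (pow_pos ht n))

/-- If the triangle inequality for a power series with nonnegative coefficients is an equality
at `x`, then all the terms are equal. -/
lemma pow_eq_of_complexSum_eq (hc : ∀ n, 0 ≤ c n) (hs : Summable fun n => c n * r ^ n) {x : ℂ}
    (hx : ‖x‖ ≤ r) (h : complexSum c x = (realSum c r : ℂ)) {n : ℕ} (hn : c n ≠ 0) :
    x ^ n = (r : ℂ) ^ n := by
  have hr : 0 ≤ r := (norm_nonneg x).trans hx
  have h1 : HasSum (fun n => c n * (x ^ n).re) (realSum c r) := by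
    have := Complex.hasSum_re (hasSum_complexSum hc hs hx)
    rw [h, Complex.ofReal_re] at this
    exact this.congr_fun fun n => (Complex.re_ofReal_mul _ _).symm
  have hle : ∀ n, (x ^ n).re ≤ r ^ n := fun n =>
    (Complex.re_le_norm _).trans (by rw [norm_pow]; exact pow_le_pow_left₀ (norm_nonneg x) hx n)
  have h2 : HasSum (fun n => c n * (r ^ n - (x ^ n).re)) 0 := by
    have := hs.hasSum.sub h1
    rw [show ∑' n, c n * r ^ n = realSum c r from rfl, sub_self] at this
    exact this.congr_fun fun n => by ring
  have h3 := (hasSum_zero_iff_of_nonneg fun n => mul_nonneg (hc n) (sub_nonneg.2 (hle n))).1 h2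
  have h4 : (x ^ n).re = r ^ n := by
    have := congr_fun h3 n
    simp only [Pi.zero_apply, mul_eq_zero, hn, false_or] at this
    linarith
  have h5 : ‖x ^ n‖ ≤ r ^ n := by rw [norm_pow]; exact pow_le_pow_left₀ (norm_nonneg x) hx n
  have h6 : (x ^ n).im = 0 := by
    have h7 := Complex.sq_norm_sub_sq_re (x ^ n)
    have h8 : ‖x ^ n‖ ^ 2 ≤ (r ^ n) ^ 2 := pow_le_pow_left₀ (norm_nonneg _) h5 2
    rw [h4] at h7
    nlinarith [sq_nonneg (x ^ n).im]
  apply Complex.ext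
  · rw [h4, ← Complex.ofReal_pow, Complex.ofReal_re]
  · rw [h6, ← Complex.ofReal_pow, Complex.ofReal_im]

end Sums

/-- Every `n` in the support of the power series `f` satisfies `ζ ^ n = η`. -/
def HasPhase (ζ : ℂ) (f : PowerSeries ℝ) (η : ℂ) : Prop :=
  ∀ n, PowerSeries.coeff n f ≠ 0 → ζ ^ n = η

namespace HasPhase

variable {ζ η θ : ℂ} {f g : PowerSeries ℝ}

lemma mul (hf : HasPhase ζ f η) (hg : HasPhase ζ g θ) : HasPhase ζ (f * g) (η * θ) := by
  intro n hn
  rw [PowerSeries.coeff_mul] at hn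
  obtain ⟨x, hx, hx0⟩ := Finset.exists_ne_zero_of_sum_ne_zero hn
  rw [← Finset.HasAntidiagonal.mem_antidiagonal.1 hx, pow_add, hf _ (left_ne_zero_of_mul hx0),
    hg _ (right_ne_zero_of_mul hx0)]

lemma one : HasPhase ζ 1 1 := by
  intro n hn
  rw [PowerSeries.coeff_one] at hn
  have : n = 0 := by by_contra h; simp [h] at hn
  rw [this, pow_zero]

lemma pow (hf : HasPhase ζ f η) (k : ℕ) : HasPhase ζ (f ^ k) (η ^ k) := by
  induction k with
  | zero => simpa using one
  | succ k ih => rw [pow_succ, pow_succ]; exact ih.mul hf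

lemma prod {ι : Type*} (s : Finset ι) {F : ι → PowerSeries ℝ} (h : ∀ i, HasPhase ζ (F i) η) :
    HasPhase ζ (∏ i ∈ s, F i) (η ^ s.card) := by
  classical
  induction s using Finset.induction_on with
  | empty => simpa using one
  | insert i s hi ih =>
    rw [Finset.prod_insert hi, Finset.card_insert_of_notMem hi, pow_succ']
    exact (h i).mul ih

lemma sum {ι : Type*} (s : Finset ι) {F : ι → PowerSeries ℝ} (h : ∀ i, HasPhase ζ (F i) η) :
    HasPhase ζ (∑ i ∈ s, F i) η := by
  intro n hn
  rw [map_sum] at hn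
  obtain ⟨i, _, hi⟩ := Finset.exists_ne_zero_of_sum_ne_zero hn
  exact h i n hi

lemma treeWeight (hf : HasPhase ζ f η) (hg : HasPhase ζ g η) (m : ℕ) :
    HasPhase ζ (treeWeight m f g) (η ^ m) := by
  rcases m with _ | _ | m
  · intro n hn
    simp [_root_.treeWeight] at hn
  · rw [zero_add, pow_one]; exact hf
  · refine sum _ fun i => ?_
    have := prod (ζ := ζ) (η := η) (Finset.univ : Finset (Fin (m + 2)))
      (F := fun v => if v ∈ Set.range i then g else f) fun v => by split_ifs <;> assumption
    simpa using this

end HasPhase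

/-! ### The rooted tree series and its radius of convergence -/

/-- The sequence of coefficients of a power series. -/
noncomputable def coeffs (f : PowerSeries ℝ) (n : ℕ) : ℝ := PowerSeries.coeff n f

/-- The coefficients of the generating function `R` of rooted trees with edges, leaves and internal
nodes decorated according to the power series `D`, `L` and `I`. -/
noncomputable def rootedTotal (D L I : PowerSeries ℝ) : ℕ → ℝ :=
  shiftedSum (fun m => (m : ℝ) / m.factorial) (fun m => rootedWeight m D L I)

/-- The coefficients of the branching series `V`. -/
noncomputable def branchTotal (D L I : PowerSeries ℝ) : ℕ → ℝ :=
  shiftedSum (fun m => 1 / (m.factorial : ℝ)) (fun m => branchWeight m D L I)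

/-- The function `ψ t z = t * D t * (L t + I t * (exp z - 1))`; the value of the series
`u + V` at `t` is a fixed point of `ψ t`. -/
noncomputable def offspring (D L I : PowerSeries ℝ) (t z : ℝ) : ℝ :=
  t * realSum (coeffs D) t *
    (realSum (coeffs L) t + realSum (coeffs I) t * (Real.exp z - 1))

lemma rootedWeight_nonneg (m : ℕ) {d a b : ℝ} (hd : 0 ≤ d) (ha : 0 ≤ a) (hb : 0 ≤ b) :
    0 ≤ rootedWeight m d a b :=
  mul_nonneg (pow_nonneg hd _) (treeWeight_nonneg m ha hb)

lemma branchWeight_nonneg (m : ℕ) {d a b : ℝ} (hd : 0 ≤ d) (ha : 0 ≤ a) (hb : 0 ≤ b) :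
    0 ≤ branchWeight m d a b := by
  rcases m with _ | _ | m
  · exact le_rfl
  · exact mul_nonneg hd hb
  · exact mul_nonneg (pow_nonneg hd _) (rangeWeight_nonneg _ _ ha hb)

/-- Power series with nonnegative coefficients, converging at `r`, such that the series of rooted
trees decorated with them has radius of convergence `ρ < r`. -/
structure Subcritical (D L I : PowerSeries ℝ) (ρ r : ℝ) : Prop where
  nonneg_edge : ∀ n, 0 ≤ coeffs D n
  nonneg_leaf : ∀ n, 0 ≤ coeffs L n
  nonneg_int : ∀ n, 0 ≤ coeffs I n
  exists_edge : ∃ n, coeffs D n ≠ 0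
  exists_leaf : ∃ n, coeffs L n ≠ 0
  exists_int : ∃ n, coeffs I n ≠ 0
  summable_edge : Summable fun n => coeffs D n * r ^ n
  summable_leaf : Summable fun n => coeffs L n * r ^ n
  summable_int : Summable fun n => coeffs I n * r ^ n
  radius_nonneg : 0 ≤ ρ
  radius_lt : ρ < r
  summable_of_lt : ∀ t, 0 ≤ t → t < ρ → Summable fun n => rootedTotal D L I n * t ^ n
  not_summable_of_lt : ∀ t, ρ < t → t < r → ¬ Summable fun n => rootedTotal D L I n * t ^ n

namespace Subcritical

variable {D L I : PowerSeries ℝ} {ρ r : ℝ}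

lemma evalsTo_edge (S : Subcritical D L I ρ r) {t : ℝ} (h0 : 0 ≤ t) (hr : t ≤ r) :
    EvalsTo t D (realSum (coeffs D) t) :=
  ⟨S.nonneg_edge, (summable_mul_pow_of_le S.nonneg_edge S.summable_edge h0 hr).hasSum⟩

lemma evalsTo_leaf (S : Subcritical D L I ρ r) {t : ℝ} (h0 : 0 ≤ t) (hr : t ≤ r) :
    EvalsTo t L (realSum (coeffs L) t) :=
  ⟨S.nonneg_leaf, (summable_mul_pow_of_le S.nonneg_leaf S.summable_leaf h0 hr).hasSum⟩

lemma evalsTo_int (S : Subcritical D L I ρ r) {t : ℝ} (h0 : 0 ≤ t) (hr : t ≤ r) :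
    EvalsTo t I (realSum (coeffs I) t) :=
  ⟨S.nonneg_int, (summable_mul_pow_of_le S.nonneg_int S.summable_int h0 hr).hasSum⟩

lemma edge_pos (S : Subcritical D L I ρ r) {t : ℝ} (h0 : 0 < t) (hr : t ≤ r) :
    0 < realSum (coeffs D) t := by
  obtain ⟨n, hn⟩ := S.exists_edge
  exact realSum_pos S.nonneg_edge S.summable_edge h0 hr hn

lemma leaf_pos (S : Subcritical D L I ρ r) {t : ℝ} (h0 : 0 < t) (hr : t ≤ r) :
    0 < realSum (coeffs L) t := by
  obtain ⟨n, hn⟩ := S.exists_leaf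
  exact realSum_pos S.nonneg_leaf S.summable_leaf h0 hr hn

lemma int_pos (S : Subcritical D L I ρ r) {t : ℝ} (h0 : 0 < t) (hr : t ≤ r) :
    0 < realSum (coeffs I) t := by
  obtain ⟨n, hn⟩ := S.exists_int
  exact realSum_pos S.nonneg_int S.summable_int h0 hr hn

lemma continuousOn_offspring (S : Subcritical D L I ρ r) (z : ℝ) :
    ContinuousOn (fun t => offspring D L I t z) (Set.Icc 0 r) :=
  (continuousOn_id.mul (continuousOn_realSum S.nonneg_edge S.summable_edge)).mul
    ((continuousOn_realSum S.nonneg_leaf S.summable_leaf).add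
      ((continuousOn_realSum S.nonneg_int S.summable_int).mul continuousOn_const))

/-- `ψ t z` grows at least linearly in `t`. -/
lemma offspring_le (S : Subcritical D L I ρ r) {s t z : ℝ} (hs : 0 ≤ s)
    (hst : s ≤ t) (ht : 0 < t) (htr : t ≤ r) (hz : 0 ≤ z) :
    offspring D L I s z ≤ s / t * offspring D L I t z := by
  have hexp : 0 ≤ Real.exp z - 1 := by linarith [Real.add_one_le_exp z]
  have h1 := realSum_mono S.nonneg_edge S.summable_edge hs hst htr
  have h2 := realSum_mono S.nonneg_leaf S.summable_leaf hs hst htr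
  have h3 := realSum_mono S.nonneg_int S.summable_int hs hst htr
  have e : s / t * offspring D L I t z = s * realSum (coeffs D) t *
      (realSum (coeffs L) t + realSum (coeffs I) t * (Real.exp z - 1)) := by
    unfold offspring; field_simp
  have h4 := realSum_nonneg S.nonneg_edge hs
  have h5 := realSum_nonneg S.nonneg_leaf hs
  have h6 := realSum_nonneg S.nonneg_int hs
  have h7 := h4.trans h1
  rw [e, offspring]
  gcongr

lemma offspring_pos (S : Subcritical D L I ρ r) {t z : ℝ} (ht : 0 < t) (htr : t ≤ r) (hz : 0 ≤ z) :
    0 < offspring D L I t z := by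
  have hexp : 0 ≤ Real.exp z - 1 := by linarith [Real.add_one_le_exp z]
  have h1 := S.edge_pos ht htr
  have h2 := S.leaf_pos ht htr
  have h3 := S.int_pos ht htr
  unfold offspring
  positivity

/-- A decorated tree series with `ψ t z < z` is dominated by a geometric series. -/
lemma summable_of_offspring_lt (S : Subcritical D L I ρ r) {t z : ℝ} (ht : 0 < t) (htr : t ≤ r)
    (hz : 0 < z)
    (h : offspring D L I t z < z) : Summable fun n => rootedTotal D L I n * t ^ n := by
  have hd := S.edge_pos ht htr
  have hl := S.leaf_pos ht htr
  have hi := S.int_pos ht htr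
  have hG := fun m => (S.evalsTo_edge ht.le htr).rootedWeight ht.le (S.evalsTo_leaf ht.le htr)
    (S.evalsTo_int ht.le htr) m
  have hq0 : 0 ≤ offspring D L I t z / z := div_nonneg (S.offspring_pos ht htr hz.le).le hz.le
  have hq1 : offspring D L I t z / z < 1 := (div_lt_one hz).2 h
  have hs : Summable fun m : ℕ => (m : ℝ) / m.factorial * rootedWeight m (realSum (coeffs D) t)
      (realSum (coeffs L) t) (realSum (coeffs I) t) * t ^ m := by
    refine Summable.of_nonneg_of_le (fun m => ?_)
      (fun m => rootedWeight_le m ht.le hd hl.le hi.le hz)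
      ((summable_geometric_of_lt_one hq0 hq1).mul_left ((z ^ 2 + z) / realSum (coeffs D) t))
    have h1 := rootedWeight_nonneg m hd.le hl.le hi.le
    positivity
  exact (hasSum_shiftedSum ht.le (fun m => by positivity) hG hs.hasSum).summable

lemma le_offspring (S : Subcritical D L I ρ r) {z : ℝ} (hz : 0 < z) : z ≤ offspring D L I ρ z := by
  by_contra! h
  have hc := (S.continuousOn_offspring z) ρ ⟨S.radius_nonneg, S.radius_lt.le⟩
  have hsub : Set.Ioo ρ r ⊆ Set.Icc 0 r := fun x hx =>
    ⟨S.radius_nonneg.trans hx.1.le, hx.2.le⟩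
  have hne : (nhdsWithin ρ (Set.Ioo ρ r)).NeBot := left_nhdsWithin_Ioo_neBot S.radius_lt
  have h1 := (hc.mono hsub).eventually_lt_const h
  obtain ⟨t, ht, htm⟩ := (h1.and self_mem_nhdsWithin).exists
  exact S.not_summable_of_lt t htm.1 htm.2
    (S.summable_of_offspring_lt (S.radius_nonneg.trans_lt htm.1) htm.2.le hz ht)

lemma radius_pos (S : Subcritical D L I ρ r) : 0 < ρ := by
  refine S.radius_nonneg.lt_of_ne ?_
  intro h
  have := S.le_offspring one_pos
  rw [← h] at this
  simp [offspring] at this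
  linarith

lemma summable_rooted (S : Subcritical D L I ρ r) {t : ℝ} (ht : 0 ≤ t) (htρ : t < ρ) :
    Summable fun m : ℕ => (m : ℝ) / m.factorial * rootedWeight m (realSum (coeffs D) t)
      (realSum (coeffs L) t) (realSum (coeffs I) t) * t ^ m := by
  have htr := (htρ.trans S.radius_lt).le
  have hG := fun m => (S.evalsTo_edge ht htr).rootedWeight ht (S.evalsTo_leaf ht htr)
    (S.evalsTo_int ht htr) m
  exact summable_of_summable_shiftedSum ht (fun m => by positivity) hG (S.summable_of_lt t ht htρ)

lemma evalsTo_branch (S : Subcritical D L I ρ r) {t : ℝ} (ht : 0 ≤ t) (htr : t ≤ r) (m : ℕ) :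
    EvalsTo t (branchWeight m D L I) (branchWeight m (realSum (coeffs D) t)
      (realSum (coeffs L) t) (realSum (coeffs I) t)) :=
  (S.evalsTo_edge ht htr).branchWeight ht (S.evalsTo_leaf ht htr) (S.evalsTo_int ht htr) m

lemma branchTotal_nonneg (S : Subcritical D L I ρ r) (n : ℕ) : 0 ≤ branchTotal D L I n := by
  unfold branchTotal shiftedSum
  exact Finset.sum_nonneg fun m _ => mul_nonneg (by positivity)
    ((S.evalsTo_branch le_rfl (S.radius_nonneg.trans S.radius_lt.le) m).1 _)

lemma rootedTotal_nonneg (S : Subcritical D L I ρ r) (n : ℕ) : 0 ≤ rootedTotal D L I n := by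
  unfold rootedTotal shiftedSum
  exact Finset.sum_nonneg fun m _ => mul_nonneg (by positivity)
    (((S.evalsTo_edge le_rfl (S.radius_nonneg.trans S.radius_lt.le)).rootedWeight le_rfl
      (S.evalsTo_leaf le_rfl (S.radius_nonneg.trans S.radius_lt.le))
      (S.evalsTo_int le_rfl (S.radius_nonneg.trans S.radius_lt.le)) m).1 _)

lemma summable_branchTotal_of_lt (S : Subcritical D L I ρ r) {t : ℝ} (ht : 0 ≤ t) (htρ : t < ρ) :
    Summable fun n => branchTotal D L I n * t ^ n := by
  rcases ht.eq_or_lt with rfl | ht0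
  · refine summable_of_ne_finset_zero (s := {0}) fun n hn => ?_
    rw [zero_pow (by simpa using hn), mul_zero]
  have htr := (htρ.trans S.radius_lt).le
  have hd := S.edge_pos ht0 htr
  have hl := S.leaf_pos ht0 htr
  have hi := S.int_pos ht0 htr
  have hs : Summable fun m : ℕ => 1 / (m.factorial : ℝ) * branchWeight m (realSum (coeffs D) t)
      (realSum (coeffs L) t) (realSum (coeffs I) t) * t ^ m := by
    refine Summable.of_nonneg_of_le (fun m => ?_) (fun m => branchWeight_le m ht hd.le hl hi.le)
      ((S.summable_rooted ht htρ).mul_left (realSum (coeffs D) t *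
        max 1 (realSum (coeffs I) t / realSum (coeffs L) t)))
    have h1 := branchWeight_nonneg m hd.le hl.le hi.le
    positivity
  exact (hasSum_shiftedSum ht (fun m => by positivity) (S.evalsTo_branch ht htr) hs.hasSum).summable

/-- The functional equations for `V` and `R` hold at small positive reals. -/
lemma eventually_real_identities (S : Subcritical D L I ρ r) :
    ∀ᶠ t in nhdsWithin 0 (Set.Ioi (0 : ℝ)),
    realSum (branchTotal D L I) t = t * realSum (coeffs D) t * realSum (coeffs I) t *
      Real.exp (t * realSum (coeffs D) t * (realSum (coeffs L) t - realSum (coeffs I) t) +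
        realSum (branchTotal D L I) t) ∧
    realSum (coeffs D) t * realSum (rootedTotal D L I) t =
      (1 + t * realSum (coeffs D) t * (realSum (coeffs L) t - realSum (coeffs I) t)) *
      (t * realSum (coeffs D) t * (realSum (coeffs L) t - realSum (coeffs I) t) +
        realSum (branchTotal D L I) t) := by
  have hr : 0 < r := S.radius_pos.trans S.radius_lt
  have hcD := continuousOn_realSum S.nonneg_edge S.summable_edge
  have hcL := continuousOn_realSum S.nonneg_leaf S.summable_leaf
  have hcI := continuousOn_realSum S.nonneg_int S.summable_int
  have hcont : ContinuousOn (fun t => t * realSum (coeffs D) t * realSum (coeffs I) t *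
      Real.exp |t * realSum (coeffs D) t * (realSum (coeffs L) t - realSum (coeffs I) t)|)
      (Set.Icc 0 r) :=
    ((continuousOn_id.mul hcD).mul hcI).mul
      (((continuousOn_id.mul hcD).mul (hcL.sub hcI)).abs.rexp)
  have hsub : Set.Ioo 0 r ⊆ Set.Icc 0 r := Set.Ioo_subset_Icc_self
  have hlt := ((hcont 0 ⟨le_rfl, hr.le⟩).mono hsub).eventually_lt_const
    (show _ < (1 / 20 : ℝ) by simp)
  rw [nhdsWithin_Ioo_eq_nhdsGT hr] at hlt
  filter_upwards [hlt, Ioo_mem_nhdsGT hr] with t hsm ht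
  have ht0 := ht.1.le
  have htr := ht.2.le
  obtain ⟨s, hs, h1, h2⟩ := exists_hasSum_branch_rooted ht0 (realSum_nonneg S.nonneg_edge ht0)
    (realSum_nonneg S.nonneg_int ht0) hsm.le
  have e1 : realSum (branchTotal D L I) t = s :=
    (hasSum_shiftedSum ht0 (fun m => by positivity) (S.evalsTo_branch ht0 htr) h1).tsum_eq
  have hd := S.edge_pos ht.1 htr
  have h3 := h2.div_const (realSum (coeffs D) t)
  have h4 : HasSum (fun m : ℕ => (m : ℝ) / m.factorial * rootedWeight m (realSum (coeffs D) t)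
      (realSum (coeffs L) t) (realSum (coeffs I) t) * t ^ m) _ :=
    h3.congr_fun fun m => by field_simp
  have e2 := (hasSum_shiftedSum ht0 (fun m => by positivity)
    (fun m => (S.evalsTo_edge ht0 htr).rootedWeight ht0 (S.evalsTo_leaf ht0 htr)
      (S.evalsTo_int ht0 htr) m) h4).tsum_eq
  rw [e1]
  refine ⟨hs, ?_⟩
  have e3 : realSum (rootedTotal D L I) t = _ := e2
  rw [e3]
  field_simp

end Subcritical

/-! ### The branching series up to its critical value -/

lemma differentiableOn_complexSum_of_forall_lt {c : ℕ → ℝ} {ρ : ℝ} (hc : ∀ n, 0 ≤ c n)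
    (hs : ∀ t, 0 ≤ t → t < ρ → Summable fun n => c n * t ^ n) :
    DifferentiableOn ℂ (complexSum c) (Metric.ball 0 ρ) := by
  intro x hx
  have hx' : ‖x‖ < ρ := by simpa using hx
  obtain ⟨t, h1, h2⟩ := exists_between hx'
  have := differentiableOn_complexSum hc (hs t ((norm_nonneg x).trans h1.le) h2)
  exact (this.differentiableAt
    (Metric.isOpen_ball.mem_nhds (by simpa using h1))).differentiableWithinAt

lemma differentiableAt_realSum {c : ℕ → ℝ} {r t : ℝ} (hc : ∀ n, 0 ≤ c n)
    (hs : Summable fun n => c n * r ^ n) (ht : 0 ≤ t) (htr : t < r) :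
    DifferentiableAt ℝ (realSum c) t := by
  have hm : (t : ℂ) ∈ Metric.ball (0 : ℂ) r := by simpa [abs_of_nonneg ht] using htr
  have h1 := ((differentiableOn_complexSum hc hs).differentiableAt
    (Metric.isOpen_ball.mem_nhds hm)).hasDerivAt.real_of_complex
  refine (h1.congr_of_eventuallyEq (Eventually.of_forall fun x => ?_)).differentiableAt
  simp only [complexSum_ofReal, Complex.ofReal_re]

/-- A lower bound for a derivative from a linear upper bound to the left of the point. -/
lemma le_deriv_of_le_sub {f : ℝ → ℝ} {f' p c : ℝ} (hp : 0 < p) (hf : HasDerivAt f f' p)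
    (h : ∀ t ∈ Set.Ioo 0 p, f t ≤ f p - c * (p - t)) : c ≤ f' := by
  have h1 := (hasDerivAt_iff_tendsto_slope.1 hf).mono_left
    (nhdsWithin_mono p (show Set.Ioo 0 p ⊆ {p}ᶜ from fun t ht => ht.2.ne))
  have hne : (nhdsWithin p (Set.Ioo 0 p)).NeBot := right_nhdsWithin_Ioo_neBot hp
  refine ge_of_tendsto h1 ?_
  filter_upwards [self_mem_nhdsWithin] with t ht
  have h2 := h t ht
  have h3 : 0 < p - t := sub_pos.2 ht.2
  rw [slope_comm, slope_def_field, le_div_iff₀ h3]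
  linarith

/-- The function `u = x * D * (L - I)` on the reals. -/
noncomputable def drift (D L I : PowerSeries ℝ) (t : ℝ) : ℝ :=
  t * realSum (coeffs D) t * (realSum (coeffs L) t - realSum (coeffs I) t)

/-- The function `h = x * D * I * exp u` on the reals, for which `V = h * exp V`. -/
noncomputable def branchKernel (D L I : PowerSeries ℝ) (t : ℝ) : ℝ :=
  t * realSum (coeffs D) t * realSum (coeffs I) t * Real.exp (drift D L I t)

/-- The function `u = x * D * (L - I)` on the complex numbers. -/
noncomputable def complexDrift (D L I : PowerSeries ℝ) (x : ℂ) : ℂ :=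
  x * complexSum (coeffs D) x * (complexSum (coeffs L) x - complexSum (coeffs I) x)

/-- The function `h = x * D * I * exp u` on the complex numbers. -/
noncomputable def complexBranchKernel (D L I : PowerSeries ℝ) (x : ℂ) : ℂ :=
  x * complexSum (coeffs D) x * complexSum (coeffs I) x * Complex.exp (complexDrift D L I x)

lemma complexDrift_ofReal (D L I : PowerSeries ℝ) (t : ℝ) :
    complexDrift D L I t = (drift D L I t : ℂ) := by
  simp only [complexDrift, drift, complexSum_ofReal]
  push_cast; rfl

lemma complexBranchKernel_ofReal (D L I : PowerSeries ℝ) (t : ℝ) :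
    complexBranchKernel D L I t = (branchKernel D L I t : ℂ) := by
  simp only [complexBranchKernel, branchKernel, complexSum_ofReal, complexDrift_ofReal]
  push_cast; rfl

lemma offspring_eq (D L I : PowerSeries ℝ) (t z : ℝ) : offspring D L I t z =
    drift D L I t + t * realSum (coeffs D) t * realSum (coeffs I) t * Real.exp z := by
  unfold offspring drift; ring

lemma offspring_drift_add (D L I : PowerSeries ℝ) (t y : ℝ) :
    offspring D L I t (drift D L I t + y) = drift D L I t + branchKernel D L I t * Real.exp y := by
  rw [offspring_eq, branchKernel, Real.exp_add]; ring

lemma exp_one_mul_branchKernel_le (D L I : PowerSeries ℝ) (t z : ℝ) :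
    Real.exp 1 * branchKernel D L I t ≤ Real.exp (offspring D L I t z - z) := by
  set y := t * realSum (coeffs D) t * realSum (coeffs I) t * Real.exp z with hy
  have h1 := Real.add_one_le_exp (y - 1)
  have e1 : Real.exp 1 * branchKernel D L I t = y * Real.exp (1 + drift D L I t - z) := by
    rw [hy, branchKernel, Real.exp_sub, Real.exp_add]
    field_simp
  have e2 : offspring D L I t z - z = (y - 1) + (1 + drift D L I t - z) := by
    rw [offspring_eq]; ring
  rw [e1, e2, Real.exp_add (y - 1)]
  have := Real.exp_pos (1 + drift D L I t - z)
  nlinarith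

namespace Subcritical

variable {D L I : PowerSeries ℝ} {ρ r : ℝ}

lemma differentiableOn_complexDrift (S : Subcritical D L I ρ r) :
    DifferentiableOn ℂ (complexDrift D L I) (Metric.ball 0 r) :=
  (differentiableOn_id.mul (differentiableOn_complexSum S.nonneg_edge S.summable_edge)).mul
    ((differentiableOn_complexSum S.nonneg_leaf S.summable_leaf).sub
      (differentiableOn_complexSum S.nonneg_int S.summable_int))

lemma differentiableOn_complexBranchKernel (S : Subcritical D L I ρ r) :
    DifferentiableOn ℂ (complexBranchKernel D L I) (Metric.ball 0 r) :=
  ((differentiableOn_id.mul (differentiableOn_complexSum S.nonneg_edge S.summable_edge)).mul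
    (differentiableOn_complexSum S.nonneg_int S.summable_int)).mul
      S.differentiableOn_complexDrift.cexp

lemma differentiableOn_branch (S : Subcritical D L I ρ r) :
    DifferentiableOn ℂ (complexSum (branchTotal D L I)) (Metric.ball 0 ρ) :=
  differentiableOn_complexSum_of_forall_lt S.branchTotal_nonneg
    fun _ => S.summable_branchTotal_of_lt

lemma eqOn_ball_of_eventually_real (S : Subcritical D L I ρ r) {f g : ℂ → ℂ}
    (hf : DifferentiableOn ℂ f (Metric.ball 0 ρ)) (hg : DifferentiableOn ℂ g (Metric.ball 0 ρ))
    (h : ∀ᶠ t : ℝ in nhdsWithin 0 (Set.Ioi 0), f t = g t) :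
    Set.EqOn f g (Metric.ball 0 ρ) := by
  have hT : Tendsto (fun t : ℝ => (t : ℂ)) (nhdsWithin 0 (Set.Ioi (0 : ℝ)))
      (nhdsWithin 0 {0}ᶜ) := by
    refine tendsto_nhdsWithin_iff.2 ⟨?_, ?_⟩
    · have := Complex.continuous_ofReal.tendsto 0
      rw [Complex.ofReal_zero] at this
      exact this.mono_left nhdsWithin_le_nhds
    · filter_upwards [self_mem_nhdsWithin] with t ht
      have ht : 0 < t := ht
      simpa using ht.ne'
  exact (hf.analyticOnNhd Metric.isOpen_ball).eqOn_of_preconnected_of_frequently_eq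
    (hg.analyticOnNhd Metric.isOpen_ball) (convex_ball 0 ρ).isPreconnected
    (Metric.mem_ball_self S.radius_pos) (hT.frequently h.frequently)

lemma complex_branch_eq (S : Subcritical D L I ρ r) : Set.EqOn (complexSum (branchTotal D L I))
    (fun x => complexBranchKernel D L I x * Complex.exp (complexSum (branchTotal D L I) x))
    (Metric.ball 0 ρ) := by
  refine S.eqOn_ball_of_eventually_real S.differentiableOn_branch
    ((S.differentiableOn_complexBranchKernel.mono
      (Metric.ball_subset_ball S.radius_lt.le)).mul S.differentiableOn_branch.cexp) ?_
  filter_upwards [S.eventually_real_identities] with t ht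
  rw [complexSum_ofReal, complexBranchKernel_ofReal, ← Complex.ofReal_exp, ← Complex.ofReal_mul,
    Complex.ofReal_inj, branchKernel, drift, mul_assoc _ (Real.exp _), ← Real.exp_add]
  exact ht.1

lemma complex_rooted_eq (S : Subcritical D L I ρ r) : Set.EqOn (complexSum (rootedTotal D L I))
    (fun x => (1 + complexDrift D L I x) *
        (x * (complexSum (coeffs L) x - complexSum (coeffs I) x)) +
      (1 + complexDrift D L I x) * (x * complexSum (coeffs I) x *
        Complex.exp (complexDrift D L I x)) *
      Complex.exp (complexSum (branchTotal D L I) x)) (Metric.ball 0 ρ) := by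
  have hm := Metric.ball_subset_ball (x := (0 : ℂ)) S.radius_lt.le
  have hL := (differentiableOn_complexSum S.nonneg_leaf S.summable_leaf).mono hm
  have hI := (differentiableOn_complexSum S.nonneg_int S.summable_int).mono hm
  have hu := S.differentiableOn_complexDrift.mono hm
  refine S.eqOn_ball_of_eventually_real
    (differentiableOn_complexSum_of_forall_lt S.rootedTotal_nonneg S.summable_of_lt)
    (((hu.const_add 1).mul (differentiableOn_id.mul (hL.sub hI))).add
      (((hu.const_add 1).mul ((differentiableOn_id.mul hI).mul hu.cexp)).mul
        S.differentiableOn_branch.cexp)) ?_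
  filter_upwards [S.eventually_real_identities,
    Ioo_mem_nhdsGT (S.radius_pos.trans S.radius_lt)] with t ht htr
  have hd := S.edge_pos htr.1 htr.2.le
  obtain ⟨h1, h2⟩ := ht
  simp only [complexSum_ofReal, complexDrift_ofReal]
  have e : realSum (rootedTotal D L I) t = (1 + drift D L I t) *
        (t * (realSum (coeffs L) t - realSum (coeffs I) t)) +
      (1 + drift D L I t) * (t * realSum (coeffs I) t * Real.exp (drift D L I t)) *
      Real.exp (realSum (branchTotal D L I) t) := by
    refine mul_left_cancel₀ hd.ne' (h2.trans ?_)
    rw [Real.exp_add] at h1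
    simp only [drift]
    nth_rewrite 1 [h1]
    ring
  rw [e]
  push_cast
  rfl

lemma branch_eq_of_lt (S : Subcritical D L I ρ r) {t : ℝ} (ht : 0 ≤ t) (htρ : t < ρ) :
    realSum (branchTotal D L I) t =
      branchKernel D L I t * Real.exp (realSum (branchTotal D L I) t) := by
  have := S.complex_branch_eq (show (t : ℂ) ∈ Metric.ball (0 : ℂ) ρ by
    simpa [abs_of_nonneg ht] using htρ)
  simp only [complexSum_ofReal, complexBranchKernel_ofReal] at this
  exact_mod_cast this

lemma continuousOn_branch_of_lt (S : Subcritical D L I ρ r) {t : ℝ} (ht : 0 ≤ t) (htρ : t < ρ) :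
    ContinuousOn (realSum (branchTotal D L I)) (Set.Icc 0 t) :=
  continuousOn_realSum S.branchTotal_nonneg (S.summable_branchTotal_of_lt ht htρ)

/-- The term with `m = 1` nodes of the branching series shows that `1 + p + q` is in its support. -/
lemma coeff_branch_one (S : Subcritical D L I ρ r) {n p q : ℕ} (h : n = 1 + p + q)
    (hp : coeffs D p ≠ 0) (hq : coeffs I q ≠ 0) : branchTotal D L I n ≠ 0 := by
  have hr := S.radius_nonneg.trans S.radius_lt.le
  have h1 : 1 / ((1 : ℕ).factorial : ℝ) * PowerSeries.coeff (n - 1) (branchWeight 1 D L I) ≤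
      branchTotal D L I n := by
    unfold branchTotal shiftedSum
    exact Finset.single_le_sum (f := fun m => 1 / (m.factorial : ℝ) *
      PowerSeries.coeff (n - m) (branchWeight m D L I))
      (fun m _ => mul_nonneg (by positivity) ((S.evalsTo_branch le_rfl hr m).1 _))
      (Finset.mem_range.2 (by omega))
  have h2 : coeffs D p * coeffs I q ≤ PowerSeries.coeff (n - 1) (branchWeight 1 D L I) := by
    rw [show branchWeight 1 D L I = D * I from rfl, PowerSeries.coeff_mul]
    exact Finset.single_le_sum (f := fun x : ℕ × ℕ => coeffs D x.1 * coeffs I x.2)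
      (fun x _ => mul_nonneg (S.nonneg_edge _) (S.nonneg_int _))
      (a := (p, q)) (Finset.HasAntidiagonal.mem_antidiagonal.2 (by omega))
  have h3 : 0 < coeffs D p * coeffs I q :=
    mul_pos ((S.nonneg_edge p).lt_of_ne' hp) ((S.nonneg_int q).lt_of_ne' hq)
  simp at h1
  linarith

/-- The term with `m = 2` nodes of the branching series shows that `2 + p + p' + q + l` is in its
support. -/
lemma coeff_branch_two (S : Subcritical D L I ρ r) {n p p' q l : ℕ} (h : n = 2 + p + p' + q + l)
    (hp : coeffs D p ≠ 0) (hp' : coeffs D p' ≠ 0) (hq : coeffs I q ≠ 0) (hl : coeffs L l ≠ 0) :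
    branchTotal D L I n ≠ 0 := by
  have hr := S.radius_nonneg.trans S.radius_lt.le
  have h1 : 1 / ((2 : ℕ).factorial : ℝ) * PowerSeries.coeff (n - 2) (branchWeight 2 D L I) ≤
      branchTotal D L I n := by
    unfold branchTotal shiftedSum
    exact Finset.single_le_sum (f := fun m => 1 / (m.factorial : ℝ) *
      PowerSeries.coeff (n - m) (branchWeight m D L I))
      (fun m _ => mul_nonneg (by positivity) ((S.evalsTo_branch le_rfl hr m).1 _))
      (Finset.mem_range.2 (by omega))
  have hle : ∀ {f g : PowerSeries ℝ} {i j k : ℕ}, (∀ n, 0 ≤ coeffs f n) → (∀ n, 0 ≤ coeffs g n) →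
      i + j = k → coeffs f i * coeffs g j ≤ coeffs (f * g) k := by
    intro f g i j k hf hg hk
    rw [coeffs.eq_1 (f * g), PowerSeries.coeff_mul]
    exact Finset.single_le_sum (f := fun x : ℕ × ℕ => coeffs f x.1 * coeffs g x.2)
      (fun x _ => mul_nonneg (hf _) (hg _))
      (a := (i, j)) (Finset.HasAntidiagonal.mem_antidiagonal.2 hk)
  have hnn : ∀ {f g : PowerSeries ℝ}, (∀ n, 0 ≤ coeffs f n) → (∀ n, 0 ≤ coeffs g n) →
      ∀ n, 0 ≤ coeffs (f * g) n := by
    intro f g hf hg n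
    rw [coeffs, PowerSeries.coeff_mul]
    exact Finset.sum_nonneg fun x _ => mul_nonneg (hf _) (hg _)
  have e : branchWeight 2 D L I = D * D * (I * L) + D * D * (I * L) := by
    have : rangeWeight 2 1 L I = I * L + L * I := by
      rw [rangeWeight, ← (Equiv.funUnique (Fin 1) (Fin 2)).symm.sum_comp]
      simp [Fin.sum_univ_two, Fin.prod_univ_two]
    rw [show branchWeight 2 D L I = D ^ 2 * rangeWeight 2 1 L I from rfl, this]
    ring
  have h2 : 0 < coeffs (D * D * (I * L)) (n - 2) := by
    have a1 := hle S.nonneg_edge S.nonneg_edge (rfl : p + p' = _)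
    have a2 := hle S.nonneg_int S.nonneg_leaf (rfl : q + l = _)
    have a3 := hle (hnn S.nonneg_edge S.nonneg_edge) (hnn S.nonneg_int S.nonneg_leaf)
      (show p + p' + (q + l) = n - 2 by omega)
    have b1 := (S.nonneg_edge p).lt_of_ne' hp
    have b2 := (S.nonneg_edge p').lt_of_ne' hp'
    have b3 := (S.nonneg_int q).lt_of_ne' hq
    have b4 := (S.nonneg_leaf l).lt_of_ne' hl
    have c1 := (mul_pos b1 b2).trans_le a1
    have c2 := (mul_pos b3 b4).trans_le a2
    exact (mul_pos c1 c2).trans_le a3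
  rw [e, map_add] at h1
  change 1 / ((2 : ℕ).factorial : ℝ) * (coeffs (D * D * (I * L)) (n - 2) +
    coeffs (D * D * (I * L)) (n - 2)) ≤ _ at h1
  have : (0 : ℝ) < 1 / ((2 : ℕ).factorial : ℝ) := by positivity
  nlinarith

lemma le_branch (S : Subcritical D L I ρ r) {t : ℝ} (ht : 0 ≤ t) (htr : t ≤ r)
    (hs : Summable fun n => branchTotal D L I n * t ^ n) :
    t * realSum (coeffs D) t * realSum (coeffs I) t ≤ realSum (branchTotal D L I) t := by
  have hs' := summable_of_summable_shiftedSum ht (fun m => by positivity)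
    (S.evalsTo_branch ht htr) hs
  have h1 := (hasSum_shiftedSum ht (fun m => by positivity)
    (S.evalsTo_branch ht htr) hs'.hasSum).tsum_eq
  have h2 : realSum (branchTotal D L I) t = _ := h1
  rw [h2]
  have h3 := hs'.le_tsum 1 fun m _ => mul_nonneg (mul_nonneg (by positivity)
    (branchWeight_nonneg m (realSum_nonneg S.nonneg_edge ht) (realSum_nonneg S.nonneg_leaf ht)
      (realSum_nonneg S.nonneg_int ht))) (pow_nonneg ht m)
  refine le_trans (le_of_eq ?_) h3
  simp [branchWeight]
  ring

/-- The fixed point `u + V` of `ψ t` is positive. -/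
lemma drift_add_branch_pos (S : Subcritical D L I ρ r) {t : ℝ} (ht : 0 < t) (htr : t ≤ r)
    (hs : Summable fun n => branchTotal D L I n * t ^ n) :
    0 < drift D L I t + realSum (branchTotal D L I) t := by
  have h1 := S.le_branch ht.le htr hs
  have h2 : 0 < t * realSum (coeffs D) t * realSum (coeffs L) t :=
    mul_pos (mul_pos ht (S.edge_pos ht htr)) (S.leaf_pos ht htr)
  have e : drift D L I t = t * realSum (coeffs D) t * realSum (coeffs L) t -
    t * realSum (coeffs D) t * realSum (coeffs I) t := by rw [drift]; ring
  linarith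

/-- Where `V = 1`, the inequality `e * h ≤ exp (ψ z - z)` gives `z ≤ ψ z` for all `z`; but then
`ψ` could have no fixed point at a larger argument. -/
lemma branch_lt_one (S : Subcritical D L I ρ r) {t : ℝ} (ht : 0 ≤ t) (htρ : t < ρ) :
    realSum (branchTotal D L I) t < 1 := by
  by_contra! hge
  have h0 : realSum (branchTotal D L I) 0 = 0 := by
    have := S.branch_eq_of_lt le_rfl S.radius_pos
    rw [this]
    simp [branchKernel]
  obtain ⟨t1, ht1, hV1⟩ := intermediate_value_Icc ht (S.continuousOn_branch_of_lt ht htρ)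
    (show (1 : ℝ) ∈ Set.Icc _ _ from ⟨by rw [h0]; norm_num, hge⟩)
  have ht1pos : 0 < t1 := by
    refine ht1.1.lt_of_ne ?_
    rintro rfl
    rw [h0] at hV1
    norm_num at hV1
  have ht1ρ := ht1.2.trans_lt htρ
  have hk := S.branch_eq_of_lt ht1.1 ht1ρ
  rw [hV1] at hk
  obtain ⟨t2, h12, h2ρ⟩ := exists_between ht1ρ
  have ht2 := ht1pos.trans h12
  have h2r := (h2ρ.trans S.radius_lt).le
  have hQ := S.drift_add_branch_pos ht2 h2r (S.summable_branchTotal_of_lt ht2.le h2ρ)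
  set Q := drift D L I t2 + realSum (branchTotal D L I) t2 with hQdef
  have hfix : offspring D L I t2 Q = Q := by
    rw [hQdef, offspring_drift_add, ← S.branch_eq_of_lt ht2.le h2ρ]
  have h3 := S.offspring_le ht1pos.le h12.le ht2 h2r hQ.le
  rw [hfix] at h3
  have h4 : t1 / t2 * Q < Q := by
    have : t1 / t2 < 1 := (div_lt_one ht2).2 h12
    nlinarith
  have h5 := exp_one_mul_branchKernel_le D L I t1 Q
  rw [mul_comm, ← hk] at h5
  have h6 : Real.exp (offspring D L I t1 Q - Q) < 1 := by
    rw [← Real.exp_zero]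
    exact Real.exp_lt_exp.2 (by linarith)
  linarith

lemma summable_branchTotal (S : Subcritical D L I ρ r) :
    Summable fun n => branchTotal D L I n * ρ ^ n := by
  have hρ := S.radius_pos
  refine summable_of_sum_le (c := 1)
    (fun n => mul_nonneg (S.branchTotal_nonneg n) (pow_nonneg hρ.le n)) fun s => ?_
  have hne : (nhdsWithin ρ (Set.Ioo 0 ρ)).NeBot := right_nhdsWithin_Ioo_neBot hρ
  have hc : Continuous fun t : ℝ => ∑ n ∈ s, branchTotal D L I n * t ^ n := by fun_prop
  refine le_of_tendsto ((hc.tendsto ρ).mono_left (nhdsWithin_le_nhds (s := Set.Ioo 0 ρ))) ?_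
  filter_upwards [self_mem_nhdsWithin] with t ht
  refine le_trans ?_ (S.branch_lt_one ht.1.le ht.2).le
  exact (S.summable_branchTotal_of_lt ht.1.le ht.2).sum_le_tsum s
    fun n _ => mul_nonneg (S.branchTotal_nonneg n) (pow_nonneg ht.1.le n)

lemma branch_le_one (S : Subcritical D L I ρ r) : realSum (branchTotal D L I) ρ ≤ 1 := by
  have hρ := S.radius_pos
  have hne : (nhdsWithin ρ (Set.Ioo 0 ρ)).NeBot := right_nhdsWithin_Ioo_neBot hρ
  have hc := (continuousOn_realSum S.branchTotal_nonneg S.summable_branchTotal) ρ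
    ⟨hρ.le, le_rfl⟩
  refine le_of_tendsto (hc.mono Set.Ioo_subset_Icc_self) ?_
  filter_upwards [self_mem_nhdsWithin] with t ht
  exact (S.branch_lt_one ht.1.le ht.2).le

lemma continuousOn_branch (S : Subcritical D L I ρ r) :
    ContinuousOn (complexSum (branchTotal D L I)) (Metric.closedBall 0 ρ) :=
  continuousOn_complexSum S.branchTotal_nonneg S.summable_branchTotal

lemma complex_branch_eq_closedBall (S : Subcritical D L I ρ r) :
    Set.EqOn (complexSum (branchTotal D L I))
    (fun x => complexBranchKernel D L I x * Complex.exp (complexSum (branchTotal D L I) x))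
    (Metric.closedBall 0 ρ) := by
  refine S.complex_branch_eq.of_subset_closure S.continuousOn_branch ?_
    Metric.ball_subset_closedBall ?_
  · exact (S.differentiableOn_complexBranchKernel.continuousOn.mono
      (Metric.closedBall_subset_ball S.radius_lt)).mul S.continuousOn_branch.cexp
  · rw [closure_ball _ S.radius_pos.ne']

lemma branch_eq (S : Subcritical D L I ρ r) : realSum (branchTotal D L I) ρ =
    branchKernel D L I ρ * Real.exp (realSum (branchTotal D L I) ρ) := by
  have := S.complex_branch_eq_closedBall (show (ρ : ℂ) ∈ Metric.closedBall (0 : ℂ) ρ by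
    simp [abs_of_nonneg S.radius_nonneg])
  simp only [complexSum_ofReal, complexBranchKernel_ofReal] at this
  exact_mod_cast this

/-- At the radius of convergence the branching series reaches its critical value: otherwise
`ψ ρ z < z` slightly above the fixed point, and the series of trees would converge beyond `ρ`. -/
lemma branch_eq_one (S : Subcritical D L I ρ r) : realSum (branchTotal D L I) ρ = 1 := by
  refine S.branch_le_one.antisymm ?_
  by_contra! hlt
  have hρ := S.radius_pos
  have hQ := S.drift_add_branch_pos hρ S.radius_lt.le S.summable_branchTotal
  have hb := S.branch_eq
  set y := realSum (branchTotal D L I) ρ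
  have h1 := S.le_offspring (z := drift D L I ρ + 1) (by linarith)
  rw [offspring_drift_add] at h1
  have h2 := Real.add_one_lt_exp (x := y - 1) (by linarith)
  rw [Real.exp_sub, sub_add_cancel, lt_div_iff₀ (Real.exp_pos 1)] at h2
  have h3 := mul_nonneg (show 0 ≤ branchKernel D L I ρ * Real.exp 1 - 1 by linarith)
    (Real.exp_pos y).le
  have h4 : (branchKernel D L I ρ * Real.exp 1 - 1) * Real.exp y =
      y * Real.exp 1 - Real.exp y := by linear_combination (-Real.exp 1) * hb
  linarith

lemma exp_one_mul_branchKernel (S : Subcritical D L I ρ r) :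
    Real.exp 1 * branchKernel D L I ρ = 1 := by
  have := S.branch_eq
  rw [S.branch_eq_one] at this
  linarith

end Subcritical

/-! ### Asymptotics of the rooted tree series -/

namespace Subcritical

variable {D L I : PowerSeries ℝ} {ρ r : ℝ}

/-- If the support of the tree series is aperiodic, then `V` takes the value `1` on the closed disk
only at `ρ`: a further such point gives a unit `ζ` with `ζ ^ n = 1` on the support of `V`, and
the supports of `D`, `L`, `I` then lie in residue classes that make `ζ ^ n` constant on the
sizes of trees. -/
lemma eq_radius_of_branch_eq_one (S : Subcritical D L I ρ r)
    (hper : ∀ ζ η : ℂ, ‖ζ‖ = 1 → (∀ n, rootedTotal D L I n ≠ 0 → ζ ^ n = η) → ζ = 1)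
    {x : ℂ} (hx : ‖x‖ ≤ ρ) (h : complexSum (branchTotal D L I) x = 1) : x = ρ := by
  have hρ := S.radius_pos
  have hρ' : (ρ : ℂ) ≠ 0 := by exact_mod_cast hρ.ne'
  obtain ⟨p, hp⟩ := S.exists_edge
  obtain ⟨q, hq⟩ := S.exists_int
  have hpow : ∀ n, branchTotal D L I n ≠ 0 → x ^ n = (ρ : ℂ) ^ n := fun n hn =>
    pow_eq_of_complexSum_eq S.branchTotal_nonneg S.summable_branchTotal hx
      (by rw [h, S.branch_eq_one]; simp) hn
  set ζ := x / ρ with hζ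
  have hζ1 : ∀ n, branchTotal D L I n ≠ 0 → ζ ^ n = 1 := fun n hn => by
    rw [hζ, div_pow, hpow n hn, div_self (pow_ne_zero _ hρ')]
  have h1 := hζ1 _ (S.coeff_branch_one rfl hp hq)
  have hnorm : ‖ζ‖ = 1 := by
    have h2 : ‖ζ‖ ^ (1 + p + q) = 1 := by rw [← norm_pow, h1, norm_one]
    exact (pow_eq_one_iff_of_nonneg (norm_nonneg ζ) (by omega)).1 h2
  have hζ0 : ζ ≠ 0 := by
    intro h0
    simp [h0] at hnorm
  have hD : HasPhase ζ D (ζ ^ p) := fun n hn => by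
    have h2 := (hζ1 _ (S.coeff_branch_one rfl hn hq)).trans h1.symm
    rw [pow_add ζ (1 + n), pow_add ζ (1 + p), pow_add ζ 1 p, pow_add ζ 1 n] at h2
    exact mul_left_cancel₀ (pow_ne_zero 1 hζ0) (mul_right_cancel₀ (pow_ne_zero q hζ0) h2)
  have hI : HasPhase ζ I (ζ ^ q) := fun n hn => by
    have h2 := (hζ1 _ (S.coeff_branch_one rfl hp hn)).trans h1.symm
    rw [pow_add ζ (1 + p) n, pow_add ζ (1 + p) q] at h2
    exact mul_left_cancel₀ (pow_ne_zero _ hζ0) h2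
  have hL : HasPhase ζ L (ζ ^ q) := fun n hn => by
    have h2 := (hζ1 _ (S.coeff_branch_two rfl hp hp hq hn)).trans h1.symm
    have e : ζ ^ (2 + p + p + q + n) = ζ ^ (1 + p + q) * (ζ ^ (1 + p) * ζ ^ n) := by
      rw [← pow_add, ← pow_add]; congr 1; ring
    rw [e, h1, one_mul, ← h1, pow_add ζ (1 + p) q] at h2
    exact mul_left_cancel₀ (pow_ne_zero _ hζ0) h2
  have hfin : ζ = 1 := by
    refine hper ζ (ζ ^ p)⁻¹ hnorm fun n hn => ?_
    unfold rootedTotal shiftedSum at hn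
    obtain ⟨m, hm, hm0⟩ := Finset.exists_ne_zero_of_sum_ne_zero hn
    have hmn : m ≤ n := Nat.lt_succ_iff.1 (Finset.mem_range.1 hm)
    have hm1 : m ≠ 0 := by rintro rfl; simp at hm0
    have h2 := ((hD.pow (m - 1)).mul (hL.treeWeight hI m)) (n - m) (right_ne_zero_of_mul hm0)
    refine eq_inv_of_mul_eq_one_left ?_
    have e : ζ ^ n = ζ ^ m * ζ ^ (n - m) := by rw [← pow_add, Nat.add_sub_cancel' hmn]
    rw [e, h2]
    have e2 : (ζ ^ p) ^ m = (ζ ^ p) ^ (m - 1) * ζ ^ p := by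
      rw [← pow_succ, Nat.sub_add_cancel (Nat.one_le_iff_ne_zero.2 hm1)]
    calc _ = ζ ^ m * ((ζ ^ p) ^ (m - 1) * ζ ^ p) * (ζ ^ q) ^ m := by ring
      _ = (ζ ^ (1 + p + q)) ^ m := by rw [← e2]; ring
      _ = 1 := by rw [h1, one_pow]
  rw [hζ, div_eq_one_iff_eq hρ'] at hfin
  exact hfin

lemma differentiableAt_offspring (S : Subcritical D L I ρ r) (z : ℝ) :
    DifferentiableAt ℝ (fun t => offspring D L I t z) ρ := by
  have hD := differentiableAt_realSum S.nonneg_edge S.summable_edge S.radius_nonneg S.radius_lt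
  have hL := differentiableAt_realSum S.nonneg_leaf S.summable_leaf S.radius_nonneg S.radius_lt
  have hI := differentiableAt_realSum S.nonneg_int S.summable_int S.radius_nonneg S.radius_lt
  unfold offspring
  fun_prop

lemma differentiableAt_branchKernel (S : Subcritical D L I ρ r) :
    DifferentiableAt ℝ (branchKernel D L I) ρ := by
  have hD := differentiableAt_realSum S.nonneg_edge S.summable_edge S.radius_nonneg S.radius_lt
  have hL := differentiableAt_realSum S.nonneg_leaf S.summable_leaf S.radius_nonneg S.radius_lt
  have hI := differentiableAt_realSum S.nonneg_int S.summable_int S.radius_nonneg S.radius_lt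
  unfold branchKernel drift
  fun_prop

/-- The fixed point `u ρ + 1` of `ψ ρ` is positive. -/
lemma drift_add_one_pos (S : Subcritical D L I ρ r) : 0 < drift D L I ρ + 1 := by
  have := S.drift_add_branch_pos S.radius_pos S.radius_lt.le S.summable_branchTotal
  rwa [S.branch_eq_one] at this

lemma offspring_drift_add_one (S : Subcritical D L I ρ r) :
    offspring D L I ρ (drift D L I ρ + 1) = drift D L I ρ + 1 := by
  rw [offspring_drift_add, mul_comm, S.exp_one_mul_branchKernel]

lemma offspring_le_sub (S : Subcritical D L I ρ r) {t : ℝ} (ht : t ∈ Set.Ioo 0 ρ) :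
    offspring D L I t (drift D L I ρ + 1) ≤
      drift D L I ρ + 1 - (drift D L I ρ + 1) / ρ * (ρ - t) := by
  have hρ := S.radius_pos
  refine (S.offspring_le ht.1.le ht.2.le hρ S.radius_lt.le S.drift_add_one_pos.le).trans
    (le_of_eq ?_)
  rw [S.offspring_drift_add_one]
  field_simp
  ring

lemma deriv_offspring_pos (S : Subcritical D L I ρ r) :
    0 < deriv (fun t => offspring D L I t (drift D L I ρ + 1)) ρ := by
  have hτ := S.drift_add_one_pos
  refine (div_pos hτ S.radius_pos).trans_le
    (le_deriv_of_le_sub S.radius_pos (S.differentiableAt_offspring _).hasDerivAt fun t ht => ?_)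
  refine (S.offspring_le_sub ht).trans (le_of_eq ?_)
  rw [S.offspring_drift_add_one]

lemma deriv_branchKernel_pos (S : Subcritical D L I ρ r) : 0 < deriv (branchKernel D L I) ρ := by
  have hF := (S.differentiableAt_offspring (drift D L I ρ + 1)).hasDerivAt
  have hG := ((hF.sub_const (drift D L I ρ + 1)).exp.const_sub 0).add
    (S.differentiableAt_branchKernel.hasDerivAt.const_mul (Real.exp 1))
  have h1 := le_deriv_of_le_sub (c := 0) S.radius_pos hG fun t ht => ?_
  · rw [S.offspring_drift_add_one, sub_self, Real.exp_zero, one_mul] at h1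
    have h2 := S.deriv_offspring_pos
    have h3 := Real.exp_pos 1
    by_contra! h4
    nlinarith
  · have h2 := exp_one_mul_branchKernel_le D L I t (drift D L I ρ + 1)
    have h3 := S.exp_one_mul_branchKernel
    simp only [Pi.add_apply]
    rw [S.offspring_drift_add_one, sub_self, Real.exp_zero]
    linarith

lemma deriv_complexBranchKernel (S : Subcritical D L I ρ r) :
    HasDerivAt (complexBranchKernel D L I) (deriv (branchKernel D L I) ρ : ℝ) ρ := by
  have hm : (ρ : ℂ) ∈ Metric.ball (0 : ℂ) r := by
    simpa [abs_of_nonneg S.radius_nonneg] using S.radius_lt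
  have h1 := (S.differentiableOn_complexBranchKernel.differentiableAt
    (Metric.isOpen_ball.mem_nhds hm)).hasDerivAt
  have h2 := h1.comp_ofReal
  have h3 := S.differentiableAt_branchKernel.hasDerivAt.ofReal_comp
  simp only [complexBranchKernel_ofReal] at h2
  rw [← h2.unique h3]
  exact h1

/-- The coefficients of the rooted tree series are asymptotically a constant multiple of
`n ^ (-3 / 2) * ρ ^ (-n)`. -/
theorem exists_tendsto_rootedTotal (S : Subcritical D L I ρ r)
    (hper : ∀ ζ η : ℂ, ‖ζ‖ = 1 → (∀ n, rootedTotal D L I n ≠ 0 → ζ ^ n = η) → ζ = 1) :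
    ∃ c : ℝ, 0 < c ∧ Tendsto (fun n : ℕ => (n : ℝ) ^ (3 / 2 : ℝ) * (rootedTotal D L I n * ρ ^ n))
      atTop (nhds c) := by
  have hρ := S.radius_pos
  have hρr := S.radius_lt
  have hρ' : (ρ : ℂ) ≠ 0 := by exact_mod_cast hρ.ne'
  have hnorm : ∀ ξ : ℂ, ‖(ρ : ℂ) * ξ‖ = ρ * ‖ξ‖ := fun ξ => by
    rw [norm_mul, Complex.norm_real, Real.norm_of_nonneg hρ.le]
  have hmaps : Set.MapsTo (fun ξ : ℂ => (ρ : ℂ) * ξ) (Metric.ball 0 (r / ρ)) (Metric.ball 0 r) := by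
    intro ξ hξ
    have : ‖ξ‖ < r / ρ := by simpa using hξ
    rw [lt_div_iff₀' hρ] at this
    rw [mem_ball_zero_iff, hnorm]; exact this
  have hmaps1 : Set.MapsTo (fun ξ : ℂ => (ρ : ℂ) * ξ) (Metric.ball 0 1) (Metric.ball 0 ρ) := by
    intro ξ hξ
    have : ‖ξ‖ < 1 := by simpa using hξ
    rw [mem_ball_zero_iff, hnorm]; nlinarith
  have hmaps2 : Set.MapsTo (fun ξ : ℂ => (ρ : ℂ) * ξ) (Metric.closedBall 0 1)
      (Metric.closedBall 0 ρ) := by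
    intro ξ hξ
    have : ‖ξ‖ ≤ 1 := by simpa using hξ
    rw [mem_closedBall_zero_iff, hnorm]; nlinarith
  have hscale : ∀ s : Set ℂ, DifferentiableOn ℂ (fun ξ : ℂ => (ρ : ℂ) * ξ) s := fun s => by
    fun_prop
  have hD := differentiableOn_complexSum S.nonneg_edge S.summable_edge
  have hL := differentiableOn_complexSum S.nonneg_leaf S.summable_leaf
  have hI := differentiableOn_complexSum S.nonneg_int S.summable_int
  have hu := S.differentiableOn_complexDrift
  have hw : -1 < drift D L I ρ := by linarith [S.drift_add_one_pos]
  set γ : ℝ := (1 + drift D L I ρ) * (ρ * realSum (coeffs I) ρ * Real.exp (drift D L I ρ))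
  have hγ : 0 < γ := mul_pos (by linarith)
    (mul_pos (mul_pos hρ (S.int_pos hρ hρr.le)) (Real.exp_pos _))
  have hVle : ∀ ξ ∈ Metric.closedBall (0 : ℂ) 1,
      ‖complexSum (branchTotal D L I) (ρ * ξ)‖ ≤ 1 := fun ξ hξ => by
    rw [← S.branch_eq_one]
    exact norm_complexSum_le S.branchTotal_nonneg S.summable_branchTotal
      (by simpa using hmaps2 hξ)
  have hcomp : ∀ {f : ℂ → ℂ}, DifferentiableOn ℂ f (Metric.ball 0 r) →
      DifferentiableOn ℂ (fun ξ => f (ρ * ξ)) (Metric.ball 0 (r / ρ)) :=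
    fun hf => hf.comp (hscale _) hmaps
  have a2 : DifferentiableOn ℂ (fun x : ℂ => (1 + complexDrift D L I x) *
      (x * (complexSum (coeffs L) x - complexSum (coeffs I) x))) (Metric.ball 0 r) :=
    (hu.const_add 1).mul (differentiableOn_id.mul (hL.sub hI))
  have a3 : DifferentiableOn ℂ (fun x : ℂ => (1 + complexDrift D L I x) *
      (x * complexSum (coeffs I) x * Complex.exp (complexDrift D L I x))) (Metric.ball 0 r) :=
    (hu.const_add 1).mul ((differentiableOn_id.mul hI).mul hu.cexp)
  have a4 : ContinuousOn (fun ξ => complexSum (branchTotal D L I) (ρ * ξ))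
      (Metric.closedBall 0 1) := S.continuousOn_branch.comp (hscale _).continuousOn hmaps2
  have a5 : DifferentiableOn ℂ (fun ξ => complexSum (branchTotal D L I) (ρ * ξ))
      (Metric.ball 0 1) := S.differentiableOn_branch.comp (hscale _) hmaps1
  refine exists_tendsto_coeff_of_sqrt_singularity ((one_lt_div hρ).2 hρr)
    (H := ρ * deriv (branchKernel D L I) ρ) (γ := γ)
    (hcomp S.differentiableOn_complexBranchKernel) (hcomp a2) (hcomp a3) a4 a5
    (fun ξ hξ => S.complex_branch_eq_closedBall (hmaps2 hξ)) ?_ hVle ?_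
    (mul_pos hρ S.deriv_branchKernel_pos) ?_ hγ ?_ ?_
  · simp only [mul_one, complexSum_ofReal, S.branch_eq_one, Complex.ofReal_one]
  · intro ξ hξ hξ1 h1
    refine hξ1 (mul_left_cancel₀ hρ' ?_)
    rw [mul_one]
    exact S.eq_radius_of_branch_eq_one hper (by simpa using hmaps2 hξ) h1
  · have h1 := S.deriv_complexBranchKernel
    have h2 : HasDerivAt (fun ξ : ℂ => (ρ : ℂ) * ξ) (ρ * 1) 1 := (hasDerivAt_id 1).const_mul _
    have h3 := HasDerivAt.comp (h₂ := complexBranchKernel D L I) (1 : ℂ)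
      (by rw [mul_one]; exact h1) h2
    refine h3.deriv.trans ?_
    push_cast; ring
  · simp only [mul_one, complexSum_ofReal, complexDrift_ofReal]
    simp only [γ]
    push_cast; rfl
  · intro ξ hξ
    have hm := hmaps1 (show ξ ∈ Metric.ball (0 : ℂ) 1 by simpa using hξ)
    have h1 := S.complex_rooted_eq hm
    simp only at h1
    rw [← h1]
    have hm' : ‖(ρ : ℂ) * ξ‖ < ρ := by simpa using hm
    obtain ⟨t, ht1, ht2⟩ := exists_between hm'
    refine (hasSum_complexSum S.rootedTotal_nonneg
      (S.summable_of_lt t ((norm_nonneg _).trans ht1.le) ht2) ht1.le).congr_fun fun n => ?_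
    push_cast
    ring

end Subcritical

/-! ### Exponential tail bounds for the number of nodes -/

/-- The contribution of the trees with `m` nodes to the coefficient of `x ^ n` in the series of
decorated unrooted trees. -/
noncomputable def treeTerm (D L I : PowerSeries ℝ) (n m : ℕ) : ℝ :=
  PowerSeries.coeff (n - m) (rootedWeight m D L I) / (m.factorial : ℝ)

/-- The coefficients of the series of decorated unrooted trees. -/
noncomputable def treeTotal (D L I : PowerSeries ℝ) (n : ℕ) : ℝ :=
  ∑ m ∈ Finset.range (n + 1), treeTerm D L I n m

section TreeTerm

variable {D L I : PowerSeries ℝ}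

lemma evalsTo_zero {f : PowerSeries ℝ} (hf : ∀ n, 0 ≤ coeffs f n) :
    EvalsTo 0 f (PowerSeries.coeff 0 f) := by
  refine ⟨hf, (hasSum_ite_eq 0 (PowerSeries.coeff 0 f)).congr_fun fun n => ?_⟩
  rcases n with _ | n <;> simp

lemma treeTerm_nonneg (hD : ∀ n, 0 ≤ coeffs D n) (hL : ∀ n, 0 ≤ coeffs L n)
    (hI : ∀ n, 0 ≤ coeffs I n) (n m : ℕ) : 0 ≤ treeTerm D L I n m :=
  div_nonneg (((evalsTo_zero hD).rootedWeight le_rfl (evalsTo_zero hL) (evalsTo_zero hI) m).1 _)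
    (by positivity)

lemma treeTerm_zero (n : ℕ) : treeTerm D L I n 0 = 0 := by
  simp [treeTerm, rootedWeight, treeWeight]

lemma rootedTotal_eq (n : ℕ) :
    rootedTotal D L I n = ∑ m ∈ Finset.range (n + 1), m * treeTerm D L I n m := by
  unfold rootedTotal shiftedSum
  exact Finset.sum_congr rfl fun m _ => by rw [treeTerm]; ring

lemma treeTerm_le (hD : ∀ n, 0 ≤ coeffs D n) (hL : ∀ n, 0 ≤ coeffs L n)
    (hI : ∀ n, 0 ≤ coeffs I n) (n m : ℕ) : treeTerm D L I n m ≤ m * treeTerm D L I n m := by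
  rcases m with _ | m
  · simp [treeTerm_zero]
  · have := treeTerm_nonneg hD hL hI n (m + 1)
    have h : (1 : ℝ) ≤ (m + 1 : ℕ) := by push_cast; linarith [(Nat.cast_nonneg m : (0 : ℝ) ≤ m)]
    nlinarith

lemma treeTotal_nonneg (hD : ∀ n, 0 ≤ coeffs D n) (hL : ∀ n, 0 ≤ coeffs L n)
    (hI : ∀ n, 0 ≤ coeffs I n) (n : ℕ) : 0 ≤ treeTotal D L I n :=
  Finset.sum_nonneg fun m _ => treeTerm_nonneg hD hL hI n m

lemma treeTotal_le_rootedTotal (hD : ∀ n, 0 ≤ coeffs D n) (hL : ∀ n, 0 ≤ coeffs L n)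
    (hI : ∀ n, 0 ≤ coeffs I n) (n : ℕ) : treeTotal D L I n ≤ rootedTotal D L I n := by
  rw [rootedTotal_eq]
  exact Finset.sum_le_sum fun m _ => treeTerm_le hD hL hI n m

lemma rootedTotal_le_mul_treeTotal (hD : ∀ n, 0 ≤ coeffs D n) (hL : ∀ n, 0 ≤ coeffs L n)
    (hI : ∀ n, 0 ≤ coeffs I n) (n : ℕ) : rootedTotal D L I n ≤ n * treeTotal D L I n := by
  rw [rootedTotal_eq, treeTotal, Finset.mul_sum]
  refine Finset.sum_le_sum fun m hm => mul_le_mul_of_nonneg_right ?_ (treeTerm_nonneg hD hL hI n m)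
  exact_mod_cast Nat.lt_succ_iff.1 (Finset.mem_range.1 hm)

end TreeTerm

namespace Subcritical

variable {D L I : PowerSeries ℝ} {ρ r : ℝ}

lemma mul_treeTerm_mul_pow_le (S : Subcritical D L I ρ r) {t z : ℝ} (ht : 0 < t) (htr : t ≤ r)
    (hz : 0 < z) {n m : ℕ} (hmn : m ≤ n) : m * treeTerm D L I n m * t ^ n ≤
      (z ^ 2 + z) / realSum (coeffs D) t * (offspring D L I t z / z) ^ m := by
  refine le_trans ?_ (rootedWeight_le m ht.le (S.edge_pos ht htr) (S.leaf_pos ht htr).le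
    (S.int_pos ht htr).le hz)
  have hE := (S.evalsTo_edge ht.le htr).rootedWeight ht.le (S.evalsTo_leaf ht.le htr)
    (S.evalsTo_int ht.le htr) m
  have h1 := hE.2.summable.le_tsum (n - m) fun k _ => mul_nonneg (hE.1 k) (pow_nonneg ht.le k)
  rw [hE.2.tsum_eq] at h1
  have e : m * treeTerm D L I n m * t ^ n = (m : ℝ) / m.factorial *
      (PowerSeries.coeff (n - m) (rootedWeight m D L I) * t ^ (n - m)) * t ^ m := by
    have : t ^ n = t ^ (n - m) * t ^ m := by rw [← pow_add, Nat.sub_add_cancel hmn]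
    rw [treeTerm, this]; ring
  rw [e]
  gcongr

/-- The limit of the proportion of nodes among all labels. -/
noncomputable def nodeDensity (D L I : PowerSeries ℝ) (ρ : ℝ) : ℝ :=
  (drift D L I ρ + 1) / (ρ * deriv (fun t => offspring D L I t (drift D L I ρ + 1)) ρ)

lemma nodeDensity_pos (S : Subcritical D L I ρ r) : 0 < nodeDensity D L I ρ :=
  div_pos S.drift_add_one_pos (mul_pos S.radius_pos S.deriv_offspring_pos)

/-- The logarithm of `ψ (ρ * exp s) τ / τ`, with `τ` the fixed point of `ψ ρ`. -/
noncomputable def logRatio (D L I : PowerSeries ℝ) (ρ s : ℝ) : ℝ :=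
  Real.log (offspring D L I (ρ * Real.exp s) (drift D L I ρ + 1) / (drift D L I ρ + 1))

lemma logRatio_zero (S : Subcritical D L I ρ r) : logRatio D L I ρ 0 = 0 := by
  rw [logRatio, Real.exp_zero, mul_one, S.offspring_drift_add_one,
    div_self S.drift_add_one_pos.ne', Real.log_one]

lemma hasDerivAt_logRatio (S : Subcritical D L I ρ r) :
    HasDerivAt (logRatio D L I ρ) (nodeDensity D L I ρ)⁻¹ 0 := by
  have hτ := S.drift_add_one_pos
  have h1 : HasDerivAt (fun s : ℝ => ρ * Real.exp s) ρ 0 := by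
    simpa using (Real.hasDerivAt_exp 0).const_mul ρ
  have h2 := (S.differentiableAt_offspring (drift D L I ρ + 1)).hasDerivAt
  have h3 := HasDerivAt.comp (h₂ := fun t => offspring D L I t (drift D L I ρ + 1)) (0 : ℝ)
    (by rw [Real.exp_zero, mul_one]; exact h2) h1
  have e : offspring D L I (ρ * Real.exp 0) (drift D L I ρ + 1) / (drift D L I ρ + 1) = 1 := by
    rw [Real.exp_zero, mul_one, S.offspring_drift_add_one, div_self hτ.ne']
  have h4 := (h3.div_const (drift D L I ρ + 1)).log (by
    simp only [Function.comp_apply]; rw [e]; norm_num)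
  refine h4.congr_deriv ?_
  simp only [Function.comp_apply]
  rw [e, div_one, nodeDensity, inv_div, mul_comm]

/-- The exponential Chebyshev bound, tilting by `exp s`. -/
lemma mul_treeTerm_le_exp (S : Subcritical D L I ρ r) {s : ℝ} (hs : ρ * Real.exp s ≤ r) :
    ∃ K : ℝ, 0 < K ∧ ∀ n m : ℕ, m ≤ n → m * treeTerm D L I n m * ρ ^ n ≤
      K * Real.exp (logRatio D L I ρ s * m - s * n) := by
  have hτ := S.drift_add_one_pos
  have ht : 0 < ρ * Real.exp s := mul_pos S.radius_pos (Real.exp_pos s)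
  have hd := S.edge_pos ht hs
  refine ⟨((drift D L I ρ + 1) ^ 2 + (drift D L I ρ + 1)) /
    realSum (coeffs D) (ρ * Real.exp s), by positivity, fun n m hmn => ?_⟩
  have h1 := S.mul_treeTerm_mul_pow_le ht hs hτ hmn
  have hpos := div_pos (S.offspring_pos ht hs hτ.le) hτ
  have e1 : (offspring D L I (ρ * Real.exp s) (drift D L I ρ + 1) / (drift D L I ρ + 1)) ^ m =
      Real.exp (logRatio D L I ρ s * m) := by
    rw [mul_comm (logRatio D L I ρ s), Real.exp_nat_mul, logRatio, Real.exp_log hpos]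
  rw [e1, mul_pow, ← Real.exp_nat_mul] at h1
  rw [Real.exp_sub, ← mul_div_assoc, le_div_iff₀ (Real.exp_pos _), mul_comm s]
  calc _ = m * treeTerm D L I n m * (ρ ^ n * Real.exp (n * s)) := by ring
    _ ≤ _ := h1

/-- A function with positive derivative at a zero has the sign of the argument nearby. -/
lemma eventually_pos_div {g : ℝ → ℝ} {g' : ℝ} (hg : HasDerivAt g g' 0) (h0 : g 0 = 0)
    (hpos : 0 < g') : ∀ᶠ s in nhdsWithin (0 : ℝ) {0}ᶜ, 0 < g s / s := by
  filter_upwards [(hasDerivAt_iff_tendsto_slope.1 hg).eventually (lt_mem_nhds hpos)] with s hs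
  rwa [slope_def_field, h0, sub_zero, sub_zero] at hs

lemma eventually_mul_exp_lt (S : Subcritical D L I ρ r) :
    ∀ᶠ s in nhds (0 : ℝ), ρ * Real.exp s < r := by
  have : Tendsto (fun s => ρ * Real.exp s) (nhds 0) (nhds (ρ * Real.exp 0)) :=
    (continuous_const.mul Real.continuous_exp).tendsto 0
  rw [Real.exp_zero, mul_one] at this
  exact this.eventually_lt_const S.radius_lt

/-- Trees with too many nodes are exponentially rare. -/
lemma exists_upper_tail (S : Subcritical D L I ρ r) {ε : ℝ} (hε : 0 < ε) :
    ∃ K κ : ℝ, 0 < K ∧ 0 < κ ∧ ∀ n m : ℕ, m ≤ n → (nodeDensity D L I ρ + ε) * n ≤ m →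
      m * treeTerm D L I n m * ρ ^ n ≤ K * Real.exp (-(κ * n)) := by
  have ha := S.nodeDensity_pos
  set a := nodeDensity D L I ρ
  have hφ := S.hasDerivAt_logRatio
  have hg : HasDerivAt (fun s => logRatio D L I ρ s * (a + ε) - s) (a⁻¹ * (a + ε) - 1) 0 :=
    (hφ.mul_const _).sub (hasDerivAt_id 0)
  have hg' : 0 < a⁻¹ * (a + ε) - 1 := by
    have : a⁻¹ * (a + ε) - 1 = ε / a := by field_simp; ring
    rw [this]; positivity
  have hle : nhdsWithin (0 : ℝ) (Set.Iio 0) ≤ nhdsWithin 0 {0}ᶜ :=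
    nhdsWithin_mono _ fun s hs => ne_of_lt hs
  have h1 := (eventually_pos_div hφ S.logRatio_zero (inv_pos.2 ha)).filter_mono hle
  have h2 := (eventually_pos_div hg (by simp [S.logRatio_zero]) hg').filter_mono hle
  obtain ⟨s, ⟨⟨h3, h4⟩, h5⟩, h6⟩ := (((h1.and h2).and
    (S.eventually_mul_exp_lt.filter_mono nhdsWithin_le_nhds)).and self_mem_nhdsWithin).exists
  have h6 : s < 0 := h6
  have h7 : logRatio D L I ρ s < 0 := by
    by_contra! h
    exact absurd h3 (not_lt.2 (div_nonpos_of_nonneg_of_nonpos h h6.le))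
  have h8 : logRatio D L I ρ s * (a + ε) - s < 0 := by
    by_contra! h
    exact absurd h4 (not_lt.2 (div_nonpos_of_nonneg_of_nonpos h h6.le))
  obtain ⟨K, hK, hb⟩ := S.mul_treeTerm_le_exp h5.le
  refine ⟨K, -(logRatio D L I ρ s * (a + ε) - s), hK, by linarith, fun n m hmn hm => ?_⟩
  refine (hb n m hmn).trans ?_
  gcongr
  nlinarith [mul_le_mul_of_nonpos_left hm h7.le]

/-- Trees with too few nodes are exponentially rare. -/
lemma exists_lower_tail (S : Subcritical D L I ρ r) {ε : ℝ} (hε : 0 < ε) :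
    ∃ K κ : ℝ, 0 < K ∧ 0 < κ ∧ ∀ n m : ℕ, m ≤ n → (m : ℝ) ≤ (nodeDensity D L I ρ - ε) * n →
      m * treeTerm D L I n m * ρ ^ n ≤ K * Real.exp (-(κ * n)) := by
  have ha := S.nodeDensity_pos
  set a := nodeDensity D L I ρ
  have hφ := S.hasDerivAt_logRatio
  have hg : HasDerivAt (fun s => s - logRatio D L I ρ s * (a - ε)) (1 - a⁻¹ * (a - ε)) 0 :=
    (hasDerivAt_id 0).sub (hφ.mul_const _)
  have hg' : 0 < 1 - a⁻¹ * (a - ε) := by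
    have : 1 - a⁻¹ * (a - ε) = ε / a := by field_simp; ring
    rw [this]; positivity
  have hle : nhdsWithin (0 : ℝ) (Set.Ioi 0) ≤ nhdsWithin 0 {0}ᶜ :=
    nhdsWithin_mono _ fun s hs => ne_of_gt hs
  have h1 := (eventually_pos_div hφ S.logRatio_zero (inv_pos.2 ha)).filter_mono hle
  have h2 := (eventually_pos_div hg (by simp [S.logRatio_zero]) hg').filter_mono hle
  obtain ⟨s, ⟨⟨h3, h4⟩, h5⟩, h6⟩ := (((h1.and h2).and
    (S.eventually_mul_exp_lt.filter_mono nhdsWithin_le_nhds)).and self_mem_nhdsWithin).exists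
  have h6 : 0 < s := h6
  have h7 : 0 < logRatio D L I ρ s := (div_pos_iff_of_pos_right h6).1 h3
  have h8 : 0 < s - logRatio D L I ρ s * (a - ε) := (div_pos_iff_of_pos_right h6).1 h4
  obtain ⟨K, hK, hb⟩ := S.mul_treeTerm_le_exp h5.le
  refine ⟨K, s - logRatio D L I ρ s * (a - ε), hK, h8, fun n m hmn hm => ?_⟩
  refine (hb n m hmn).trans ?_
  gcongr
  nlinarith [mul_le_mul_of_nonneg_left hm h7.le]

/-- The total weight of the rooted trees whose number of nodes deviates from its typical value. -/
noncomputable def deviant (D L I : PowerSeries ℝ) (ρ ε : ℝ) (n : ℕ) : ℝ := by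
  classical
  exact ∑ m ∈ Finset.range (n + 1) with ε < |((m : ℕ) : ℝ) / n - nodeDensity D L I ρ|,
    m * treeTerm D L I n m

lemma exists_deviant_le (S : Subcritical D L I ρ r) {ε : ℝ} (hε : 0 < ε) :
    ∃ K κ : ℝ, 0 < K ∧ 0 < κ ∧ ∀ n : ℕ, 0 < n →
      deviant D L I ρ ε n * ρ ^ n ≤ (n + 1) * (K * Real.exp (-(κ * n))) := by
  obtain ⟨K1, κ1, hK1, hκ1, h1⟩ := S.exists_upper_tail hε
  obtain ⟨K2, κ2, hK2, hκ2, h2⟩ := S.exists_lower_tail hε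
  refine ⟨max K1 K2, min κ1 κ2, lt_max_of_lt_left hK1, lt_min hκ1 hκ2, fun n hn => ?_⟩
  have hn' : (0 : ℝ) < n := by exact_mod_cast hn
  have hb1 : K1 * Real.exp (-(κ1 * n)) ≤ max K1 K2 * Real.exp (-(min κ1 κ2 * n)) := by
    gcongr
    · exact le_max_left _ _
    · exact min_le_left _ _
  have hb2 : K2 * Real.exp (-(κ2 * n)) ≤ max K1 K2 * Real.exp (-(min κ1 κ2 * n)) := by
    gcongr
    · exact le_max_right _ _
    · exact min_le_right _ _
  rw [deviant, Finset.sum_mul]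
  refine (Finset.sum_le_card_nsmul _ _ (max K1 K2 * Real.exp (-(min κ1 κ2 * n)))
    fun m hm => ?_).trans ?_
  · rw [Finset.mem_filter, Finset.mem_range, Nat.lt_succ_iff] at hm
    obtain ⟨hmn, hm⟩ := hm
    rcases lt_abs.1 hm with h | h
    · refine (h1 n m hmn ?_).trans hb1
      rw [lt_sub_iff_add_lt, lt_div_iff₀ hn'] at h
      linarith
    · refine (h2 n m hmn ?_).trans hb2
      rw [← div_le_iff₀ hn']
      linarith
  · rw [nsmul_eq_mul]
    have h3 : ((Finset.card (Finset.filter (fun m : ℕ => ε < |((m : ℕ) : ℝ) / n -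
        nodeDensity D L I ρ|) (Finset.range (n + 1))) : ℕ) : ℝ) ≤ n + 1 := by
      have := Finset.card_filter_le (Finset.range (n + 1))
        (fun m : ℕ => ε < |((m : ℕ) : ℝ) / n - nodeDensity D L I ρ|)
      rw [Finset.card_range] at this
      exact_mod_cast this
    have h4 : 0 ≤ max K1 K2 * Real.exp (-(min κ1 κ2 * n)) :=
      mul_nonneg (hK1.le.trans (le_max_left _ _)) (Real.exp_pos _).le
    exact mul_le_mul_of_nonneg_right h3 h4

end Subcritical

/-! ### Comparison of rooted and unrooted trees -/

namespace Subcritical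

variable {D L I : PowerSeries ℝ} {ρ r : ℝ}

lemma deviant_nonneg (S : Subcritical D L I ρ r) (ε : ℝ) (n : ℕ) : 0 ≤ deviant D L I ρ ε n :=
  Finset.sum_nonneg fun m _ => mul_nonneg (Nat.cast_nonneg m)
    (treeTerm_nonneg S.nonneg_edge S.nonneg_leaf S.nonneg_int n m)

/-- The deviant trees form an exponentially small proportion of all rooted trees; the factor `n`
leaves room for forgetting the root. -/
lemma exists_mul_deviant_le (S : Subcritical D L I ρ r) {c : ℝ} (hc : 0 < c)
    (hlim : Tendsto (fun n : ℕ => (n : ℝ) ^ (3 / 2 : ℝ) * (rootedTotal D L I n * ρ ^ n))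
      atTop (nhds c)) {ε : ℝ} (hε : 0 < ε) :
    ∃ κ : ℝ, 0 < κ ∧ ∀ᶠ n : ℕ in atTop,
      n * deviant D L I ρ ε n ≤ Real.exp (-(κ * n)) * rootedTotal D L I n := by
  obtain ⟨K, κ, hK, hκ, hdev⟩ := S.exists_deviant_le hε
  refine ⟨κ / 2, by positivity, ?_⟩
  have hq : |Real.exp (-(κ / 2))| < 1 := by
    rw [abs_of_pos (Real.exp_pos _), ← Real.exp_zero]
    exact Real.exp_lt_exp.2 (by linarith)
  have hpoly := tendsto_pow_const_mul_const_pow_of_abs_lt_one 4 hq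
  have hev := hpoly.eventually_lt_const (show (0 : ℝ) < c / (4 * K) by positivity)
  filter_upwards [hev, hlim.eventually_const_lt (half_lt_self hc), eventually_gt_atTop 0]
    with n h1 h2 hn
  have hn1 : (1 : ℝ) ≤ n := by exact_mod_cast hn
  have hn0 : (0 : ℝ) < n := by linarith
  have h3 := hdev n hn
  rw [← Real.exp_nat_mul] at h1
  have hρn : 0 < ρ ^ n := pow_pos S.radius_pos n
  have hR := S.rootedTotal_nonneg n
  have h4 : (n : ℝ) ^ (3 / 2 : ℝ) ≤ (n : ℝ) ^ 2 := by
    rw [← Real.rpow_natCast (n : ℝ) 2]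
    exact Real.rpow_le_rpow_of_exponent_le hn1 (by norm_num)
  have h5 : c / 2 ≤ (n : ℝ) ^ 2 * (rootedTotal D L I n * ρ ^ n) :=
    h2.le.trans (mul_le_mul_of_nonneg_right h4 (by positivity))
  set E := Real.exp (n * -(κ / 2)) with hE
  have hE0 : 0 < E := Real.exp_pos _
  have e1 : Real.exp (-(κ * n)) = E * E := by rw [hE, ← Real.exp_add]; congr 1; ring
  have e2 : Real.exp (-(κ / 2 * n)) = E := by rw [hE]; congr 1; ring
  rw [e1] at h3
  rw [e2]
  rw [lt_div_iff₀ (by positivity)] at h1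
  refine le_of_mul_le_mul_right ?_ hρn
  refine le_of_mul_le_mul_left ?_ (show (0 : ℝ) < n ^ 2 by positivity)
  calc (n : ℝ) ^ 2 * (n * deviant D L I ρ ε n * ρ ^ n)
      = n ^ 3 * (deviant D L I ρ ε n * ρ ^ n) := by ring
    _ ≤ n ^ 3 * ((n + 1) * (K * (E * E))) := by gcongr
    _ ≤ n ^ 3 * ((n + n) * (K * (E * E))) := by gcongr
    _ = (n ^ 4 * E * (4 * K)) * E / 2 := by ring
    _ ≤ c * E / 2 := by gcongr
    _ = (c / 2) * E := by ring
    _ ≤ (n ^ 2 * (rootedTotal D L I n * ρ ^ n)) * E := by gcongr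
    _ = n ^ 2 * (E * rootedTotal D L I n * ρ ^ n) := by ring

lemma eventually_rootedTotal_pos (S : Subcritical D L I ρ r) {c : ℝ} (hc : 0 < c)
    (hlim : Tendsto (fun n : ℕ => (n : ℝ) ^ (3 / 2 : ℝ) * (rootedTotal D L I n * ρ ^ n))
      atTop (nhds c)) : ∀ᶠ n : ℕ in atTop, 0 < rootedTotal D L I n := by
  filter_upwards [hlim.eventually_const_lt hc] with n hn
  refine (S.rootedTotal_nonneg n).lt_of_ne fun h => ?_
  rw [← h] at hn
  simp at hn

/-- On average a tree of size `n` has `a * n` nodes, which compares rooted and unrooted trees. -/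
lemma tendsto_rootedTotal_div (S : Subcritical D L I ρ r) {c : ℝ} (hc : 0 < c)
    (hlim : Tendsto (fun n : ℕ => (n : ℝ) ^ (3 / 2 : ℝ) * (rootedTotal D L I n * ρ ^ n))
      atTop (nhds c)) :
    Tendsto (fun n : ℕ => rootedTotal D L I n / (n * treeTotal D L I n)) atTop
      (nhds (nodeDensity D L I ρ)) := by
  have ha := S.nodeDensity_pos
  set a := nodeDensity D L I ρ with hadef
  rw [Metric.tendsto_nhds]
  intro ε hε
  obtain ⟨κ, hκ, hdev⟩ := S.exists_mul_deviant_le hc hlim (half_pos hε)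
  have hexp : Tendsto (fun n : ℕ => (1 + a) * Real.exp (-(κ * n))) atTop (nhds ((1 + a) * 0)) := by
    refine Tendsto.const_mul _ ?_
    exact Real.tendsto_exp_neg_atTop_nhds_zero.comp
      (tendsto_natCast_atTop_atTop.const_mul_atTop hκ)
  rw [mul_zero] at hexp
  filter_upwards [hdev, S.eventually_rootedTotal_pos hc hlim, eventually_gt_atTop 0,
    hexp.eventually_lt_const (half_pos hε)] with n h1 h2 hn h3
  have hn0 : (0 : ℝ) < n := by exact_mod_cast hn
  have hterm := treeTerm_nonneg S.nonneg_edge S.nonneg_leaf S.nonneg_int n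
  have hle := rootedTotal_le_mul_treeTotal S.nonneg_edge S.nonneg_leaf S.nonneg_int n
  have hA : 0 < n * treeTotal D L I n := h2.trans_le hle
  have hbad : ∀ m ∈ Finset.range (n + 1), |(m : ℝ) - a * n| * treeTerm D L I n m ≤
      ε / 2 * n * treeTerm D L I n m +
      (if ε / 2 < |((m : ℕ) : ℝ) / n - a| then (1 + a) * n * (m * treeTerm D L I n m) else 0) := by
    intro m hm
    have hmn : (m : ℝ) ≤ n := by exact_mod_cast Nat.lt_succ_iff.1 (Finset.mem_range.1 hm)
    have e : |(m : ℝ) - a * n| = |(m : ℝ) / n - a| * n := by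
      rw [← abs_of_pos hn0, ← abs_mul, abs_of_pos hn0]
      congr 1; field_simp
    split_ifs with h
    · have h4 : |(m : ℝ) - a * n| ≤ (1 + a) * n := by
        rw [abs_le]
        have := (Nat.cast_nonneg m : (0 : ℝ) ≤ m)
        constructor <;> nlinarith
      have h5 := treeTerm_le S.nonneg_edge S.nonneg_leaf S.nonneg_int n m
      have h6 : |(m : ℝ) - a * n| * treeTerm D L I n m ≤
          (1 + a) * n * (m * treeTerm D L I n m) :=
        mul_le_mul h4 h5 (hterm m) (by positivity)
      have h7 : 0 ≤ ε / 2 * n * treeTerm D L I n m := mul_nonneg (by positivity) (hterm m)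
      linarith
    · rw [add_zero, e]
      exact mul_le_mul_of_nonneg_right (mul_le_mul_of_nonneg_right (not_lt.1 h) hn0.le) (hterm m)
  have hsum : |rootedTotal D L I n - a * (n * treeTotal D L I n)| ≤
      ε / 2 * (n * treeTotal D L I n) + (1 + a) * (n * deviant D L I ρ (ε / 2) n) := by
    have e1 : rootedTotal D L I n - a * (n * treeTotal D L I n) =
        ∑ m ∈ Finset.range (n + 1), (m - a * n) * treeTerm D L I n m := by
      rw [rootedTotal_eq, treeTotal, Finset.mul_sum, Finset.mul_sum, ← Finset.sum_sub_distrib]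
      exact Finset.sum_congr rfl fun m _ => by ring
    rw [e1]
    refine (Finset.abs_sum_le_sum_abs _ _).trans ?_
    have e2 : ε / 2 * (n * treeTotal D L I n) + (1 + a) * (n * deviant D L I ρ (ε / 2) n) =
        ∑ m ∈ Finset.range (n + 1), (ε / 2 * n * treeTerm D L I n m +
        (if ε / 2 < |((m : ℕ) : ℝ) / n - a| then (1 + a) * n * (m * treeTerm D L I n m)
          else 0)) := by
      rw [Finset.sum_add_distrib, ← Finset.sum_filter, treeTotal, deviant, ← Finset.mul_sum,
        ← Finset.mul_sum, ← mul_assoc, ← mul_assoc]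
    rw [e2]
    refine Finset.sum_le_sum fun m hm => ?_
    rw [abs_mul, abs_of_nonneg (hterm m)]
    exact hbad m hm
  rw [Real.dist_eq]
  have e3 : rootedTotal D L I n / (n * treeTotal D L I n) - a =
      (rootedTotal D L I n - a * (n * treeTotal D L I n)) / (n * treeTotal D L I n) := by
    rw [sub_div, mul_div_assoc, div_self hA.ne', mul_one]
  rw [e3, abs_div, abs_of_pos hA, div_lt_iff₀ hA]
  refine hsum.trans_lt ?_
  have h8 : (1 + a) * (n * deviant D L I ρ (ε / 2) n) ≤
      (1 + a) * Real.exp (-(κ * n)) * (n * treeTotal D L I n) := by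
    rw [mul_assoc]
    refine mul_le_mul_of_nonneg_left (h1.trans ?_) (by positivity)
    exact mul_le_mul_of_nonneg_left hle (Real.exp_pos _).le
  nlinarith [mul_lt_mul_of_pos_right h3 hA]

lemma summable_rootedTotal (S : Subcritical D L I ρ r) {c : ℝ}
    (hlim : Tendsto (fun n : ℕ => (n : ℝ) ^ (3 / 2 : ℝ) * (rootedTotal D L I n * ρ ^ n))
      atTop (nhds c)) : Summable fun n => rootedTotal D L I n * ρ ^ n := by
  have hs : Summable fun n : ℕ => (c + 1) * (n : ℝ) ^ (-(3 / 2) : ℝ) :=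
    (Real.summable_nat_rpow.2 (by norm_num)).mul_left _
  refine hs.of_norm_bounded_eventually_nat ?_
  filter_upwards [hlim.eventually_lt_const (lt_add_one c), eventually_gt_atTop 0] with n h1 hn
  have hn0 : (0 : ℝ) < n := by exact_mod_cast hn
  rw [Real.norm_of_nonneg (mul_nonneg (S.rootedTotal_nonneg n)
    (pow_nonneg S.radius_nonneg n)), Real.rpow_neg hn0.le, ← div_eq_mul_inv,
    le_div_iff₀ (by positivity)]
  linarith

end Subcritical

/-! ### Generating functions of labelled classes -/

section Radius

variable {c : ℕ → ℝ} {t : ℝ}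

lemma summable_of_lt_radius (hc : ∀ n, 0 ≤ c n) (ht : 0 ≤ t)
    (h : ENNReal.ofReal t < (FormalMultilinearSeries.ofScalars ℝ c).radius) :
    Summable fun n => c n * t ^ n := by
  have h1 := (FormalMultilinearSeries.ofScalars ℝ c).summable_norm_mul_pow (r := t.toNNReal) h
  refine h1.congr fun n => ?_
  rw [FormalMultilinearSeries.ofScalars_norm, Real.norm_of_nonneg (hc n), Real.coe_toNNReal t ht]

lemma le_radius_of_summable (hc : ∀ n, 0 ≤ c n) (ht : 0 ≤ t)
    (h : Summable fun n => c n * t ^ n) :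
    ENNReal.ofReal t ≤ (FormalMultilinearSeries.ofScalars ℝ c).radius := by
  refine (FormalMultilinearSeries.ofScalars ℝ c).le_radius_of_summable_norm (r := t.toNNReal) ?_
  refine h.congr fun n => ?_
  rw [FormalMultilinearSeries.ofScalars_norm, Real.norm_of_nonneg (hc n), Real.coe_toNNReal t ht]

end Radius

lemma egfCoeff_nonneg (F : Finset ℕ → Type u) (n : ℕ) : 0 ≤ egfCoeff F n :=
  div_nonneg (Nat.cast_nonneg _) (Nat.cast_nonneg _)

lemma LabelledClass.coeffs_egf (C : LabelledClass.{u}) : coeffs C.egf = egfCoeff C.Obj := by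
  funext n
  simp [coeffs, LabelledClass.egf]

lemma LabelledClass.IsNonempty.exists_egf_ne_zero {C : LabelledClass.{u}} (h : C.IsNonempty) :
    ∃ n, coeffs C.egf n ≠ 0 := by
  obtain ⟨S, ⟨x⟩⟩ := h
  refine ⟨S.card, ?_⟩
  rw [C.coeffs_egf, egfCoeff]
  have hfin := C.finite (Finset.Icc 1 S.card)
  have hne : Nonempty (C.Obj (Finset.Icc 1 S.card)) :=
    ⟨C.relabel (Finset.equivOfCardEq (by simp)) x⟩
  have hpos : 0 < count C.Obj S.card := Nat.card_pos
  have : (0 : ℝ) < count C.Obj S.card := by exact_mod_cast hpos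
  positivity

section Count

variable (D : LabelledClass.{u}) (I : LabelledClass.{v}) (L : LabelledClass.{w})

lemma count_treeObj (n : ℕ) :
    (count (TreeObj D I L) n : ℝ) = n.factorial * treeTotal D.egf L.egf I.egf n := by
  have h := card_treeObj D I L n (fun _ => True)
  rw [Nat.card_congr (Equiv.subtypeUnivEquiv fun _ => trivial), Finset.filter_true] at h
  exact h

lemma count_rootedTreeObj (n : ℕ) :
    (count (RootedTreeObj D I L) n : ℝ) = n.factorial * rootedTotal D.egf L.egf I.egf n := by
  have h := card_rootedTreeObj D I L n (fun _ => True)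
  rw [Nat.card_congr (Equiv.subtypeUnivEquiv fun _ => trivial), Finset.filter_true] at h
  rw [rootedTotal_eq]
  exact h

lemma egfCoeff_treeObj (n : ℕ) : egfCoeff (TreeObj D I L) n = treeTotal D.egf L.egf I.egf n := by
  rw [egfCoeff, count_treeObj, mul_div_cancel_left₀ _ (by positivity)]

lemma egfCoeff_rootedTreeObj (n : ℕ) :
    egfCoeff (RootedTreeObj D I L) n = rootedTotal D.egf L.egf I.egf n := by
  rw [egfCoeff, count_rootedTreeObj, mul_div_cancel_left₀ _ (by positivity)]

lemma coeffs_egf_nonneg (C : LabelledClass.{u}) (n : ℕ) : 0 ≤ coeffs C.egf n := by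
  rw [C.coeffs_egf]
  exact egfCoeff_nonneg _ _

variable {D I L}

/-- The hypothesis on the radii of convergence, in terms of real power series. -/
lemma exists_subcritical (hD : D.IsNonempty) (hI : I.IsNonempty) (hL : L.IsNonempty)
    (hρ : egfRadius (TreeObj D I L) <
      min (egfRadius D.Obj) (min (egfRadius I.Obj) (egfRadius L.Obj))) :
    ∃ r, Subcritical D.egf L.egf I.egf (egfRadius (TreeObj D I L)).toReal r := by
  obtain ⟨r, h1, h2⟩ := ENNReal.lt_iff_exists_nnreal_btwn.1 hρ
  have hfin : egfRadius (TreeObj D I L) ≠ ⊤ := hρ.ne_top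
  rw [lt_min_iff, lt_min_iff] at h2
  have hsum : ∀ {C : ℕ → ℝ}, (∀ n, 0 ≤ C n) → (r : ENNReal) <
      (FormalMultilinearSeries.ofScalars ℝ C).radius → Summable fun n => C n * (r : ℝ) ^ n :=
    fun hC h => summable_of_lt_radius hC r.2 (by simpa using h)
  have hnnD := coeffs_egf_nonneg D
  have hnnL := coeffs_egf_nonneg L
  have hnnI := coeffs_egf_nonneg I
  have hA : egfCoeff (TreeObj D I L) = treeTotal D.egf L.egf I.egf :=
    funext (egfCoeff_treeObj D I L)
  have hA0 := treeTotal_nonneg hnnD hnnL hnnI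
  refine ⟨r, hnnD, hnnL, hnnI, hD.exists_egf_ne_zero, hL.exists_egf_ne_zero,
    hI.exists_egf_ne_zero, hsum hnnD (by rw [D.coeffs_egf]; exact h2.1),
    hsum hnnL (by rw [L.coeffs_egf]; exact h2.2.2),
    hsum hnnI (by rw [I.coeffs_egf]; exact h2.2.1), ENNReal.toReal_nonneg, ?_, ?_, ?_⟩
  · exact ENNReal.toReal_lt_of_lt_ofReal (by simpa using h1)
  · intro t ht htρ
    obtain ⟨s, hts, hsρ⟩ := exists_between htρ
    have hs0 : 0 < s := ht.trans_lt hts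
    have hs : Summable fun n => treeTotal D.egf L.egf I.egf n * s ^ n := by
      refine summable_of_lt_radius hA0 hs0.le ?_
      rw [← hA]
      exact (ENNReal.ofReal_lt_iff_lt_toReal hs0.le hfin).2 hsρ
    -- the factor `n` between rooted and unrooted trees is absorbed by enlarging `t` to `s`
    have hlim := tendsto_self_mul_const_pow_of_lt_one (div_nonneg ht hs0.le)
      ((div_lt_one hs0).2 hts)
    refine hs.of_norm_bounded_eventually_nat ?_
    filter_upwards [hlim.eventually_lt_const one_pos] with n hn
    have h3 := rootedTotal_le_mul_treeTotal hnnD hnnL hnnI n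
    have h4 := (hA0 n).trans (treeTotal_le_rootedTotal hnnD hnnL hnnI n)
    rw [Real.norm_of_nonneg (mul_nonneg h4 (pow_nonneg ht n))]
    have h5 : n * t ^ n ≤ s ^ n := by
      rw [div_pow, ← mul_div_assoc, div_lt_one (pow_pos hs0 n)] at hn
      exact hn.le
    calc _ ≤ n * treeTotal D.egf L.egf I.egf n * t ^ n :=
          mul_le_mul_of_nonneg_right h3 (pow_nonneg ht n)
      _ = treeTotal D.egf L.egf I.egf n * (n * t ^ n) := by ring
      _ ≤ _ := mul_le_mul_of_nonneg_left h5 (hA0 n)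
  · intro t htρ _ hs
    have ht : 0 ≤ t := ENNReal.toReal_nonneg.trans htρ.le
    have hs' : Summable fun n => treeTotal D.egf L.egf I.egf n * t ^ n :=
      hs.of_nonneg_of_le (fun n => mul_nonneg (hA0 n) (pow_nonneg ht n)) fun n =>
        mul_le_mul_of_nonneg_right (treeTotal_le_rootedTotal hnnD hnnL hnnI n) (pow_nonneg ht n)
    have h3 := le_radius_of_summable hA0 ht hs'
    rw [← hA] at h3
    have h4 : t ≤ (egfRadius (TreeObj D I L)).toReal := (ENNReal.ofReal_le_iff_le_toReal hfin).1 h3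
    exact absurd htρ (not_lt.2 h4)

/-- A unit whose powers agree on all the sizes of trees is trivial. -/
lemma eq_one_of_pow_eq_on_sizes
    (hper : ∃ i j k : ℕ, 0 < i ∧ 0 < j ∧ 0 < k ∧
      Int.gcd ((k : ℤ) - (i : ℤ)) ((j : ℤ) - (i : ℤ)) = 1 ∧
      Nonempty (OfSize (TreeObj D I L) i) ∧ Nonempty (OfSize (TreeObj D I L) j) ∧
      Nonempty (OfSize (TreeObj D I L) k)) {ζ η : ℂ} (hζ : ‖ζ‖ = 1)
    (h : ∀ n, rootedTotal D.egf L.egf I.egf n ≠ 0 → ζ ^ n = η) : ζ = 1 := by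
  obtain ⟨i, j, k, -, -, -, hgcd, hi, hj, hk⟩ := hper
  have hζ0 : ζ ≠ 0 := by rintro rfl; simp at hζ
  have hsize : ∀ n, Nonempty (OfSize (TreeObj D I L) n) → ζ ^ n = η := by
    intro n hn
    refine h n (ne_of_gt ?_)
    have h1 : (0 : ℝ) < count (TreeObj D I L) n := by
      have : 0 < count (TreeObj D I L) n := Nat.card_pos
      exact_mod_cast this
    rw [count_treeObj] at h1
    exact (pos_of_mul_pos_right h1 (by positivity)).trans_le (treeTotal_le_rootedTotal
      (coeffs_egf_nonneg D) (coeffs_egf_nonneg L) (coeffs_egf_nonneg I) n)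
  have hz : ∀ {n m : ℕ}, ζ ^ n = η → ζ ^ m = η → ζ ^ ((n : ℤ) - m) = 1 := by
    intro n m hn hm
    rw [zpow_sub₀ hζ0, zpow_natCast, zpow_natCast, hn, ← hm, div_self (pow_ne_zero _ hζ0)]
  have h1 := hz (hsize k hk) (hsize i hi)
  have h2 := hz (hsize j hj) (hsize i hi)
  have h3 := Int.gcd_eq_gcd_ab ((k : ℤ) - i) ((j : ℤ) - i)
  rw [hgcd] at h3
  have h4 : ζ ^ ((1 : ℕ) : ℤ) = 1 := by
    rw [h3, zpow_add₀ hζ0, zpow_mul, zpow_mul, h1, h2, one_zpow, one_zpow, one_mul]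
  simpa using h4

end Count

section Probability

variable {D : LabelledClass.{u}} {I : LabelledClass.{v}} {L : LabelledClass.{w}}

lemma uniformProb_rootedTreeObj (n : ℕ) (ρ ε : ℝ) :
    uniformProb (fun α : OfSize (RootedTreeObj D I L) n =>
      ε < |(α.treeSize : ℝ) / (n : ℝ) - Subcritical.nodeDensity D.egf L.egf I.egf ρ|) =
    Subcritical.deviant D.egf L.egf I.egf ρ ε n / rootedTotal D.egf L.egf I.egf n := by
  classical
  have h := card_rootedTreeObj D I L n
    (fun m => ε < |(m : ℝ) / (n : ℝ) - Subcritical.nodeDensity D.egf L.egf I.egf ρ|)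
  have h2 := count_rootedTreeObj D I L n
  rw [uniformProb, h]
  rw [count] at h2
  rw [h2, mul_div_mul_left _ _ (by positivity), Subcritical.deviant]
  congr

/-- Forgetting the root changes the probability of a deviant size by a factor at most `n`. -/
lemma uniformProb_treeObj_le (n : ℕ) (ρ ε : ℝ) (hpos : 0 < rootedTotal D.egf L.egf I.egf n) :
    uniformProb (fun α : OfSize (TreeObj D I L) n =>
      ε < |(α.treeSize : ℝ) / (n : ℝ) - Subcritical.nodeDensity D.egf L.egf I.egf ρ|) ≤
    n * Subcritical.deviant D.egf L.egf I.egf ρ ε n / rootedTotal D.egf L.egf I.egf n := by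
  classical
  have h := card_treeObj D I L n
    (fun m => ε < |(m : ℝ) / (n : ℝ) - Subcritical.nodeDensity D.egf L.egf I.egf ρ|)
  have h2 := count_treeObj D I L n
  have h3 := rootedTotal_le_mul_treeTotal (coeffs_egf_nonneg D) (coeffs_egf_nonneg L)
    (coeffs_egf_nonneg I) n
  have h4 : 0 < treeTotal D.egf L.egf I.egf n :=
    pos_of_mul_pos_right (hpos.trans_le h3) (Nat.cast_nonneg n)
  have h5 : (∑ m ∈ Finset.range (n + 1) with
      ε < |((m : ℕ) : ℝ) / (n : ℝ) - Subcritical.nodeDensity D.egf L.egf I.egf ρ|,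
        treeCoeff D I L n m) ≤ Subcritical.deviant D.egf L.egf I.egf ρ ε n := by
    have h6 := Finset.sum_le_sum (s := Finset.filter (fun m : ℕ =>
      ε < |(m : ℝ) / (n : ℝ) - Subcritical.nodeDensity D.egf L.egf I.egf ρ|)
        (Finset.range (n + 1))) fun m _ => treeTerm_le (coeffs_egf_nonneg D)
          (coeffs_egf_nonneg L) (coeffs_egf_nonneg I) n m
    refine h6.trans (le_of_eq ?_)
    rw [Subcritical.deviant]
  rw [uniformProb, h]
  rw [count] at h2
  rw [h2, mul_div_mul_left _ _ (by positivity), div_le_div_iff₀ h4 hpos]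
  have h7 : 0 ≤ Subcritical.deviant D.egf L.egf I.egf ρ ε n :=
    Finset.sum_nonneg fun m _ => mul_nonneg (Nat.cast_nonneg m) (treeTerm_nonneg
      (coeffs_egf_nonneg D) (coeffs_egf_nonneg L) (coeffs_egf_nonneg I) n m)
  calc _ ≤ Subcritical.deviant D.egf L.egf I.egf ρ ε n *
        (n * treeTotal D.egf L.egf I.egf n) := by gcongr
    _ = _ := by ring

end Probability

theorem theorem5p1 (D : LabelledClass.{u}) (I : LabelledClass.{v}) (L : LabelledClass.{w})
    (hD : D.IsNonempty) (hI : I.IsNonempty) (hL : L.IsNonempty)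
    (hρ : egfRadius (TreeObj D I L) <
      min (egfRadius D.Obj) (min (egfRadius I.Obj) (egfRadius L.Obj)))
    (hper : ∃ i j k : ℕ, 0 < i ∧ 0 < j ∧ 0 < k ∧
      Int.gcd ((k : ℤ) - (i : ℤ)) ((j : ℤ) - (i : ℤ)) = 1 ∧
      Nonempty (OfSize (TreeObj D I L) i) ∧ Nonempty (OfSize (TreeObj D I L) j) ∧
      Nonempty (OfSize (TreeObj D I L) k)) :
    ∃ a c : ℝ, 0 < a ∧ 0 < c ∧
      (∀ ε : ℝ, 0 < ε →
        ExpSmall (fun n : ℕ => uniformProb (fun α : OfSize (RootedTreeObj D I L) n =>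
          ε < |(α.treeSize : ℝ) / (n : ℝ) - a|)) ∧
        ExpSmall (fun n : ℕ => uniformProb (fun α : OfSize (TreeObj D I L) n =>
          ε < |(α.treeSize : ℝ) / (n : ℝ) - a|))) ∧
      (fun n : ℕ => (count (TreeObj D I L) n : ℝ)) ~[atTop]
        (fun n : ℕ => (a * (n : ℝ))⁻¹ * (count (RootedTreeObj D I L) n : ℝ)) ∧
      (fun n : ℕ => (count (TreeObj D I L) n : ℝ)) ~[atTop]
        (fun n : ℕ => c * a⁻¹ * (n : ℝ) ^ (-(5 / 2) : ℝ) * (n.factorial : ℝ) *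
          ((egfRadius (TreeObj D I L)).toReal ^ n)⁻¹) ∧
      Summable (fun n : ℕ =>
        egfCoeff (TreeObj D I L) n * (egfRadius (TreeObj D I L)).toReal ^ n) ∧
      Summable (fun n : ℕ =>
        egfCoeff (RootedTreeObj D I L) n * (egfRadius (TreeObj D I L)).toReal ^ n) := by
  obtain ⟨r, S⟩ := exists_subcritical hD hI hL hρ
  set ρ := (egfRadius (TreeObj D I L)).toReal
  obtain ⟨c, hc, hlim⟩ := S.exists_tendsto_rootedTotal
    fun ζ η hζ h => eq_one_of_pow_eq_on_sizes hper hζ h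
  have ha := S.nodeDensity_pos
  have hratio := S.tendsto_rootedTotal_div hc hlim
  have hRpos := S.eventually_rootedTotal_pos hc hlim
  have hle := treeTotal_le_rootedTotal S.nonneg_edge S.nonneg_leaf S.nonneg_int
  have hA0 := treeTotal_nonneg S.nonneg_edge S.nonneg_leaf S.nonneg_int
  have hsum := S.summable_rootedTotal hlim
  have hratio' := (hratio.inv₀ ha.ne').const_mul (Subcritical.nodeDensity D.egf L.egf I.egf ρ)
  rw [mul_inv_cancel₀ ha.ne'] at hratio'
  refine ⟨Subcritical.nodeDensity D.egf L.egf I.egf ρ, c, ha, hc, fun ε hε => ?_, ?_, ?_, ?_, ?_⟩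
  · obtain ⟨κ, hκ, hdev⟩ := S.exists_mul_deviant_le hc hlim hε
    refine ⟨⟨κ, hκ, ?_⟩, ⟨κ, hκ, ?_⟩⟩
    · filter_upwards [hdev, hRpos, eventually_gt_atTop 0] with n h1 h2 hn
      have hn1 : (1 : ℝ) ≤ n := by exact_mod_cast hn
      rw [uniformProb_rootedTreeObj, div_le_iff₀ h2]
      refine le_trans ?_ h1
      have := S.deviant_nonneg ε n
      nlinarith
    · filter_upwards [hdev, hRpos] with n h1 h2
      refine (uniformProb_treeObj_le n ρ ε h2).trans ?_
      rwa [div_le_iff₀ h2]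
  · refine isEquivalent_of_tendsto_one (hratio'.congr' ?_)
    filter_upwards with n
    simp only [Pi.div_apply, count_treeObj, count_rootedTreeObj]
    have hf : (n.factorial : ℝ) ≠ 0 := by positivity
    have e : (Subcritical.nodeDensity D.egf L.egf I.egf ρ * n)⁻¹ *
        (n.factorial * rootedTotal D.egf L.egf I.egf n) = n.factorial *
        ((Subcritical.nodeDensity D.egf L.egf I.egf ρ * n)⁻¹ *
          rootedTotal D.egf L.egf I.egf n) := by ring
    rw [e, mul_div_mul_left _ _ hf, inv_div, mul_inv]
    field_simp
  · have hlim' := hratio'.mul (hlim.div_const c)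
    rw [div_self hc.ne', one_mul] at hlim'
    refine isEquivalent_of_tendsto_one (hlim'.congr' ?_)
    filter_upwards [hRpos, eventually_gt_atTop 0] with n h2 hn
    have hn0 : (0 : ℝ) < n := by exact_mod_cast hn
    have hρn : ρ ^ n ≠ 0 := (pow_pos S.radius_pos n).ne'
    have hf : (n.factorial : ℝ) ≠ 0 := by positivity
    have e5 : (n : ℝ) ^ (-(5 / 2) : ℝ) = ((n : ℝ) ^ (3 / 2 : ℝ) * n)⁻¹ := by
      rw [Real.rpow_neg hn0.le, ← Real.rpow_add_one hn0.ne']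
      norm_num
    have h6 : (n : ℝ) ^ (3 / 2 : ℝ) ≠ 0 := (Real.rpow_pos_of_pos hn0 _).ne'
    simp only [Pi.div_apply, count_treeObj]
    rw [e5]
    field_simp
  · refine Summable.of_nonneg_of_le (fun n => ?_) (fun n => ?_) hsum
    · exact mul_nonneg (egfCoeff_nonneg _ n) (pow_nonneg S.radius_nonneg n)
    · rw [egfCoeff_treeObj]
      exact mul_le_mul_of_nonneg_right (hle n) (pow_nonneg S.radius_nonneg n)
  · refine hsum.congr fun n => ?_
    rw [egfCoeff_rootedTreeObj]
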